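/- **Theorem 5.1.** *Machines.* A probabilistic Turing machine (PTM) has a two-way read-only input tape, on which the input stands between two end-markers, one read/write work tape, and finitely many states, each of which is coin-tossing, deterministic, accepting or rejecting; in a coin-tossing state the next step depends also on a fresh fair random bit. A PTM (or a probabilistic multihead automaton) *recognizes a language $L$ with unbounded error* if, for every input $x$, $x\in L$ if and only if $x$ is accepted with probability greater than $\tfrac12$. It uses at most $r(n)$ random bits if on inputs of length $n$ each of its computations tosses at most $r(n)$ coins; its space is the number of work tape cells visited, in the worst case over all inputs of length $n$ and all outcomes of the coin tosses. $\mathsf{SPACE}(s)$ is the class of languages decided by deterministic Turing machines (with a read-only input tape and a fixed number of work tapes) in space $O(s(n))$, and $\mathsf{L}=\mathsf{SPACE}(\log n)$. A function $f:\mathbb N\to\mathbb N$ is *computable in space $s(n)$* if a deterministic Turing machine computes the binary representation of $f(n)$ from $1^n$ in space $O(s(n))$, and $s$ is *space constructible* if $s$ is computable in space $s(n)$. (In all space bounds $O(s(n))$ is read as $O(s(n)+1)$.) For $k\ge 1$, a 2pfa($k$) is a probabilistic finite automaton with $k$ two-way heads on a read-only input tape on which the input stands between two end-markers; a 2dfa($k$)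 is a 2pfa($k$) without coin-tossing states. *Statement.* Let $r,s:\mathbb N\to\mathbb N$ be such that $s(n)$ is space constructible, $r(n)$ is computable in space $s(n)$, and $r(n)\in O(s(n))$. Then every language over a finite alphabet that is recognized with unbounded error by a PTM that uses at most $r(n)$ random bits and $O(s(n))$ space belongs to $\mathsf{SPACE}(s)$. Moreover, over every finite alphabet, the class of languages recognized with unbounded error by 2pfa($k$)'s, $k\ge1$, that use $O(\log n)$ random bits is equal to $\mathsf{L}$, and also to the class of languages recognized by 2dfa($k$)'s, $k\ge 1$. -/

import Mathlib

open MeasureTheory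

/-! ## Input tape, head moves, control states

The input `x` is written between two occurrences of one end-marker: cell `0` and cell
`x.length + 1` hold the end-marker, cells `1, …, x.length` hold the letters of `x`.
Head moves are elements of `SignType = {-1, 0, 1}`. -/

/-- Content of cell `p` of the input tape holding `x`; `none` is the end-marker. -/
def inputSymbol {α : Type*} (x : List α) (p : ℕ) : Option α :=
  if p = 0 then none else x[p - 1]?

/-- Move of an input head on an input of length `n`. The head never leaves the cells
`0, …, n + 1`: a move beyond an end-marker leaves it where it is. -/
def moveInput (n : ℕ) (d : SignType) (p : ℕ) : ℕ :=
  match d with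
  | .neg => p - 1
  | .zero => p
  | .pos => min (p + 1) (n + 1)

/-- The control states of a machine: the non-halting states `q : Q`, one accepting and one
rejecting halting state. -/
inductive Control (Q : Type) : Type
  | run (q : Q)
  | accept
  | reject

/-! ## Random bits -/

/-- The law of an infinite sequence of independent fair coin tosses. -/
noncomputable def coinMeasure : Measure (ℕ → Bool) :=
  Measure.infinitePi fun _ => (PMF.uniformOfFintype Bool).toMeasure

/-- The computation from the configuration `c₀`, given the sequence `ω` of coin tosses.
A configuration with `tosses c = true` tosses a coin in its next step, whose outcome is the first
unused bit of `ω`; in the other configurations `step` ignores the bit. The second component of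
`coinRun step tosses c₀ ω t` is the number of coins tossed in the first `t` steps. -/
def coinRun {C : Type*} (step : Bool → C → C) (tosses : C → Bool) (c₀ : C) (ω : ℕ → Bool) :
    ℕ → C × ℕ
  | 0 => (c₀, 0)
  | t + 1 =>
    let p := coinRun step tosses c₀ ω t
    (step (ω p.2) p.1, if tosses p.1 then p.2 + 1 else p.2)

/-! ## Probabilistic Turing machines -/

/-- A probabilistic Turing machine with a two-way read-only input tape and a single read/write
work tape. Its states are the coin-tossing states `R`, the deterministic states `D`, and the two
halting states; the start state is not halting. A transition yields the next state, the symbol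
written on the work tape, the move of the input head and the move of the work head. -/
structure PTM (α : Type*) where
  R : Type
  D : Type
  Γ : Type
  finR : Finite R
  finD : Finite D
  finΓ : Finite Γ
  blank : Γ
  start : R ⊕ D
  δR : R → Option α → Γ → Bool → Control (R ⊕ D) × Γ × SignType × SignType
  δD : D → Option α → Γ → Control (R ⊕ D) × Γ × SignType × SignType

namespace PTM

variable {α : Type*} (M : PTM α)

/-- Configurations: state, input head position, work tape content, work head position. -/
structure Config where
  state : Control (M.R ⊕ M.D)
  inPos : ℕ
  tape : ℤ → M.Γ
  workPos : ℤ

/-- At the start both heads are on cell `0`, and the work tape is blank. -/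
def init : M.Config := ⟨.run M.start, 0, fun _ => M.blank, 0⟩

variable {M}

/-- Does the machine toss a coin in the next step? -/
def Config.tosses (c : M.Config) : Bool :=
  match c.state with
  | .run (.inl _) => true
  | _ => false

/-- The effect of a transition on a configuration. -/
def Config.apply (x : List α) (c : M.Config)
    (a : Control (M.R ⊕ M.D) × M.Γ × SignType × SignType) : M.Config :=
  ⟨a.1, moveInput x.length a.2.2.1 c.inPos, Function.update c.tape c.workPos a.2.1,
    c.workPos + (a.2.2.2 : ℤ)⟩

/-- One step on input `x`; `b` is the outcome of the coin toss, if there is one. -/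
def Config.step (x : List α) (b : Bool) (c : M.Config) : M.Config :=
  match c.state with
  | .run (.inl q) => c.apply x (M.δR q (inputSymbol x c.inPos) (c.tape c.workPos) b)
  | .run (.inr q) => c.apply x (M.δD q (inputSymbol x c.inPos) (c.tape c.workPos))
  | .accept => c
  | .reject => c

variable (M)

/-- Configuration and number of tossed coins after `t` steps. -/
def run (x : List α) (ω : ℕ → Bool) (t : ℕ) : M.Config × ℕ :=
  coinRun (Config.step x) Config.tosses M.init ω t

/-- The probability that `M` accepts `x`. -/
noncomputable def acceptProb (x : List α) : ENNReal :=
  coinMeasure {ω | ∃ t, (M.run x ω t).1.state = .accept}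

/-- `M` recognizes `L` with (two-sided) unbounded error: exactly the members of `L` are accepted
with probability greater than `1/2`. -/
def RecognizesUnbounded (L : Language α) : Prop :=
  ∀ x : List α, x ∈ L ↔ 1 / 2 < M.acceptProb x

/-- On inputs of length `n`, every computation of `M` tosses at most `r n` coins. -/
def UsesRandomBits (r : ℕ → ℕ) : Prop :=
  ∀ (x : List α) (ω : ℕ → Bool) (t : ℕ), (M.run x ω t).2 ≤ r x.length

/-- The number of work tape cells visited in the computation on `x` with coin tosses `ω`. -/
noncomputable def cellsUsed (x : List α) (ω : ℕ → Bool) : ℕ∞ :=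
  Set.encard {p : ℤ | ∃ t, (M.run x ω t).1.workPos = p}

/-- `M` runs in space `O(s(n))`, in the worst case over all computations. The summand `1` accounts
for the cell that the work head always occupies; it matters only where `s n = 0`. -/
def RunsInSpace (s : ℕ → ℕ) : Prop :=
  ∃ C : ℕ, ∀ (x : List α) (ω : ℕ → Bool),
    M.cellsUsed x ω ≤ ((C * (s x.length + 1) : ℕ) : ℕ∞)

end PTM

/-- The languages over `α` recognized with unbounded error by probabilistic Turing machines that
use at most `r(n)` random bits and `O(s(n))` space. -/
def ptmClass (α : Type*) (r s : ℕ → ℕ) : Set (Language α) :=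
  {L | ∃ M : PTM α, M.UsesRandomBits r ∧ M.RunsInSpace s ∧ M.RecognizesUnbounded L}

/-! ## Deterministic Turing machines and deterministic space -/

/-- A deterministic Turing machine with a two-way read-only input tape and `k + 1` read/write work
tapes. A transition yields the next state, the symbols written on the work tapes, the move of the
input head and the moves of the work heads. -/
structure DTM (α : Type*) where
  k : ℕ
  Q : Type
  Γ : Type
  finQ : Finite Q
  finΓ : Finite Γ
  blank : Γ
  start : Q
  δ : Q → Option α → (Fin (k + 1) → Γ) →
    Control Q × (Fin (k + 1) → Γ) × SignType × (Fin (k + 1) → SignType)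

namespace DTM

variable {α : Type*} (M : DTM α)

/-- Configurations: state, input head position, work tape contents, work head positions. -/
structure Config where
  state : Control M.Q
  inPos : ℕ
  tape : Fin (M.k + 1) → ℤ → M.Γ
  workPos : Fin (M.k + 1) → ℤ

/-- At the start all heads are on cell `0`, and the work tapes are blank. -/
def init : M.Config := ⟨.run M.start, 0, fun _ _ => M.blank, fun _ => 0⟩

variable {M}

/-- The effect of a transition on a configuration. -/
def Config.apply (x : List α) (c : M.Config)
    (a : Control M.Q × (Fin (M.k + 1) → M.Γ) × SignType × (Fin (M.k + 1) → SignType)) :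
    M.Config :=
  ⟨a.1, moveInput x.length a.2.2.1 c.inPos,
    fun i => Function.update (c.tape i) (c.workPos i) (a.2.1 i),
    fun i => c.workPos i + (a.2.2.2 i : ℤ)⟩

/-- One step on input `x`. -/
def Config.step (x : List α) (c : M.Config) : M.Config :=
  match c.state with
  | .run q => c.apply x (M.δ q (inputSymbol x c.inPos) fun i => c.tape i (c.workPos i))
  | .accept => c
  | .reject => c

variable (M)

/-- The configuration after `t` steps on input `x`. -/
def run (x : List α) (t : ℕ) : M.Config := (Config.step x)^[t] M.init

/-- `M` decides `L`: it accepts the members of `L` and rejects all other inputs; in particular it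
halts on every input. -/
def Decides (L : Language α) : Prop :=
  ∀ x : List α, (x ∈ L → ∃ t, (M.run x t).state = .accept) ∧
    (x ∉ L → ∃ t, (M.run x t).state = .reject)

/-- The total number of work tape cells visited in the computation on `x`. -/
noncomputable def cellsUsed (x : List α) : ℕ∞ :=
  Set.encard {c : Fin (M.k + 1) × ℤ | ∃ t, (M.run x t).workPos c.1 = c.2}

/-- `M` runs in space `O(s(n))`. -/
def RunsInSpace (s : ℕ → ℕ) : Prop :=
  ∃ C : ℕ, ∀ x : List α, M.cellsUsed x ≤ ((C * (s x.length + 1) : ℕ) : ℕ∞)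

/-- On input `x` the machine halts in its accepting state, with the binary representation of `m`
(least significant digit first, `digit b` standing for the digit `b`) on work tape `0`, from cell
`0` on and followed by blanks. -/
def Outputs (digit : Bool → M.Γ) (x : List α) (m : ℕ) : Prop :=
  ∃ t, (M.run x t).state = .accept ∧
    ∀ j : ℕ, (M.run x t).tape 0 (j : ℤ) = (m.bits[j]?).elim M.blank digit

end DTM

/-- The function `f` is computable in space `O(s(n))`: some deterministic Turing machine that runs
in space `O(s(n))` transforms the input `1ⁿ` into the binary representation of `f n`. -/
def ComputableInSpace (f s : ℕ → ℕ) : Prop :=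
  ∃ (M : DTM Unit) (digit : Bool → M.Γ), Function.Injective digit ∧
    (∀ b, digit b ≠ M.blank) ∧ M.RunsInSpace s ∧
    ∀ n : ℕ, M.Outputs digit (List.replicate n ()) (f n)

/-- `s` is space constructible: `1ⁿ ↦ s(n)` is computable in space `O(s(n))`. -/
def SpaceConstructible (s : ℕ → ℕ) : Prop := ComputableInSpace s s

/-- `SPACE(s)`: the languages over `α` decided by deterministic Turing machines in space
`O(s(n))`. -/
def SPACE (α : Type*) (s : ℕ → ℕ) : Set (Language α) :=
  {L | ∃ M : DTM α, M.RunsInSpace s ∧ M.Decides L}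

/-- The class `L` (over `α`) of languages decided in deterministic logarithmic space. -/
def LogSpace (α : Type*) : Set (Language α) := SPACE α (Nat.log 2)

/-! ## Multihead finite automata -/

/-- A probabilistic finite automaton with `k` two-way heads on the input tape (a 2pfa(`k`)), with
coin-tossing states `R`, deterministic states `D` and two halting states. A transition depends on
the symbols under the heads and yields the next state and the moves of the heads. -/
structure MultiheadPFA (α : Type*) (k : ℕ) where
  R : Type
  D : Type
  finR : Finite R
  finD : Finite D
  start : R ⊕ D
  δR : R → (Fin k → Option α) → Bool → Control (R ⊕ D) × (Fin k → SignType)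
  δD : D → (Fin k → Option α) → Control (R ⊕ D) × (Fin k → SignType)

namespace MultiheadPFA

variable {α : Type*} {k : ℕ} (P : MultiheadPFA α k)

/-- Configurations: state and head positions. -/
structure Config where
  state : Control (P.R ⊕ P.D)
  pos : Fin k → ℕ

/-- At the start all heads are on the left end-marker. -/
def init : P.Config := ⟨.run P.start, fun _ => 0⟩

variable {P}

/-- Does the automaton toss a coin in the next step? -/
def Config.tosses (c : P.Config) : Bool :=
  match c.state with
  | .run (.inl _) => true
  | _ => false

/-- The effect of a transition on a configuration. -/
def Config.apply (x : List α) (c : P.Config) (a : Control (P.R ⊕ P.D) × (Fin k → SignType)) :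
    P.Config :=
  ⟨a.1, fun i => moveInput x.length (a.2 i) (c.pos i)⟩

/-- One step on input `x`; `b` is the outcome of the coin toss, if there is one. -/
def Config.step (x : List α) (b : Bool) (c : P.Config) : P.Config :=
  match c.state with
  | .run (.inl q) => c.apply x (P.δR q (fun i => inputSymbol x (c.pos i)) b)
  | .run (.inr q) => c.apply x (P.δD q fun i => inputSymbol x (c.pos i))
  | .accept => c
  | .reject => c

variable (P)

/-- Configuration and number of tossed coins after `t` steps. -/
def run (x : List α) (ω : ℕ → Bool) (t : ℕ) : P.Config × ℕ :=
  coinRun (Config.step x) Config.tosses P.init ω t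

/-- `P` accepts `x` when the coin tosses are `ω`. -/
def Accepts (x : List α) (ω : ℕ → Bool) : Prop :=
  ∃ t, (P.run x ω t).1.state = .accept

/-- The probability that `P` accepts `x`. -/
noncomputable def acceptProb (x : List α) : ENNReal := coinMeasure {ω | P.Accepts x ω}

/-- `P` recognizes `L` with (two-sided) unbounded error. -/
def RecognizesUnbounded (L : Language α) : Prop :=
  ∀ x : List α, x ∈ L ↔ 1 / 2 < P.acceptProb x

/-- On inputs of length `n`, every computation of `P` tosses at most `O(log n)` coins. -/
def UsesLogRandomBits : Prop :=
  ∃ C : ℕ, ∀ (x : List α) (ω : ℕ → Bool) (t : ℕ),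
    (P.run x ω t).2 ≤ C * (Nat.log 2 x.length + 1)

end MultiheadPFA

/-- The languages over `α` recognized with unbounded error by probabilistic two-way multihead
finite automata that use `O(log n)` random bits. -/
def logRandomMultiheadPFA (α : Type*) : Set (Language α) :=
  {L | ∃ k : ℕ, 1 ≤ k ∧ ∃ P : MultiheadPFA α k, P.UsesLogRandomBits ∧ P.RecognizesUnbounded L}

/-- The languages over `α` recognized by deterministic two-way multihead finite automata: the
automata without coin-tossing states, whose computation does not depend on `ω`. -/
def multiheadDFA (α : Type*) : Set (Language α) :=
  {L | ∃ k : ℕ, 1 ≤ k ∧ ∃ P : MultiheadPFA α k, IsEmpty P.R ∧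
    ∀ (x : List α) (ω : ℕ → Bool), x ∈ L ↔ P.Accepts x ω}

-- Once the outcomes of the coins are fixed, a probabilistic machine is deterministic. In a window
-- of size `S` (work cells `-S, …, S`, coins `0, …, S`) there are `2 ^ (S + 1)` blocks of coins, and
-- a binary counter on a tape runs through them. Acceptance with probability greater than `1/2`
-- means that more than `2 ^ S` blocks accept (`half_lt_coinMeasure_iff`). A second counter with `S
-- + 1` bits, started at `2 ^ S - 1` and increased for every accepting block, overflows exactly in
-- this case (`CoinProg.runs_coinLoop`).
--
-- The difficulty is that the machine may run forever on a fixed block. A clock could be too large: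
-- the number of configurations grows with the length of the input, and `s` may be below the
-- logarithm. Instead, the simulation walks around the graph of configurations. A label from a
-- finite set describes how a step is undone, so from a configuration one can go to its successor
-- and to each of its predecessors. The walk is injective on a finite set (`TourSystem.tour_injOn`),
-- hence returns to its start, and the halting configurations it exhausts are precisely those
-- reached by the computation (`TourSystem.tour_halted_iff`). It needs one configuration and a
-- bounded amount of control. To recognize the start, one has to know that the simulated work tape
-- is blank; a head on a separate tape keeps the number of nonblank cells as its distance from the
-- origin (`CoinProg.atStart_iff`).
--
-- Leaving the window counts as halting, and the same walk detects it. So the simulation tries `S =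
-- 0, 1, 2, …` until no block leaves the window (`CoinProg.runs_majority`). The first such `S` is at
-- most the true space and coin bound, and for it acceptance depends on the first `S + 1` coins only
-- (`CoinProg.run_eq_of_not_overflows`). This gives `CoinProg.mem_SPACE`.
--
-- The equalities for multihead automata are a cycle of inclusions. Head positions are numbers of
-- logarithmic length, so a probabilistic program can hold them in binary counters on one work tape
-- and toss the same coins (`MultiheadPFA.simulate_spec`); the derandomization then applies to `s =
-- Nat.log 2`. Conversely, `K` heads are the digits of a number below `(n + 2) ^ K`. The two halves
-- of a tape of logarithmic size are numbers of this kind, and a head move multiplies one by the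
-- size of the alphabet and divides the other (`computes_shiftTape`). Deterministic automata are
-- probabilistic ones that toss no coins.
--
-- All simulations are finite-state programs built from single steps by sequencing and loops. A
-- statement about a run carries a predicate on all stores met on the way; for the space bounds it
-- limits the head positions.

universe u


/-! ## Structured programs -/

/-- A finite-state program fragment: in each state it looks at an observation, performs an action,
and goes to another state or leaves the fragment with an exit value. -/
structure Prog (O : Type u) (A E : Type) where
  Q : Type
  fin : Finite Q
  start : Q
  next : Q → O → (Q ⊕ E) × A

/-- The stores on which programs work. -/
structure StoreModel (O : Type u) (A S : Type) where
  obs : S → O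
  act : A → S → S

namespace Prog

variable {O : Type u} {A E F X S : Type}

/-- A single step. -/
def op (f : O → E × A) : Prog O A E where
  Q := Unit
  fin := inferInstance
  start := ()
  next _ o := (.inr (f o).1, (f o).2)

/-- Sequential composition. -/
def bind [Finite E] (m : Prog O A E) (f : E → Prog O A F) : Prog O A F where
  Q := m.Q ⊕ Σ e, (f e).Q
  fin := by
    have := m.fin
    have := fun e => (f e).fin
    infer_instance
  start := .inl m.start
  next
    | .inl q, o =>
      (match (m.next q o).1 with
        | .inl q' => .inl (.inl q')
        | .inr e => .inl (.inr ⟨e, (f e).start⟩), (m.next q o).2)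
    | .inr ⟨e, q⟩, o =>
      (match ((f e).next q o).1 with
        | .inl q' => .inl (.inr ⟨e, q'⟩)
        | .inr e' => .inr e', ((f e).next q o).2)

/-- A loop with a loop variable of type `X`. -/
def iter [Finite X] (m : X → Prog O A (X ⊕ E)) (a : X) : Prog O A E where
  Q := Σ a, (m a).Q
  fin := by
    have := fun e => (m e).fin
    infer_instance
  start := ⟨a, (m a).start⟩
  next
    | ⟨a, q⟩, o =>
      (match ((m a).next q o).1 with
        | .inl q' => .inl ⟨a, q'⟩
        | .inr (.inl b) => .inl ⟨b, (m b).start⟩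
        | .inr (.inr e) => .inr e, ((m a).next q o).2)

end Prog

/-! ### Semantics of programs: finite runs, sequencing, loops. -/

namespace StoreModel

variable {O : Type u} {A E F X S : Type} (M : StoreModel O A S)

/-- One step of a program; a program that has been left stays as it is. -/
def step (m : Prog O A E) : (m.Q ⊕ E) × S → (m.Q ⊕ E) × S
  | (.inl q, s) => ((m.next q (M.obs s)).1, M.act (m.next q (M.obs s)).2 s)
  | (.inr e, s) => (.inr e, s)

@[simp] lemma step_inr (m : Prog O A E) (e : E) (s : S) :
    M.step m (.inr e, s) = (.inr e, s) := rfl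

lemma step_inl (m : Prog O A E) (q : m.Q) (s : S) :
    M.step m (.inl q, s) = ((m.next q (M.obs s)).1, M.act (m.next q (M.obs s)).2 s) := rfl

/-- A finite computation all of whose stores satisfy `P`. -/
inductive Reach (m : Prog O A E) (P : S → Prop) : m.Q ⊕ E → S → m.Q ⊕ E → S → Prop
  | refl {a s} : P s → Reach m P a s a s
  | head {q s a s'} : P s →
      Reach m P (m.next q (M.obs s)).1 (M.act (m.next q (M.obs s)).2 s) a s' →
      Reach m P (.inl q) s a s'

/-- Started on the store `s`, the program is left with exit value `e` and store `s'`, and all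
stores on the way satisfy `P`. -/
def Runs (m : Prog O A E) (P : S → Prop) (s : S) (e : E) (s' : S) : Prop :=
  M.Reach m P (.inl m.start) s (.inr e) s'

variable {M}

lemma Reach.trans {m : Prog O A E} {P : S → Prop} {a b c s t r}
    (h : M.Reach m P a s b t) (h' : M.Reach m P b t c r) : M.Reach m P a s c r := by
  induction h with
  | refl _ => exact h'
  | head h1 _ ih => exact .head h1 (ih h')

lemma Reach.mono {m : Prog O A E} {P P' : S → Prop} (hP : ∀ s, P s → P' s) {a b s t}
    (h : M.Reach m P a s b t) : M.Reach m P' a s b t := by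
  induction h with
  | refl h => exact .refl (hP _ h)
  | head h1 _ ih => exact .head (hP _ h1) ih

lemma Reach.right {m : Prog O A E} {P : S → Prop} {a b s t}
    (h : M.Reach m P a s b t) : P t := by
  induction h <;> assumption

lemma Runs.mono {m : Prog O A E} {P P' : S → Prop} (hP : ∀ s, P s → P' s) {e s t}
    (h : M.Runs m P s e t) : M.Runs m P' s e t := Reach.mono hP h

lemma Runs.op {P : S → Prop} {s : S} (f : O → E × A) (h : P s)
    (h' : P (M.act (f (M.obs s)).2 s)) :
    M.Runs (.op f) P s (f (M.obs s)).1 (M.act (f (M.obs s)).2 s) :=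
  .head h (.refl h')

lemma Runs.op' {P : S → Prop} {s s' : S} {f : O → E × A} {e : E} {a : A}
    (hf : f (M.obs s) = (e, a)) (ha : M.act a s = s') (h : P s) (h' : P s') :
    M.Runs (.op f) P s e s' := by
  have := Runs.op (M := M) (P := P) (s := s) f h (by rw [hf]; simpa [ha] using h')
  simpa [hf, ha] using this

/-- The states of both parts embed into those of the composition, and an exit of the first part with
value `e` is embedded as the start of `f e`; so the two runs can be joined. -/
lemma Runs.bind [Finite E] {m : Prog O A E} {f : E → Prog O A F} {P : S → Prop} {s e s' e' s''}
    (h : M.Runs m P s e s') (h' : M.Runs (f e) P s' e' s'') :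
    M.Runs (m.bind f) P s e' s'' := by
  let i : m.Q ⊕ E → (m.bind f).Q ⊕ F
    | .inl q => .inl (.inl q)
    | .inr e => .inl (.inr ⟨e, (f e).start⟩)
  let j : (f e).Q ⊕ F → (m.bind f).Q ⊕ F
    | .inl q => .inl (.inr ⟨e, q⟩)
    | .inr e => .inr e
  have hi : ∀ {a s b t}, M.Reach m P a s b t → M.Reach (m.bind f) P (i a) s (i b) t := by
    intro a s b t h
    induction h with
    | refl h => exact .refl h
    | @head q s a s' h1 _ ih =>
      refine .head h1 ?_
      have : (m.bind f).next (.inl q) (M.obs s) =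
          (i (m.next q (M.obs s)).1, (m.next q (M.obs s)).2) := by
        cases hq : (m.next q (M.obs s)).1 <;> simp [Prog.bind, i, hq]
      rwa [this]
  have hj : ∀ {a s b t}, M.Reach (f e) P a s b t → M.Reach (m.bind f) P (j a) s (j b) t := by
    intro a s b t h
    induction h with
    | refl h => exact .refl h
    | @head q s a s' h1 _ ih =>
      refine .head h1 ?_
      have : (m.bind f).next (.inr ⟨e, q⟩) (M.obs s) =
          (j ((f e).next q (M.obs s)).1, ((f e).next q (M.obs s)).2) := by
        cases hq : ((f e).next q (M.obs s)).1 <;> simp [Prog.bind, j, hq]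
      rwa [this]
  exact (hi h).trans (hj h')

lemma Reach.iter [Finite X] {m : X → Prog O A (X ⊕ E)} {x y : X} {P : S → Prop}
    {a s b t} (h : M.Reach (m x) P a s b t) :
    let i : (m x).Q ⊕ (X ⊕ E) → (Σ x, (m x).Q) ⊕ E := fun
      | .inl q => .inl ⟨x, q⟩
      | .inr (.inl z) => .inl ⟨z, (m z).start⟩
      | .inr (.inr e) => .inr e
    M.Reach (Prog.iter m y) P (i a) s (i b) t := by
  intro i
  induction h with
  | refl h => exact .refl h
  | @head q s a s' h1 _ ih =>
    refine .head h1 ?_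
    have : (Prog.iter m y).next ⟨x, q⟩ (M.obs s) =
        (i ((m x).next q (M.obs s)).1, ((m x).next q (M.obs s)).2) := by
      rcases hq : ((m x).next q (M.obs s)).1 with _ | _ | _ <;> simp [Prog.iter, i, hq]
    rwa [this]

/-- Loops with different initial loop values differ in their start state only; the transition
function does not mention it. -/
lemma Reach.iter_congr [Finite X] {m : X → Prog O A (X ⊕ E)} {x y : X} {P : S → Prop}
    {a s b t} (h : M.Reach (Prog.iter m x) P a s b t) : M.Reach (Prog.iter m y) P a s b t := by
  induction h with
  | refl h => exact .refl h
  | head h1 _ ih => exact .head h1 ih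

lemma Runs.iter_next [Finite X] {m : X → Prog O A (X ⊕ E)} {x y : X} {P : S → Prop} {s s' e s''}
    (h : M.Runs (m x) P s (.inl y) s') (h' : M.Runs (.iter m y) P s' e s'') :
    M.Runs (.iter m x) P s e s'' := by
  have h2 := Reach.iter_congr (y := x) h'
  exact (Reach.iter (y := x) h).trans h2

lemma Runs.iter_exit [Finite X] {m : X → Prog O A (X ⊕ E)} {x : X} {P : S → Prop} {s s' e}
    (h : M.Runs (m x) P s (.inr e) s') : M.Runs (.iter m x) P s e s' :=
  Reach.iter (y := x) h

/-- Several rounds of a loop, then an exit. -/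
lemma Runs.iter_of_seq [Finite X] {m : X → Prog O A (X ⊕ E)} {P : S → Prop} (T : ℕ)
    (x : ℕ → X) (s : ℕ → S) {e s'}
    (h : ∀ i < T, M.Runs (m (x i)) P (s i) (.inl (x (i + 1))) (s (i + 1)))
    (h' : M.Runs (m (x T)) P (s T) (.inr e) s') : M.Runs (.iter m (x 0)) P (s 0) e s' := by
  induction T generalizing x s with
  | zero => exact .iter_exit h'
  | succ T ih =>
    exact .iter_next (h 0 (by omega)) (ih (fun i => x (i + 1)) (fun i => s (i + 1))
      (fun i hi => h (i + 1) (by omega)) h')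

lemma Reach.iterate {m : Prog O A E} {P : S → Prop} {a b s t} (h : M.Reach m P a s b t) :
    ∃ n, (M.step m)^[n] (a, s) = (b, t) ∧ ∀ i ≤ n, P ((M.step m)^[i] (a, s)).2 := by
  induction h with
  | @refl a s h => exact ⟨0, rfl, fun i hi => by obtain rfl : i = 0 := by omega
                                                 exact h⟩
  | @head q s a s' h1 _ ih =>
    obtain ⟨n, h2, h3⟩ := ih
    refine ⟨n + 1, by simpa [step_inl] using h2, fun i hi => ?_⟩
    cases i with
    | zero => exact h1
    | succ i => simpa [step_inl] using h3 i (by omega)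

lemma iterate_inr {m : Prog O A E} (e : E) (s : S) (n : ℕ) :
    (M.step m)^[n] (.inr e, s) = (.inr e, s) := by
  induction n with
  | zero => rfl
  | succ n ih => simpa using ih

/-- A program that has been left no longer changes its store, so a property of all stores of the
finite run holds at all times. -/
lemma Runs.iterate {m : Prog O A E} {P : S → Prop} {e s t} (h : M.Runs m P s e t) :
    (∃ n, (M.step m)^[n] (.inl m.start, s) = (.inr e, t)) ∧
    ∀ i, P ((M.step m)^[i] (.inl m.start, s)).2 := by
  obtain ⟨n, h1, h2⟩ := Reach.iterate h
  refine ⟨⟨n, h1⟩, fun i => ?_⟩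
  by_cases hi : i ≤ n
  · exact h2 i hi
  · obtain ⟨j, rfl⟩ : ∃ j, i = j + n := ⟨i - n, by omega⟩
    rw [Function.iterate_add_apply, h1, iterate_inr]
    exact Reach.right h

/-- An endless loop. -/
lemma iter_forever [Finite X] {m : X → Prog O A (X ⊕ E)} {P : S → Prop} (x : ℕ → X) (s : ℕ → S)
    (h : ∀ i, M.Runs (m (x i)) P (s i) (.inl (x (i + 1))) (s (i + 1))) (n : ℕ) :
    (∃ q, ((M.step (.iter m (x 0)))^[n] (.inl (Prog.iter m (x 0)).start, s 0)).1 = .inl q) ∧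
      P ((M.step (.iter m (x 0)))^[n] (.inl (Prog.iter m (x 0)).start, s 0)).2 := by
  suffices H : ∀ n i, (∃ q, ((M.step (.iter m (x 0)))^[n]
        (.inl ⟨x i, (m (x i)).start⟩, s i)).1 = .inl q) ∧
      P ((M.step (.iter m (x 0)))^[n] (.inl ⟨x i, (m (x i)).start⟩, s i)).2 from H n 0
  intro n
  induction n using Nat.strong_induction_on with
  | _ n ih =>
    intro i
    -- A round starts in a state of the program and ends with an exit value, so it takes at least
    -- one step; this is what makes the strong induction on `n` work.
    obtain ⟨k, hk0, hk, hP⟩ : ∃ k, k ≠ 0 ∧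
        (M.step (.iter m (x 0)))^[k] (.inl ⟨x i, (m (x i)).start⟩, s i) =
          (.inl ⟨x (i + 1), (m (x (i + 1))).start⟩, s (i + 1)) ∧
        ∀ j ≤ k, P ((M.step (.iter m (x 0)))^[j] (.inl ⟨x i, (m (x i)).start⟩, s i)).2 := by
      cases h i with
      | head h1 h2 =>
        obtain ⟨k, hk, hP⟩ := (Reach.iter (y := x 0) h2).iterate
        refine ⟨k + 1, by omega, ?_, fun j hj => ?_⟩
        · exact hk
        · cases j with
          | zero => exact h1
          | succ j => exact hP j (by omega)
    by_cases hn : n < k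
    · refine ⟨?_, hP n hn.le⟩
      rcases hq : ((M.step (.iter m (x 0)))^[n] (.inl ⟨x i, (m (x i)).start⟩, s i)) with ⟨q | e, t⟩
      · exact ⟨q, rfl⟩
      -- Had the loop been left before step `k`, it would still be left at step `k`.
      · exfalso
        obtain ⟨j, rfl⟩ : ∃ j, k = j + n := ⟨k - n, by omega⟩
        rw [Function.iterate_add_apply, hq, iterate_inr] at hk
        simp at hk
    · obtain ⟨j, rfl⟩ : ∃ j, n = j + k := ⟨n - k, by omega⟩
      rw [Function.iterate_add_apply, hk]
      exact ih j (by omega) (i + 1)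

end StoreModel


/-! ## Tape stores and deterministic Turing machines -/

section Input

variable {α : Type u}

/-- Is the input head on the left end-marker? This follows from its last move, from the answer
before that move, and from the symbol it reads. -/
def leftFlag (d : SignType) (prev : Bool) (a : Option α) : Bool :=
  match d with
  | .neg => a.isNone
  | .zero => prev
  | .pos => false

lemma moveInput_le {n p : ℕ} (d : SignType) (h : p ≤ n + 1) : moveInput n d p ≤ n + 1 := by
  cases d <;> simp [moveInput] <;> omega

lemma inputSymbol_isNone {x : List α} {p : ℕ} :
    (inputSymbol x p).isNone = decide (p = 0 ∨ x.length < p) := by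
  unfold inputSymbol
  by_cases h : p = 0
  · simp [h]
  · simp only [h, if_false, false_or]
    rw [Bool.eq_iff_iff]
    simp
    omega

/-- The two end-markers look alike, but after a move to the left only the left one can be under the
head, and after a move to the right the head is not on cell `0`. -/
lemma leftFlag_moveInput {x : List α} {p : ℕ} (d : SignType) (h : p ≤ x.length + 1) :
    leftFlag d (decide (p = 0)) (inputSymbol x (moveInput x.length d p)) =
      decide (moveInput x.length d p = 0) := by
  cases d
  · rfl
  · rw [leftFlag, inputSymbol_isNone, decide_eq_decide]
    change p - 1 = 0 ∨ _ < p - 1 ↔ p - 1 = 0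
    omega
  · simp [leftFlag, moveInput]

end Input

/-- Input head position, tape contents and head positions. -/
@[ext] structure TapeStore (Γ : Type) (k : ℕ) where
  inPos : ℕ
  tape : Fin (k + 1) → ℤ → Γ
  workPos : Fin (k + 1) → ℤ

/-- The store model of deterministic Turing machines, with a flag that tells whether the input head
is on the left end-marker. -/
def tapeModel {α : Type u} (Γ : Type) (k : ℕ) (x : List α) :
    StoreModel (Bool × Option α × (Fin (k + 1) → Γ))
      ((Fin (k + 1) → Γ) × SignType × (Fin (k + 1) → SignType)) (TapeStore Γ k) where
  obs σ := (decide (σ.inPos = 0), inputSymbol x σ.inPos, fun i => σ.tape i (σ.workPos i))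
  act a σ := ⟨moveInput x.length a.2.1 σ.inPos,
    fun i => Function.update (σ.tape i) (σ.workPos i) (a.1 i),
    fun i => σ.workPos i + (a.2.2 i : ℤ)⟩

/-- The control state of a machine after leaving a decision program or not. -/
def controlOf {Q Q' : Type} (f : Q → Q') : Q ⊕ Bool → Control Q'
  | .inl q => .run (f q)
  | .inr true => .accept
  | .inr false => .reject

/-- The Turing machine that runs a decision program. -/
def Prog.toDTM {α : Type u} {Γ : Type} {k : ℕ} [Finite Γ] (b : Γ)
    (m : Prog (Bool × Option α × (Fin (k + 1) → Γ))
      ((Fin (k + 1) → Γ) × SignType × (Fin (k + 1) → SignType)) Bool) : DTM α where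
  k := k
  Q := m.Q × SignType × Bool
  Γ := Γ
  finQ := by
    have := m.fin
    infer_instance
  finΓ := inferInstance
  blank := b
  start := (m.start, .zero, true)
  δ q a g :=
    let l := leftFlag q.2.1 q.2.2 a
    let r := m.next q.1 (l, a, g)
    (controlOf (fun q' => (q', r.2.2.1, l)) r.1, r.2)

/-- The control keeps the last input move and the flag before that move; the present flag is
computed only when the next symbol is visible. The invariant is that this delayed computation is
correct. The pair is existentially quantified since a halted control state does not contain it. -/
lemma Prog.toDTM_run {α : Type u} {Γ : Type} {k : ℕ} [Finite Γ] (b : Γ)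
    (m : Prog (Bool × Option α × (Fin (k + 1) → Γ))
      ((Fin (k + 1) → Γ) × SignType × (Fin (k + 1) → SignType)) Bool) (x : List α) (t : ℕ) :
    let c := ((tapeModel Γ k x).step m)^[t] (.inl m.start, ⟨0, fun _ _ => b, fun _ => 0⟩)
    let c' := (m.toDTM b).run x t
    c'.inPos = c.2.inPos ∧ c'.tape = c.2.tape ∧ c'.workPos = c.2.workPos ∧
      c.2.inPos ≤ x.length + 1 ∧
      ∃ d f, c'.state = controlOf (fun q => (q, d, f)) c.1 ∧
        leftFlag d f (inputSymbol x c.2.inPos) = decide (c.2.inPos = 0) := by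
  induction t with
  | zero =>
    refine ⟨rfl, rfl, rfl, Nat.zero_le _, .zero, true, rfl, rfl⟩
  | succ t ih =>
    simp only [DTM.run, Function.iterate_succ_apply'] at ih ⊢
    generalize ((tapeModel Γ k x).step m)^[t] (.inl m.start, ⟨0, fun _ _ => b, fun _ => 0⟩) = c at *
    generalize (DTM.Config.step x)^[t] (m.toDTM b).init = c' at *
    obtain ⟨h1, h2, h3, h4, d, f, h5, h6⟩ := ih
    obtain ⟨c1, c2⟩ := c
    obtain ⟨st, ip, tp, wp⟩ := c'
    dsimp only at h1 h2 h3 h4 h5 h6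
    subst h1 h2 h3
    rcases c1 with q | e
    · have h7 : m.next q (leftFlag d f (inputSymbol x c2.inPos), inputSymbol x c2.inPos,
          fun i => c2.tape i (c2.workPos i)) = m.next q ((tapeModel Γ k x).obs c2) := by
        rw [h6]; rfl
      rw [StoreModel.step_inl]
      subst h5
      simp only [DTM.Config.step, controlOf, DTM.Config.apply]
      refine ⟨?_, ?_, ?_, moveInput_le _ h4, ((m.next q ((tapeModel Γ k x).obs c2)).2.2.1),
        decide (c2.inPos = 0), ?_, leftFlag_moveInput _ h4⟩
      · exact congrArg (fun r => moveInput x.length r.2.2.1 c2.inPos) h7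
      · exact congrArg (fun r => fun i => Function.update (c2.tape i) (c2.workPos i) (r.2.1 i)) h7
      · exact congrArg (fun r => fun i => c2.workPos i + (r.2.2.2 i : ℤ)) h7
      · rw [← h7, ← h6]; rfl
    · rw [StoreModel.step_inr]
      subst h5
      rcases e with _ | _
      · exact ⟨rfl, rfl, rfl, h4, d, f, rfl, h6⟩
      · exact ⟨rfl, rfl, rfl, h4, d, f, rfl, h6⟩

/-- A program that decides `L` and keeps its work heads within distance `O(s(n))` of the origin
shows that `L` belongs to `SPACE(s)`. -/
theorem mem_SPACE_of_prog {α : Type u} {Γ : Type} {k : ℕ} [Finite Γ] (b : Γ)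
    (m : Prog (Bool × Option α × (Fin (k + 1) → Γ))
      ((Fin (k + 1) → Γ) × SignType × (Fin (k + 1) → SignType)) Bool) (L : Language α)
    (s : ℕ → ℕ) (C : ℕ)
    (h : ∀ x : List α, ∃ e σ, (e = true ↔ x ∈ L) ∧
      (tapeModel Γ k x).Runs m (fun σ => ∀ i, |σ.workPos i| ≤ ((C * (s x.length + 1) : ℕ) : ℤ))
        ⟨0, fun _ _ => b, fun _ => 0⟩ e σ) :
    L ∈ SPACE α s := by
  -- Each of the `k + 1` heads visits at most `2 * B + 1` cells, where `B = C * (s n + 1)`, and `2 *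
  -- B + 1 ≤ (2 * C + 1) * (s n + 1)`.
  refine ⟨m.toDTM b, ⟨(k + 1) * (2 * C + 1), fun x => ?_⟩, fun x => ?_⟩
  · obtain ⟨e, σ, -, hr⟩ := h x
    have hP := hr.iterate.2
    set B := C * (s x.length + 1)
    have hsub : {c : Fin (k + 1) × ℤ | ∃ t, ((m.toDTM b).run x t).workPos c.1 = c.2} ⊆
        ((Finset.univ ×ˢ Finset.Icc (-(B : ℤ)) B : Finset (Fin (k + 1) × ℤ)) :
          Set (Fin (k + 1) × ℤ)) := by
      rintro ⟨i, p⟩ ⟨t, ht⟩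
      have h1 := (m.toDTM_run b x t).2.2.1
      have h2 := hP t i
      rw [← h1] at h2
      have h3 : ((m.toDTM b).run x t).workPos i = p := ht
      rw [h3] at h2
      simpa [abs_le] using h2
    refine (Set.encard_le_encard hsub).trans ?_
    rw [Set.encard_coe_eq_coe_finsetCard]
    norm_cast
    simp only [Finset.card_product, Finset.card_univ, Fintype.card_fin, Int.card_Icc]
    have : ((B : ℤ) + 1 - -(B : ℤ)).toNat = 2 * B + 1 := by omega
    rw [this]
    calc (k + 1) * (2 * B + 1) ≤ (k + 1) * ((2 * C + 1) * (s x.length + 1)) := by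
          gcongr
          simp only [B]
          ring_nf
          omega
      _ = _ := by ring
  · obtain ⟨e, σ, he, hr⟩ := h x
    obtain ⟨t, ht⟩ := hr.iterate.1
    obtain ⟨-, -, -, -, d, f, hs, -⟩ := m.toDTM_run b x t
    have hs' : ((m.toDTM b).run x t).state = controlOf (fun q => (q, d, f)) (.inr e) := by
      rw [hs, ht]
    rcases e with _ | _
    · exact ⟨fun hx => absurd (he.2 hx) (by simp), fun _ => ⟨t, hs'⟩⟩
    · exact ⟨fun _ => ⟨t, hs'⟩, fun hx => absurd (he.1 rfl) hx⟩

/-! ## Multihead automata -/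

/-- The store model of multihead automata, with flags that tell which heads are on the left
end-marker. -/
def headModel {α : Type u} (H : Type) (x : List α) :
    StoreModel (H → Bool × Option α) (H → SignType) (H → ℕ) where
  obs σ h := (decide (σ h = 0), inputSymbol x (σ h))
  act a σ h := moveInput x.length (a h) (σ h)

/-- The deterministic multihead automaton that runs a decision program. -/
def Prog.toMultihead {α : Type u} {H : Type} [Finite H] {k : ℕ} (e : H ≃ Fin k)
    (m : Prog (H → Bool × Option α) (H → SignType) Bool) : MultiheadPFA α k where
  R := Empty
  D := m.Q × (H → SignType × Bool)
  finR := inferInstance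
  finD := by
    have := m.fin
    infer_instance
  start := .inr (m.start, fun _ => (.zero, true))
  δR q := q.elim
  δD q a :=
    let l : H → Bool := fun h => leftFlag (q.2 h).1 (q.2 h).2 (a (e h))
    let r := m.next q.1 fun h => (l h, a (e h))
    (controlOf (fun q' => .inr (q', fun h => (r.2 h, l h))) r.1, fun i => r.2 (e.symm i))

/-- The same invariant as in `Prog.toDTM_run`, with one delayed flag for each head. -/
lemma Prog.toMultihead_run {α : Type u} {H : Type} [Finite H] {k : ℕ} (e : H ≃ Fin k)
    (m : Prog (H → Bool × Option α) (H → SignType) Bool) (x : List α) (ω : ℕ → Bool) (t : ℕ) :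
    let c := ((headModel H x).step m)^[t] (.inl m.start, fun _ => 0)
    let c' := ((m.toMultihead e).run x ω t).1
    c'.pos = (fun i => c.2 (e.symm i)) ∧ (∀ h, c.2 h ≤ x.length + 1) ∧
      ∃ f : H → SignType × Bool, c'.state = controlOf (fun q => .inr (q, f)) c.1 ∧
        ∀ h, leftFlag (f h).1 (f h).2 (inputSymbol x (c.2 h)) = decide (c.2 h = 0) := by
  induction t with
  | zero =>
    refine ⟨rfl, fun _ => Nat.zero_le _, fun _ => (.zero, true), rfl, fun _ => rfl⟩
  | succ t ih =>
    simp only [MultiheadPFA.run, Function.iterate_succ_apply', coinRun] at ih ⊢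
    generalize ((headModel H x).step m)^[t] (.inl m.start, fun _ => 0) = c at *
    generalize (coinRun (MultiheadPFA.Config.step x) MultiheadPFA.Config.tosses
      (m.toMultihead e).init ω t) = c' at *
    obtain ⟨h1, h4, f, h5, h6⟩ := ih
    obtain ⟨c1, c2⟩ := c
    obtain ⟨⟨st, ps⟩, cn⟩ := c'
    dsimp only at h1 h4 h5 h6
    subst h1
    rcases c1 with q | e'
    · have h7 : m.next q (fun h => (leftFlag (f h).1 (f h).2 (inputSymbol x (c2 (e.symm (e h)))),
          inputSymbol x (c2 (e.symm (e h))))) = m.next q ((headModel H x).obs c2) := by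
        congr 1
        funext h
        simp only [Equiv.symm_apply_apply, h6]
        rfl
      rw [StoreModel.step_inl]
      subst h5
      simp only [MultiheadPFA.Config.step, controlOf, MultiheadPFA.Config.apply]
      refine ⟨?_, fun h => moveInput_le _ (h4 h),
        fun h => ((m.next q ((headModel H x).obs c2)).2 h, decide (c2 h = 0)), ?_,
        fun h => leftFlag_moveInput _ (h4 h)⟩
      · exact congrArg (fun r => fun i => moveInput x.length (r.2 (e.symm i)) (c2 (e.symm i))) h7
      · rw [← h7]
        have h8 : (fun h => decide (c2 h = 0)) =
            fun h => leftFlag (f h).1 (f h).2 (inputSymbol x (c2 (e.symm (e h)))) := by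
          funext h
          simp only [Equiv.symm_apply_apply, h6]
        have h9 : ∀ h, decide (c2 h = 0) =
            leftFlag (f h).1 (f h).2 (inputSymbol x (c2 (e.symm (e h)))) := congrFun h8
        simp only [h9]
        rfl
    · rw [StoreModel.step_inr]
      subst h5
      rcases e' with _ | _
      · exact ⟨rfl, h4, f, rfl, h6⟩
      · exact ⟨rfl, h4, f, rfl, h6⟩

theorem mem_multiheadDFA_of_prog {α : Type u} {H : Type} [Finite H] [Nonempty H]
    (m : Prog (H → Bool × Option α) (H → SignType) Bool) (L : Language α)
    (h : ∀ x : List α, ∃ e σ, (e = true ↔ x ∈ L) ∧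
      (headModel H x).Runs m (fun _ => True) (fun _ => 0) e σ) :
    L ∈ multiheadDFA α := by
  have := Fintype.ofFinite H
  refine ⟨Fintype.card H, Fintype.card_pos, m.toMultihead (Fintype.equivFin H),
    inferInstanceAs (IsEmpty Empty), fun x ω => ?_⟩
  obtain ⟨e, σ, he, hr⟩ := h x
  obtain ⟨t, ht⟩ := hr.iterate.1
  rw [← he]
  constructor
  · rintro rfl
    obtain ⟨-, -, f, hs, -⟩ := m.toMultihead_run (Fintype.equivFin H) x ω t
    exact ⟨t, by rw [hs, ht]; rfl⟩
  · rintro ⟨t', ht'⟩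
    obtain ⟨-, -, f, hs, -⟩ := m.toMultihead_run (Fintype.equivFin H) x ω t'
    rw [ht'] at hs
    rcases hc : (((headModel H x).step m)^[t'] (.inl m.start, fun _ => 0)) with ⟨q | e', σ'⟩
    · rw [hc] at hs
      simp [controlOf] at hs
    · rw [hc] at hs
      -- A program that has been left stands still, so the state after `t + t'` steps is both that
      -- after `t` and that after `t'` steps: only one exit value is possible.
      have h1 := congrArg ((headModel H x).step m)^[t'] ht
      rw [← Function.iterate_add_apply, add_comm, Function.iterate_add_apply, hc,
        StoreModel.iterate_inr, StoreModel.iterate_inr] at h1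
      obtain ⟨rfl, -⟩ : e' = e ∧ σ' = σ := by simpa using h1
      rcases e' with _ | _
      · simp [controlOf] at hs
      · rfl

/-! ## Probabilistic programs -/

/-- Input head position, contents of the work tape and position of its head, and number of coins
tossed. -/
@[ext] structure CoinStore (Γ : Type) where
  inPos : ℕ
  tape : ℤ → Γ
  workPos : ℤ
  coin : ℤ

/-- Move on the sequence of coins. -/
def coinMove : Bool → SignType
  | true => .pos
  | false => .zero

/-- The store model of probabilistic Turing machines that toss the coins `ω`. A program sees the
outcome of the next coin toss and decides whether to proceed to the next coin. -/
def coinModel {α : Type u} (Γ : Type) (x : List α) (ω : ℕ → Bool) :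
    StoreModel (Option α × Γ × Bool) (Γ × SignType × SignType × Bool) (CoinStore Γ) where
  obs σ := (inputSymbol x σ.inPos, σ.tape σ.workPos, ω σ.coin.toNat)
  act a σ := ⟨moveInput x.length a.2.1 σ.inPos, Function.update σ.tape σ.workPos a.1,
    σ.workPos + (a.2.2.1 : ℤ), σ.coin + (coinMove a.2.2.2 : ℤ)⟩

abbrev CoinProg (α : Type u) (Γ : Type) :=
  Prog (Option α × Γ × Bool) (Γ × SignType × SignType × Bool) Bool

/-- The initial store. -/
def CoinStore.init {Γ : Type} (b : Γ) : CoinStore Γ := ⟨0, fun _ => b, 0, 0⟩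

/-- The computation of a probabilistic program. -/
def CoinProg.run {α : Type u} {Γ : Type} (m : CoinProg α Γ) (b : Γ) (x : List α) (ω : ℕ → Bool)
    (t : ℕ) : (m.Q ⊕ Bool) × CoinStore Γ :=
  ((coinModel Γ x ω).step m)^[t] (.inl m.start, .init b)

def CoinProg.Accepts {α : Type u} {Γ : Type} (m : CoinProg α Γ) (b : Γ) (x : List α)
    (ω : ℕ → Bool) : Prop :=
  ∃ t, (m.run b x ω t).1 = .inr true

/-- Exit value of a halting control state. -/
def Control.toSum {Q : Type} : Control Q → Q ⊕ Bool
  | .run q => .inl q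
  | .accept => .inr true
  | .reject => .inr false

/-- A probabilistic Turing machine as a program. -/
def PTM.toProg {α : Type u} (M : PTM α) : CoinProg α M.Γ where
  Q := M.R ⊕ M.D
  fin := by
    have := M.finR
    have := M.finD
    infer_instance
  start := M.start
  next
    | .inl q, o =>
      let r := M.δR q o.1 o.2.1 o.2.2
      (r.1.toSum, r.2.1, r.2.2.1, r.2.2.2, true)
    | .inr q, o =>
      let r := M.δD q o.1 o.2.1
      (r.1.toSum, r.2.1, r.2.2.1, r.2.2.2, false)

lemma PTM.toProg_run {α : Type u} (M : PTM α) (x : List α) (ω : ℕ → Bool) (t : ℕ) :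
    M.toProg.run M.blank x ω t = ((M.run x ω t).1.state.toSum,
      ⟨(M.run x ω t).1.inPos, (M.run x ω t).1.tape, (M.run x ω t).1.workPos, (M.run x ω t).2⟩) := by
  induction t with
  | zero => rfl
  | succ t ih =>
    simp only [CoinProg.run, PTM.run, coinRun, Function.iterate_succ_apply'] at ih ⊢
    rw [ih]
    generalize coinRun (PTM.Config.step x) PTM.Config.tosses M.init ω t = c
    obtain ⟨⟨q, ip, tp, wp⟩, n⟩ := c
    rcases q with (q | q) | _ | _
    · simp [Control.toSum, StoreModel.step, PTM.toProg, PTM.Config.step, PTM.Config.tosses,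
        coinModel, PTM.Config.apply, coinMove]
    · simp [Control.toSum, StoreModel.step, PTM.toProg, PTM.Config.step, PTM.Config.tosses,
        coinModel, PTM.Config.apply, coinMove]
    · rfl
    · rfl

lemma PTM.toProg_accepts {α : Type u} (M : PTM α) (x : List α) (ω : ℕ → Bool) :
    M.toProg.Accepts M.blank x ω ↔ ∃ t, (M.run x ω t).1.state = .accept := by
  refine exists_congr fun t => ?_
  rw [M.toProg_run]
  rcases (M.run x ω t).1.state with _ | _ | _
  · simp [Control.toSum]
  · exact ⟨fun _ => rfl, fun _ => rfl⟩
  · exact ⟨fun h => Bool.noConfusion (Sum.inr_injective h), fun h => (by cases h)⟩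

/-- A walk on `ℤ` that starts at `0` stays within a distance less than the number of visited
points. -/
lemma abs_walk_le {w : ℕ → ℤ} (h0 : w 0 = 0) (h1 : ∀ t, |w (t + 1) - w t| ≤ 1) {B : ℕ}
    (hB : Set.encard {p | ∃ t, w t = p} ≤ B) (t : ℕ) : |w t| ≤ B := by
  -- With steps of size at most one the walk skips no integer between `0` and its present position.
  have key : ∀ t, ∀ p ∈ Set.uIcc 0 (w t), ∃ t, w t = p := by
    intro t
    induction t with
    | zero =>
      intro p hp
      rw [h0] at hp
      exact ⟨0, by rw [h0]; simp at hp; omega⟩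
    | succ t ih =>
      intro p hp
      by_cases hpt : p ∈ Set.uIcc 0 (w t)
      · exact ih p hpt
      · refine ⟨t + 1, ?_⟩
        have := abs_le.1 (h1 t)
        rw [Set.mem_uIcc] at hp hpt
        omega
  have h2 : Set.uIcc 0 (w t) ⊆ {p | ∃ t, w t = p} := fun p hp => key t p hp
  have h3 := (Set.encard_le_encard h2).trans hB
  rw [← Finset.coe_uIcc, Set.encard_coe_eq_coe_finsetCard] at h3
  norm_cast at h3
  rw [Int.card_uIcc] at h3
  rw [Int.abs_eq_natAbs]
  simp only [sub_zero] at h3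
  omega

lemma signType_abs_le (d : SignType) : |(d : ℤ)| ≤ 1 := by
  cases d <;> simp

lemma PTM.abs_workPos_le {α : Type u} (M : PTM α) {s : ℕ → ℕ} {C : ℕ}
    (h : ∀ (x : List α) (ω : ℕ → Bool),
      M.cellsUsed x ω ≤ ((C * (s x.length + 1) : ℕ) : ℕ∞)) (x : List α) (ω : ℕ → Bool) (t : ℕ) :
    |(M.run x ω t).1.workPos| ≤ ((C * (s x.length + 1) : ℕ) : ℤ) := by
  refine abs_walk_le (w := fun t => (M.run x ω t).1.workPos) rfl (fun t => ?_) (h x ω) t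
  simp only [PTM.run, coinRun]
  generalize coinRun (PTM.Config.step x) PTM.Config.tosses M.init ω t = c
  obtain ⟨⟨q, ip, tp, wp⟩, n⟩ := c
  rcases q with (q | q) | _ | _ <;>
    simp [PTM.Config.step, PTM.Config.apply, signType_abs_le]

lemma DTM.abs_workPos_le {α : Type u} (M : DTM α) {B : ℕ} {x : List α}
    (h : M.cellsUsed x ≤ B) (i : Fin (M.k + 1)) (t : ℕ) : |(M.run x t).workPos i| ≤ B := by
  refine abs_walk_le (w := fun t => (M.run x t).workPos i) rfl (fun t => ?_) (le_trans ?_ h) t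
  · simp only [DTM.run, Function.iterate_succ_apply']
    generalize (DTM.Config.step x)^[t] M.init = c
    obtain ⟨q, ip, tp, wp⟩ := c
    rcases q with q | _ | _ <;> simp [DTM.Config.step, DTM.Config.apply, signType_abs_le]
  · rw [← (Prod.mk_right_injective i).encard_image]
    refine Set.encard_le_encard ?_
    rintro _ ⟨p, ⟨t, ht⟩, rfl⟩
    exact ⟨t, ht⟩

/-! ## Counting coin tosses -/

instance : IsProbabilityMeasure coinMeasure := by
  unfold coinMeasure
  infer_instance

lemma coinMeasure_cylinder (N : ℕ) (f : ℕ → Bool) :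
    coinMeasure {ω | ∀ i < N, ω i = f i} = (2 ^ N : ENNReal)⁻¹ := by
  have h : {ω : ℕ → Bool | ∀ i < N, ω i = f i} =
      Set.pi (Finset.range N : Set ℕ) fun i => {f i} := by
    ext ω
    simp [Set.mem_pi]
  rw [h, coinMeasure, Measure.infinitePi_pi _ (fun i _ => measurableSet_singleton _)]
  simp [ENNReal.inv_pow]

lemma measurableSet_cylinder_bool (N : ℕ) (f : ℕ → Bool) :
    MeasurableSet {ω : ℕ → Bool | ∀ i < N, ω i = f i} := by
  have h : {ω : ℕ → Bool | ∀ i < N, ω i = f i} =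
      Set.pi (Finset.range N : Set ℕ) fun i => {f i} := by
    ext ω
    simp [Set.mem_pi]
  rw [h]
  exact MeasurableSet.pi (Finset.countable_toSet _) fun i _ => measurableSet_singleton _

/-- A block of `N` coins is a number below `2 ^ N`; running through all blocks is counting in
binary. -/
lemma exists_testBit_eq (N : ℕ) (ω : ℕ → Bool) :
    ∃ a < 2 ^ N, ∀ i < N, ω i = a.testBit i :=
  ⟨Nat.ofBits fun i : Fin N => ω i, Nat.ofBits_lt_two_pow _, fun i hi => by
    rw [Nat.testBit_ofBits_lt _ _ hi]⟩

lemma eq_of_testBit_eq_of_lt {N a b : ℕ} (ha : a < 2 ^ N) (hb : b < 2 ^ N)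
    (h : ∀ i < N, a.testBit i = b.testBit i) : a = b := by
  refine Nat.eq_of_testBit_eq fun i => ?_
  by_cases hi : i < N
  · exact h i hi
  · have h2 : 2 ^ N ≤ 2 ^ i := Nat.pow_le_pow_right (by norm_num) (by omega)
    rw [Nat.testBit_lt_two_pow (ha.trans_le h2), Nat.testBit_lt_two_pow (hb.trans_le h2)]

open Classical in
/-- The probability of an event that depends on the first `N` coins only. -/
theorem coinMeasure_eq_count (N : ℕ) (p : (ℕ → Bool) → Prop)
    (hp : ∀ ω ω', (∀ i < N, ω i = ω' i) → p ω → p ω') :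
    coinMeasure {ω | p ω} =
      ((Finset.range (2 ^ N)).filter fun a => p a.testBit).card * (2 ^ N : ENNReal)⁻¹ := by
  have h : {ω | p ω} = ⋃ a ∈ (Finset.range (2 ^ N)).filter fun a => p a.testBit,
      {ω : ℕ → Bool | ∀ i < N, ω i = a.testBit i} := by
    ext ω
    simp only [Set.mem_ofPred_eq, Finset.mem_filter, Finset.mem_range, Set.mem_iUnion, exists_prop]
    constructor
    · intro hω
      obtain ⟨a, ha, h2⟩ := exists_testBit_eq N ω
      exact ⟨a, ⟨ha, hp _ _ h2 hω⟩, h2⟩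
    · rintro ⟨a, ⟨-, h1⟩, h2⟩
      exact hp _ _ (fun i hi => (h2 i hi).symm) h1
  rw [h, measure_biUnion_finset]
  · simp [coinMeasure_cylinder]
  · intro a ha b hb hab
    simp only [Finset.coe_filter, Finset.mem_range, Set.mem_ofPred_eq] at ha hb
    refine Set.disjoint_left.2 fun ω h1 h2 => hab ?_
    exact eq_of_testBit_eq_of_lt ha.1 hb.1 fun i hi => (h1 i hi).symm.trans (h2 i hi)
  · exact fun a _ => measurableSet_cylinder_bool N _

-- All blocks of `S + 1` coins are equally likely, and half of their number is `2 ^ S`; clearing the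
-- denominator leaves a comparison of natural numbers.
open Classical in
theorem half_lt_coinMeasure_iff (S : ℕ) (p : (ℕ → Bool) → Prop)
    (hp : ∀ ω ω', (∀ i < S + 1, ω i = ω' i) → p ω → p ω') :
    1 / 2 < coinMeasure {ω | p ω} ↔
      2 ^ S < ((Finset.range (2 ^ (S + 1))).filter fun a => p a.testBit).card := by
  rw [coinMeasure_eq_count (S + 1) p hp]
  set c := ((Finset.range (2 ^ (S + 1))).filter fun a => p a.testBit).card
  rw [← div_eq_mul_inv, ENNReal.lt_div_iff_mul_lt (by simp) (by simp), pow_succ, ← mul_assoc,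
    mul_comm, ← mul_assoc]
  have : (2 : ENNReal) * (1 / 2) = 1 := by
    rw [one_div, ENNReal.mul_inv_cancel (by simp) (by simp)]
  rw [this, one_mul]
  exact_mod_cast Iff.rfl


/-! ## Scans and binary counters on tapes -/

section Scan

variable {O : Type u} {A E S : Type} {M : StoreModel O A S}

/-- Repeat a single step until it exits. -/
def Prog.scan (f : O → (Unit ⊕ E) × A) : Prog O A E := .iter (fun _ : Unit => .op f) ()

lemma StoreModel.Runs.scan {f : O → (Unit ⊕ E) × A} {P : S → Prop} (T : ℕ) (s : ℕ → S) {e : E}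
    {s' : S} (h : ∀ i < T, ∃ a, f (M.obs (s i)) = (.inl (), a) ∧ M.act a (s i) = s (i + 1))
    (h' : ∃ a, f (M.obs (s T)) = (.inr e, a) ∧ M.act a (s T) = s')
    (hP : ∀ i ≤ T, P (s i)) (hP' : P s') : M.Runs (.scan f) P (s 0) e s' := by
  refine Runs.iter_of_seq T (fun _ => ()) s (fun i hi => ?_) ?_
  · obtain ⟨a, h1, h2⟩ := h i hi
    exact .op' h1 h2 (hP i hi.le) (hP (i + 1) hi)
  · obtain ⟨a, h1, h2⟩ := h'
    exact .op' h1 h2 (hP T le_rfl) hP'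

/-- A view of a part of the store as a tape with one bit in each of the cells `0, …, W - 1`. -/
structure BitTape (M : StoreModel O A S) (W : ℕ) (mk : (ℕ → Bool) → ℤ → S)
    (rd : O → Option Bool) (wr : O → Bool → SignType → A) (mv : O → SignType → A) : Prop where
  rd_in : ∀ β (p : ℕ), p < W → rd (M.obs (mk β p)) = some (β p)
  rd_right : ∀ β, rd (M.obs (mk β W)) = none
  rd_left : ∀ β, rd (M.obs (mk β (-1))) = none
  act_wr : ∀ β (p : ℕ) b d, p < W →
    M.act (wr (M.obs (mk β p)) b d) (mk β p) = mk (Function.update β p b) (p + (d : ℤ))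
  act_mv : ∀ β p d, M.act (mv (M.obs (mk β p)) d) (mk β p) = mk β (p + (d : ℤ))

/-- Move left until the left end of the window has been passed, then one cell to the right. -/
def Prog.rewind (rd : O → Option Bool) (mv : O → SignType → A) (e : E) : Prog O A E :=
  .scan fun o => match rd o with
    | some _ => (.inl (), mv o .neg)
    | none => (.inr e, mv o .pos)

/-- Rewrite the bits from cell `0` on according to a rule that may also stop the sweep; then
return to cell `0`. -/
def Prog.sweep [Finite E] (rd : O → Option Bool) (wr : O → Bool → SignType → A)
    (mv : O → SignType → A) (rule : Bool → Bool × Option E) (e₀ : E) : Prog O A E :=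
  .bind (.scan fun o => match rd o with
    | none => (.inr e₀, mv o .neg)
    | some b => match (rule b).2 with
      | none => (.inl (), wr o (rule b).1 .pos)
      | some e => (.inr e, wr o (rule b).1 .zero))
  fun e => .rewind rd mv e

/-- Add a cell at the right end of the window; then return to cell `0`. -/
def Prog.append (rd : O → Option Bool) (mv : O → SignType → A) (new : O → A) : Prog O A Unit :=
  .bind (.scan fun o => match rd o with
    | none => (.inr (), new o)
    | some _ => (.inl (), mv o .pos))
  fun e => .rewind rd mv e

variable {W : ℕ} {mk : (ℕ → Bool) → ℤ → S} {rd : O → Option Bool}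
  {wr : O → Bool → SignType → A} {mv : O → SignType → A} {P : S → Prop}

/-- Writing the start as `j - 1` in the integers includes the position `-1`, from which only the
final move to the right is made. -/
lemma BitTape.rewind (h : BitTape M W mk rd wr mv) (β : ℕ → Bool) (j : ℕ) (hj : j < W + 1) (e : E)
    (hP : ∀ p : ℤ, -1 ≤ p → p ≤ W → P (mk β p)) :
    M.Runs (.rewind rd mv e) P (mk β ((j : ℤ) - 1)) e (mk β 0) := by
  have := StoreModel.Runs.scan (M := M) (P := P) (e := e) (s' := mk β 0)
    (f := fun o => match rd o with
      | some _ => (.inl (), mv o .neg)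
      | none => (.inr e, mv o .pos)) j (fun i => mk β ((j : ℤ) - 1 - i))
    (fun i hi => ?_) ?_ (fun i hi => hP _ (by omega) (by omega)) (hP _ (by omega) (by omega))
  · simpa [Prog.rewind] using this
  · have h1 : (j : ℤ) - 1 - i = ((j - 1 - i : ℕ) : ℤ) := by omega
    refine ⟨_, ?_, h.act_mv _ _ .neg |>.trans ?_⟩
    · rw [h1, h.rd_in _ _ (by omega)]
    · congr 1
      push_cast
      simp
      ring
  · have h1 : (j : ℤ) - 1 - j = -1 := by omega
    refine ⟨_, ?_, h.act_mv _ _ .pos |>.trans ?_⟩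
    · rw [h1, h.rd_left]
    · congr 1
      simp

/-- Here `j` is the cell at which the rule stops the sweep, or `W` if it never does. After `i` steps
of the scan exactly the cells below `i` have been rewritten. -/
lemma BitTape.sweep [Finite E] (h : BitTape M W mk rd wr mv) (rule : Bool → Bool × Option E)
    (e₀ e : E) (β β' : ℕ → Bool) (j : ℕ) (hjW : j ≤ W) (hlt : ∀ i < j, (rule (β i)).2 = none)
    (he : (j = W ∧ e = e₀) ∨ (j < W ∧ (rule (β j)).2 = some e))
    (hβ : ∀ i, β' i = if i ≤ j ∧ i < W then (rule (β i)).1 else β i)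
    (hP : ∀ β (p : ℤ), -1 ≤ p → p ≤ W → P (mk β p)) :
    M.Runs (.sweep rd wr mv rule e₀) P (mk β 0) e (mk β' 0) := by
  -- At the right end the head steps back to `W - 1`; when the rule stops the sweep, the head stays
  -- on `j`. The form `… - 1` is the one `BitTape.rewind` expects.
  refine StoreModel.Runs.bind (s' := mk β' ((if j = W then (j : ℤ) else j + 1) - 1)) (e := e) ?_ ?_
  · have key : ∀ i < j, M.act (wr (M.obs (mk (fun l => if l < i then (rule (β l)).1 else β l) i))
          (rule (β i)).1 .pos) (mk (fun l => if l < i then (rule (β l)).1 else β l) i) =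
        mk (fun l => if l < i + 1 then (rule (β l)).1 else β l) ((i + 1 : ℕ) : ℤ) := by
      intro i hi
      rw [h.act_wr _ _ _ _ (by omega)]
      congr 1
      funext l
      by_cases hl : l = i
      · subst hl; simp
      · rw [Function.update_of_ne hl]
        have : l < i + 1 ↔ l < i := by omega
        simp [this]
    have := StoreModel.Runs.scan (M := M) (P := P) (e := e)
      (s' := mk β' ((if j = W then (j : ℤ) else j + 1) - 1))
      (f := fun o => match rd o with
        | none => (.inr e₀, mv o .neg)
        | some b => match (rule b).2 with
          | none => (.inl (), wr o (rule b).1 .pos)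
          | some e => (.inr e, wr o (rule b).1 .zero)) j
      (fun i => mk (fun l => if l < i then (rule (β l)).1 else β l) i)
      (fun i hi => ?_) ?_ (fun i hi => hP _ _ (by omega) (by omega)) (hP _ _ ?_ ?_)
    · simpa using this
    · refine ⟨_, ?_, key i hi⟩
      rw [h.rd_in _ _ (by omega)]
      simp [hlt i hi]
    · rcases he with ⟨rfl, rfl⟩ | ⟨hj, he⟩
      · refine ⟨_, ?_, (h.act_mv _ _ .neg).trans ?_⟩
        · rw [h.rd_right]
        · simp only [if_true]
          congr 1
          funext l
          rw [hβ]
          by_cases hl : l < j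
          · simp [hl, hl.le]
          · simp [hl]
      · refine ⟨_, ?_, h.act_wr _ j (rule (β j)).1 .zero hj |>.trans ?_⟩
        · rw [h.rd_in _ _ hj]
          simp [he]
        · congr 1
          · funext l
            rw [hβ]
            by_cases hl : l = j
            · subst hl; simp [hj]
            · rw [Function.update_of_ne hl]
              have h1 : l ≤ j ∧ l < W ↔ l < j := by omega
              simp [h1]
          · simp [hj.ne]
    · split_ifs <;> omega
    · split_ifs <;> omega
  · have := h.rewind β' (if j = W then j else j + 1) (by split_ifs <;> omega) e
      (fun p h1 h2 => hP β' p h1 h2)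
    push_cast at this
    exact this

/-- The views before and after the extension share their operations, so the way to the right uses
the old view and the way back the new one. -/
lemma BitTape.append {mk' : (ℕ → Bool) → ℤ → S} {new : O → A} {b : Bool}
    (h : BitTape M W mk rd wr mv)
    (h' : BitTape M (W + 1) mk' rd wr mv) (β : ℕ → Bool)
    (hnew : M.act (new (M.obs (mk β W))) (mk β W) = mk' (Function.update β W b) W)
    (hP : ∀ β (p : ℤ), -1 ≤ p → p ≤ W → P (mk β p))
    (hP' : ∀ β (p : ℤ), -1 ≤ p → p ≤ W + 1 → P (mk' β p)) :
    M.Runs (.append rd mv new) P (mk β 0) () (mk' (Function.update β W b) 0) := by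
  refine StoreModel.Runs.bind (s' := mk' (Function.update β W b) W) (e := ()) ?_ ?_
  · have := StoreModel.Runs.scan (M := M) (P := P) (e := ())
      (s' := mk' (Function.update β W b) W)
      (f := fun o => match rd o with
        | none => (.inr (), new o)
        | some _ => (.inl (), mv o .pos)) W
      (fun i => mk β i)
      (fun i hi => ?_) ?_ (fun i hi => hP _ _ (by omega) (by omega)) (hP' _ _ (by omega) (by omega))
    · simpa using this
    · refine ⟨_, ?_, h.act_mv _ _ .pos |>.trans ?_⟩
      · rw [h.rd_in _ _ hi]
      · simp
    · exact ⟨_, by rw [h.rd_right], hnew⟩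
  · have := h'.rewind (P := P) (Function.update β W b) (W + 1) (by omega) ()
      (fun p h1 h2 => hP' _ p h1 (by push_cast at h2; exact h2))
    simpa using this

/-! ### Arithmetic of bits -/

/-- `j` is the number of trailing ones of `N`, where the carry stops. It serves both directions:
incrementing `N` and decrementing `N + 1` flip exactly the bits up to `j`. -/
lemma exists_testBit_succ (N : ℕ) : ∃ j, (∀ i < j, N.testBit i = true) ∧ N.testBit j = false ∧
    ∀ i, (N + 1).testBit i = if i < j then false else if i = j then true else N.testBit i := by
  induction N using Nat.strong_induction_on with
  | _ N ih =>
    obtain ⟨M, rfl | rfl⟩ := Nat.even_or_odd' N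
    · refine ⟨0, by simp, by simp, fun i => ?_⟩
      cases i with
      | zero => simp [Nat.testBit_zero, Nat.add_mod]
      | succ i =>
        simp only [Nat.testBit_succ]
        have : (2 * M + 1) / 2 = M := by omega
        simp [this]
    · obtain ⟨j, h1, h2, h3⟩ := ih M (by omega)
      refine ⟨j + 1, fun i hi => ?_, ?_, fun i => ?_⟩
      · cases i with
        | zero => simp [Nat.testBit_zero]
        | succ i =>
          rw [Nat.testBit_succ, show (2 * M + 1) / 2 = M by omega]
          exact h1 i (by omega)
      · rw [Nat.testBit_succ, show (2 * M + 1) / 2 = M by omega]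
        exact h2
      · cases i with
        | zero =>
          have : (2 * M + 1 + 1) % 2 = 0 := by omega
          simp [Nat.testBit_zero, this]
        | succ i =>
          simp only [Nat.testBit_succ, show (2 * M + 1 + 1) / 2 = M + 1 by omega,
            show (2 * M + 1) / 2 = M by omega, h3]
          simp

/-- Binary increment; the exit value tells whether there was an overflow. -/
def Prog.inc (rd : O → Option Bool) (wr : O → Bool → SignType → A) (mv : O → SignType → A) :
    Prog O A Bool :=
  .sweep rd wr mv (fun b => if b then (false, none) else (true, some false)) true

/-- Binary decrement of a positive number. -/
def Prog.dec (rd : O → Option Bool) (wr : O → Bool → SignType → A) (mv : O → SignType → A) :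
    Prog O A Unit :=
  .sweep rd wr mv (fun b => if b then (false, some ()) else (true, none)) ()

/-- Zero test. -/
def Prog.isZero (rd : O → Option Bool) (wr : O → Bool → SignType → A) (mv : O → SignType → A) :
    Prog O A Bool :=
  .sweep rd wr mv (fun b => if b then (true, some false) else (false, none)) true

/-- Write ones everywhere. -/
def Prog.fill (rd : O → Option Bool) (wr : O → Bool → SignType → A) (mv : O → SignType → A) :
    Prog O A Unit :=
  .sweep rd wr mv (fun _ => (true, none)) ()

lemma BitTape.inc (h : BitTape M W mk rd wr mv) {N : ℕ} (hN : N + 1 < 2 ^ W)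
    (hP : ∀ β (p : ℤ), -1 ≤ p → p ≤ W → P (mk β p)) :
    M.Runs (.inc rd wr mv) P (mk N.testBit 0) false (mk (N + 1).testBit 0) := by
  obtain ⟨j, h1, h2, h3⟩ := exists_testBit_succ N
  -- The carry stays inside the window, because bit `j` of `N + 1` is set while all its bits from
  -- `W` on vanish.
  have hj : j < W := by
    by_contra hj
    have := h3 j
    rw [Nat.testBit_lt_two_pow (hN.trans_le (Nat.pow_le_pow_right (by norm_num) (by omega)))] at this
    simp at this
  refine h.sweep _ _ _ _ _ j hj.le (fun i hi => by simp [h1 i hi]) (.inr ⟨hj, by simp [h2]⟩)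
    (fun i => ?_) hP
  rw [h3]
  rcases lt_trichotomy i j with hi | rfl | hi
  · simp [hi, hi.le, h1 i hi, hi.trans hj]
  · simp [h2, hj]
  · simp [hi.not_gt, hi.ne', hi.not_ge]

lemma BitTape.inc_overflow (h : BitTape M W mk rd wr mv) {N : ℕ} (hN : N + 1 = 2 ^ W)
    (hP : ∀ β (p : ℤ), -1 ≤ p → p ≤ W → P (mk β p)) :
    M.Runs (.inc rd wr mv) P (mk N.testBit 0) true (mk (0 : ℕ).testBit 0) := by
  have hN' : N = 2 ^ W - 1 := by omega
  subst hN'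
  refine h.sweep _ _ _ _ _ W le_rfl (fun i hi => ?_) (.inl ⟨rfl, rfl⟩) (fun i => ?_) hP
  · simp [hi]
  · by_cases hi : i < W
    · simp [hi, hi.le]
    · simp [hi]

lemma BitTape.dec (h : BitTape M W mk rd wr mv) {N : ℕ} (hN : N + 1 < 2 ^ W)
    (hP : ∀ β (p : ℤ), -1 ≤ p → p ≤ W → P (mk β p)) :
    M.Runs (.dec rd wr mv) P (mk (N + 1).testBit 0) () (mk N.testBit 0) := by
  obtain ⟨j, h1, h2, h3⟩ := exists_testBit_succ N
  have hj : j < W := by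
    by_contra hj
    have := h3 j
    rw [Nat.testBit_lt_two_pow (hN.trans_le (Nat.pow_le_pow_right (by norm_num) (by omega)))] at this
    simp at this
  refine h.sweep _ _ _ _ _ j hj.le (fun i hi => by simp [h3 i, hi]) (.inr ⟨hj, by simp [h3 j]⟩)
    (fun i => ?_) hP
  rw [h3]
  rcases lt_trichotomy i j with hi | rfl | hi
  · simp [hi, hi.le, h1 i hi, hi.trans hj]
  · simp [h2, hj]
  · simp [hi.not_gt, hi.ne', hi.not_ge]

lemma BitTape.isZero (h : BitTape M W mk rd wr mv) {N : ℕ} (hN : N < 2 ^ W)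
    (hP : ∀ β (p : ℤ), -1 ≤ p → p ≤ W → P (mk β p)) :
    M.Runs (.isZero rd wr mv) P (mk N.testBit 0) (decide (N = 0)) (mk N.testBit 0) := by
  by_cases hN0 : N = 0
  · subst hN0
    exact h.sweep _ _ _ _ _ W le_rfl (fun i hi => by simp) (.inl ⟨rfl, by simp⟩)
      (fun i => by simp) hP
  · obtain ⟨j, hj, hmin⟩ : ∃ j, N.testBit j = true ∧ ∀ i < j, N.testBit i = false := by
      classical
      have hex := Nat.exists_testBit_of_ne_zero hN0
      exact ⟨Nat.find hex, Nat.find_spec hex, fun i hi => by simpa using Nat.find_min hex hi⟩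
    have hjW : j < W := by
      by_contra hjW
      rw [Nat.testBit_lt_two_pow (hN.trans_le (Nat.pow_le_pow_right (by norm_num) (by omega)))] at hj
      simp at hj
    refine h.sweep _ _ _ _ _ j hjW.le (fun i hi => by simp [hmin i hi])
      (.inr ⟨hjW, by simp [hj, hN0]⟩) (fun i => ?_) hP
    cases N.testBit i <;> simp

lemma BitTape.fill (h : BitTape M W mk rd wr mv) {N : ℕ} (hN : N < 2 ^ W)
    (hP : ∀ β (p : ℤ), -1 ≤ p → p ≤ W → P (mk β p)) :
    M.Runs (.fill rd wr mv) P (mk N.testBit 0) () (mk (2 ^ W - 1).testBit 0) := by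
  refine h.sweep _ _ _ _ _ W le_rfl (fun i hi => rfl) (.inl ⟨rfl, rfl⟩) (fun i => ?_) hP
  by_cases hi : i < W
  · simp [hi, hi.le]
  · have : N.testBit i = false :=
      Nat.testBit_lt_two_pow (hN.trans_le (Nat.pow_le_pow_right (by norm_num) (by omega)))
    simp [hi, this]

end Scan

/-! ## Euler tours through the configuration graph of a deterministic machine

The configurations from which a halting configuration is reached form a tree. A tour around this
tree needs no memory beyond the current configuration. -/

/-- A deterministic system whose steps can be undone: `undo e` undoes the step from each
configuration `w` with `idx w = e`. Only the configurations in the finite set `X` matter. -/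
structure TourSystem (C : Type) (J : ℕ) where
  step : C → C
  halted : C → Prop
  idx : C → Fin J
  undo : Fin J → C → C
  X : Set C
  finX : X.Finite
  step_mem : ∀ w ∈ X, ¬ halted w → step w ∈ X
  undo_step : ∀ w ∈ X, ¬ halted w → undo (idx w) (step w) = w

namespace TourSystem

variable {C : Type} {J : ℕ} (Y : TourSystem C J)

/-- `undo e v` is a predecessor of `v`. -/
def Valid (e : Fin J) (v : C) : Prop :=
  Y.undo e v ∈ Y.X ∧ ¬ Y.halted (Y.undo e v) ∧ Y.step (Y.undo e v) = v ∧ Y.idx (Y.undo e v) = e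

open Classical in
/-- One step of the tour: the second component says which predecessors have been visited. -/
noncomputable def tour (z : C × Fin (J + 1)) : C × Fin (J + 1) :=
  if h : (z.2 : ℕ) < J then
    if Y.Valid ⟨z.2, h⟩ z.1 then (Y.undo ⟨z.2, h⟩ z.1, 0) else (z.1, ⟨z.2 + 1, by omega⟩)
  else if Y.halted z.1 then (z.1, 0) else (Y.step z.1, (Y.idx z.1).succ)

open Classical in
/-- A step that stops at halting configurations. -/
noncomputable def bstep (v : C) : C := if Y.halted v then v else Y.step v

lemma tour_valid {v : C} {j : Fin (J + 1)} (h : (j : ℕ) < J) (hv : Y.Valid ⟨j, h⟩ v) :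
    Y.tour (v, j) = (Y.undo ⟨j, h⟩ v, 0) := by simp [tour, h, hv]

lemma tour_invalid {v : C} {j : Fin (J + 1)} (h : (j : ℕ) < J) (hv : ¬ Y.Valid ⟨j, h⟩ v) :
    Y.tour (v, j) = (v, ⟨j + 1, by omega⟩) := by simp [tour, h, hv]

lemma tour_halted {v : C} (h : Y.halted v) : Y.tour (v, Fin.last J) = (v, 0) := by
  simp [tour, h]

lemma tour_up {v : C} (h : ¬ Y.halted v) :
    Y.tour (v, Fin.last J) = (Y.step v, (Y.idx v).succ) := by
  simp [tour, h]

lemma tour_cases {P : C × Fin (J + 1) → C × Fin (J + 1) → Prop}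
    (h1 : ∀ v (j : Fin (J + 1)) (h : (j : ℕ) < J), Y.Valid ⟨j, h⟩ v →
      P (v, j) (Y.undo ⟨j, h⟩ v, 0))
    (h2 : ∀ v (j : Fin (J + 1)) (h : (j : ℕ) < J), ¬ Y.Valid ⟨j, h⟩ v →
      P (v, j) (v, ⟨j + 1, by omega⟩))
    (h3 : ∀ v, Y.halted v → P (v, Fin.last J) (v, 0))
    (h4 : ∀ v, ¬ Y.halted v → P (v, Fin.last J) (Y.step v, (Y.idx v).succ)) (z) :
    P z (Y.tour z) := by
  obtain ⟨v, j⟩ := z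
  by_cases h : (j : ℕ) < J
  · by_cases hv : Y.Valid ⟨j, h⟩ v
    · rw [Y.tour_valid h hv]; exact h1 v j h hv
    · rw [Y.tour_invalid h hv]; exact h2 v j h hv
  · obtain rfl : j = Fin.last J := Fin.ext (by simp; omega)
    by_cases hv : Y.halted v
    · rw [Y.tour_halted hv]; exact h3 v hv
    · rw [Y.tour_up hv]; exact h4 v hv

lemma tour_mem (z : C × Fin (J + 1)) (hz : z.1 ∈ Y.X) : (Y.tour z).1 ∈ Y.X := by
  revert hz
  exact Y.tour_cases (P := fun z z' => z.1 ∈ Y.X → z'.1 ∈ Y.X) (fun v j h hv _ => hv.1)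
    (fun v j h hv hz => hz) (fun v hv hz => hz) (fun v hv hz => Y.step_mem v hz hv) z

/-- The inverse of a step of the tour, with junk values elsewhere. -/
lemma tour_injOn {z z' : C × Fin (J + 1)} (hz : z.1 ∈ Y.X) (hz' : z'.1 ∈ Y.X)
    (h : Y.tour z = Y.tour z') : z = z' := by
  -- The image reveals which of the four rules was applied. Index `0` comes from a restart if the
  -- configuration has halted, from a descent otherwise; index `e.succ` comes from an ascent if `e`
  -- is valid there, from a skipped label otherwise. Each rule determines its argument from its
  -- image.
  have key : ∀ z : C × Fin (J + 1), z.1 ∈ Y.X →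
      (Y.tour z = (z.1, 0) ∧ Y.halted z.1 ∧ z.2 = Fin.last J) ∨
      (∃ e : Fin J, (Y.tour z).2 = 0 ∧ ¬ Y.halted (Y.tour z).1 ∧ Y.step (Y.tour z).1 = z.1 ∧
        Y.idx (Y.tour z).1 = e ∧ z.2 = e.castSucc) ∨
      (∃ e : Fin J, (Y.tour z).2 = e.succ ∧ (Y.tour z).1 = z.1 ∧ ¬ Y.Valid e z.1 ∧
        z.2 = e.castSucc) ∨
      (∃ e : Fin J, (Y.tour z).2 = e.succ ∧ Y.undo e (Y.tour z).1 = z.1 ∧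
        Y.Valid e (Y.tour z).1 ∧ z.2 = Fin.last J) := by
    refine Y.tour_cases (P := fun z z' => z.1 ∈ Y.X → (z' = (z.1, 0) ∧ Y.halted z.1 ∧
      z.2 = Fin.last J) ∨ (∃ e : Fin J, z'.2 = 0 ∧ ¬ Y.halted z'.1 ∧ Y.step z'.1 = z.1 ∧
        Y.idx z'.1 = e ∧ z.2 = e.castSucc) ∨
      (∃ e : Fin J, z'.2 = e.succ ∧ z'.1 = z.1 ∧ ¬ Y.Valid e z.1 ∧ z.2 = e.castSucc) ∨
      (∃ e : Fin J, z'.2 = e.succ ∧ Y.undo e z'.1 = z.1 ∧ Y.Valid e z'.1 ∧ z.2 = Fin.last J))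
      ?_ ?_ ?_ ?_
    · exact fun v j h hv hX => .inr (.inl ⟨⟨j, h⟩, rfl, hv.2.1, hv.2.2.1, hv.2.2.2, rfl⟩)
    · exact fun v j h hv hX => .inr (.inr (.inl ⟨⟨j, h⟩, rfl, rfl, hv, rfl⟩))
    · exact fun v hv hX => .inl ⟨rfl, hv, rfl⟩
    · intro v hv hX
      have h1 := Y.undo_step v hX hv
      refine .inr (.inr (.inr ⟨Y.idx v, rfl, h1, ?_, rfl⟩))
      simp only [Valid, h1]
      exact ⟨hX, hv, trivial, trivial⟩
  rcases key z hz with h1 | ⟨e, h1, h2, h3, h4, h5⟩ | ⟨e, h1, h2, h3, h4⟩ | ⟨e, h1, h2, h3, h4⟩ <;>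
  rcases key z' hz' with g1 | ⟨f, g1, g2, g3, g4, g5⟩ | ⟨f, g1, g2, g3, g4⟩ | ⟨f, g1, g2, g3, g4⟩
  · have := h1.1.symm.trans (h.trans g1.1)
    simp only [Prod.mk.injEq, and_true] at this
    exact Prod.ext this (h1.2.2.trans g1.2.2.symm)
  · rw [← h, h1.1] at g2
    exact absurd h1.2.1 g2
  · rw [← h, h1.1] at g1
    exact absurd g1.symm (Fin.succ_ne_zero _)
  · rw [← h, h1.1] at g1
    exact absurd g1.symm (Fin.succ_ne_zero _)
  · rw [h, g1.1] at h2
    exact absurd g1.2.1 h2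
  · rw [h] at h3 h4
    refine Prod.ext (h3.symm.trans g3) ?_
    rw [h5, g5, ← h4, ← g4]
  · rw [h, g1] at h1
    exact absurd h1 (Fin.succ_ne_zero _)
  · rw [h, g1] at h1
    exact absurd h1 (Fin.succ_ne_zero _)
  · rw [h, g1.1] at h1
    exact absurd h1.symm (Fin.succ_ne_zero _)
  · rw [h, g1] at h1
    exact absurd h1.symm (Fin.succ_ne_zero _)
  · rw [h] at h1 h2
    have : e = f := Fin.succ_injective _ (h1.symm.trans g1)
    exact Prod.ext (h2.symm.trans g2) (by rw [h4, g4, this])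
  · rw [h] at h1 h2
    have : e = f := Fin.succ_injective _ (h1.symm.trans g1)
    rw [← h2, this] at h3
    exact absurd g3 h3
  · rw [h, g1.1] at h1
    exact absurd h1.symm (Fin.succ_ne_zero _)
  · rw [h, g1] at h1
    exact absurd h1.symm (Fin.succ_ne_zero _)
  · rw [h] at h1 h3
    have : e = f := Fin.succ_injective _ (h1.symm.trans g1)
    rw [g2, this] at h3
    exact absurd h3 g3
  · rw [h] at h1 h2
    have : e = f := Fin.succ_injective _ (h1.symm.trans g1)
    rw [this] at h2
    exact Prod.ext (h2.symm.trans g2) (by rw [h4, g4])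

lemma iterate_tour_mem {c₀ : C} (hc : c₀ ∈ Y.X) (i : ℕ) : (Y.tour^[i] (c₀, 0)).1 ∈ Y.X := by
  induction i with
  | zero => exact hc
  | succ i ih => rw [Function.iterate_succ_apply']; exact Y.tour_mem _ ih

/-- The tour returns to its start. -/
lemma exists_period {c₀ : C} (hc : c₀ ∈ Y.X) : ∃ T > 0, Y.tour^[T] (c₀, 0) = (c₀, 0) ∧
    ∀ i, 0 < i → i < T → Y.tour^[i] (c₀, 0) ≠ (c₀, 0) := by
  have := Y.finX.to_subtype
  -- On a finite set an injective self-map has only periodic points; the minimal period is the time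
  -- of the first return.
  let f : Y.X × Fin (J + 1) → Y.X × Fin (J + 1) := fun z =>
    (⟨(Y.tour (z.1, z.2)).1, Y.tour_mem _ z.1.2⟩, (Y.tour (z.1, z.2)).2)
  have hf : Function.Injective f := by
    rintro ⟨v, j⟩ ⟨v', j'⟩ h
    simp only [f, Prod.mk.injEq, Subtype.mk.injEq] at h
    have := Y.tour_injOn (z := (v, j)) (z' := (v', j')) v.2 v'.2 (Prod.ext h.1 h.2)
    simpa [Subtype.ext_iff] using this
  have hit : ∀ i, Y.tour^[i] (c₀, 0) = ((f^[i] (⟨c₀, hc⟩, 0)).1.1, (f^[i] (⟨c₀, hc⟩, 0)).2) := by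
    intro i
    induction i with
    | zero => rfl
    | succ i ih => rw [Function.iterate_succ_apply', Function.iterate_succ_apply', ih]
  have hp := hf.mem_periodicPts (⟨c₀, hc⟩, 0)
  refine ⟨_, Function.minimalPeriod_pos_of_mem_periodicPts hp, ?_, fun i hi hT h => ?_⟩
  · rw [hit, Function.iterate_minimalPeriod]
  · refine Function.not_isPeriodicPt_of_pos_of_lt_minimalPeriod hi.ne' hT ?_
    rw [hit] at h
    simp only [Prod.mk.injEq] at h
    exact Prod.ext (Subtype.ext h.1) h.2

lemma bstep_of_not {v : C} (h : ¬ Y.halted v) : Y.bstep v = Y.step v := by simp [bstep, h]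

lemma iterate_bstep_halted {v : C} (h : Y.halted v) (t : ℕ) : Y.bstep^[t] v = v := by
  induction t with
  | zero => rfl
  | succ t ih => rw [Function.iterate_succ_apply', ih]; simp [bstep, h]

/-- Configurations seen in the tour lead to the same ones as the start. -/
lemma tour_connected (c₀ : C) (i : ℕ) :
    ∃ a b, Y.bstep^[a] (Y.tour^[i] (c₀, 0)).1 = Y.bstep^[b] c₀ := by
  induction i with
  | zero => exact ⟨0, 0, rfl⟩
  | succ i ih =>
    rw [Function.iterate_succ_apply']
    generalize Y.tour^[i] (c₀, 0) = z at *
    revert ih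
    refine Y.tour_cases (P := fun z z' => (∃ a b, Y.bstep^[a] z.1 = Y.bstep^[b] c₀) →
      ∃ a b, Y.bstep^[a] z'.1 = Y.bstep^[b] c₀) ?_ ?_ ?_ ?_ z
    · rintro v j h hv ⟨a, b, hab⟩
      refine ⟨a + 1, b, ?_⟩
      rw [Function.iterate_succ_apply, Y.bstep_of_not hv.2.1, hv.2.2.1, hab]
    · exact fun v j h hv hz => hz
    · exact fun v hv hz => hz
    · rintro v hv ⟨a, b, hab⟩
      refine ⟨a, b + 1, ?_⟩
      rw [Function.iterate_succ_apply', ← hab, ← Y.bstep_of_not hv,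
        ← Function.iterate_succ_apply, Function.iterate_succ_apply']

/-- A closed set of tour positions that contains a position at a tree node `v` contains the
position after all predecessors of `v`. -/
lemma last_mem_of_mem {O : Set (C × Fin (J + 1))} (hO : ∀ z ∈ O, Y.tour z ∈ O) (v : C)
    (hX : v ∈ Y.X) (hv : ∃ d, Y.halted (Y.bstep^[d] v)) (j : Fin (J + 1)) (hj : (v, j) ∈ O) :
    (v, Fin.last J) ∈ O := by
  -- Outer induction on the size of the tree of configurations that lead to `v`; inner induction on
  -- the number `J - j` of labels that remain to be tried.
  generalize hn : {u ∈ Y.X | ∃ t, Y.bstep^[t] u = v}.ncard = n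
  induction n using Nat.strong_induction_on generalizing v j with
  | _ n ih =>
    induction hk : J - j generalizing j with
    | zero =>
      obtain rfl : j = Fin.last J := Fin.ext (by simp; omega)
      exact hj
    | succ k ihk =>
      have hlt : (j : ℕ) < J := by omega
      have hnext := hO _ hj
      by_cases hval : Y.Valid ⟨j, hlt⟩ v
      · rw [Y.tour_valid hlt hval] at hnext
        set w := Y.undo ⟨j, hlt⟩ v with hw
        obtain ⟨h1, h2, h3, h4⟩ := hval
        rw [← hw] at h1 h2 h3 h4
        have hwv : Y.bstep w = v := by rw [Y.bstep_of_not h2, h3]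
        have hw' : ∃ d, Y.halted (Y.bstep^[d] w) := by
          obtain ⟨d, hd⟩ := hv
          exact ⟨d + 1, by rwa [Function.iterate_succ_apply, hwv]⟩
        have hcard : {u ∈ Y.X | ∃ t, Y.bstep^[t] u = w}.ncard < n := by
          rw [← hn]
          refine Set.ncard_lt_ncard ?_ (Y.finX.subset fun u hu => hu.1)
          refine Set.ssubset_iff_exists.2 ⟨?_, v, ⟨hX, 0, rfl⟩, ?_⟩
          · rintro u ⟨hu, t, ht⟩
            exact ⟨hu, t + 1, by rw [Function.iterate_succ_apply', ht, hwv]⟩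
          -- If `v` led back to `w`, then `w` would lie on a cycle. A number of rounds that takes at
          -- least `d` steps would end both in `w` and in a halted configuration, but `w` has not
          -- halted.
          · rintro ⟨-, t, ht⟩
            obtain ⟨d, hd⟩ := hw'
            have hper : Y.bstep^[t + 1] w = w := by
              rw [Function.iterate_succ_apply, hwv, ht]
            have hper' : Y.bstep^[(t + 1) * (d + 1)] w = w := by
              rw [Function.iterate_mul]
              exact Function.iterate_fixed hper _
            have hsplit : (t + 1) * (d + 1) = (t * (d + 1) + 1) + d := by ring
            rw [hsplit, Function.iterate_add_apply, Y.iterate_bstep_halted hd] at hper'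
            rw [hper'] at hd
            exact h2 hd
        -- The walk around the smaller tree ends at the last position of `w`, and the ascent from
        -- there returns to `v` with the next label.
        have hlast := ih _ hcard w h1 hw' 0 hnext rfl
        have hup := hO _ hlast
        rw [Y.tour_up h2, h3, h4] at hup
        exact ihk _ hup (by simp; omega)
      · rw [Y.tour_invalid hlt hval] at hnext
        exact ihk _ hnext (by simp; omega)

/-- The halting configurations seen in the tour are those reached from its start. -/
theorem tour_halted_iff {c₀ h : C} (hc : c₀ ∈ Y.X) (hh : Y.halted h) {T : ℕ} (hT : 0 < T)
    (hper : Y.tour^[T] (c₀, 0) = (c₀, 0)) :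
    (∃ i < T, Y.tour^[i] (c₀, 0) = (h, Fin.last J)) ↔ ∃ t, Y.bstep^[t] c₀ = h := by
  constructor
  · rintro ⟨i, -, hi⟩
    obtain ⟨a, b, hab⟩ := Y.tour_connected c₀ i
    rw [hi, Y.iterate_bstep_halted hh] at hab
    exact ⟨b, hab.symm⟩
  · rintro ⟨t, ht⟩
    have hO : ∀ z ∈ Set.range fun i => Y.tour^[i] (c₀, 0),
        Y.tour z ∈ Set.range fun i => Y.tour^[i] (c₀, 0) := by
      rintro _ ⟨i, rfl⟩
      exact ⟨i + 1, Function.iterate_succ_apply' _ _ _⟩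
    -- Induction along the computation: after exhausting the predecessors of a running
    -- configuration, the tour ascends to the next one and by `last_mem_of_mem` exhausts its
    -- predecessors as well.
    have key : ∀ k ≤ t, Y.bstep^[k] c₀ ∈ Y.X ∧
        (Y.bstep^[k] c₀, Fin.last J) ∈ Set.range fun i => Y.tour^[i] (c₀, 0) := by
      intro k
      have hreach : ∀ k ≤ t, ∃ d, Y.halted (Y.bstep^[d] (Y.bstep^[k] c₀)) := by
        intro k hk
        refine ⟨t - k, ?_⟩
        rwa [← Function.iterate_add_apply, Nat.sub_add_cancel hk, ht]
      induction k with
      | zero =>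
        exact fun _ => ⟨hc, Y.last_mem_of_mem hO c₀ hc (hreach 0 (by omega)) 0 ⟨0, rfl⟩⟩
      | succ k ih =>
        intro hk
        obtain ⟨ih1, ih2⟩ := ih (by omega)
        have hr := hreach _ hk
        rw [Function.iterate_succ_apply'] at hr ⊢
        by_cases hhalt : Y.halted (Y.bstep^[k] c₀)
        · have : Y.bstep (Y.bstep^[k] c₀) = Y.bstep^[k] c₀ := by
            conv_lhs => rw [bstep]
            simp [hhalt]
          rw [this]
          exact ⟨ih1, ih2⟩
        · rw [Y.bstep_of_not hhalt] at hr ⊢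
          have hX := Y.step_mem _ ih1 hhalt
          refine ⟨hX, Y.last_mem_of_mem hO _ hX hr (Y.idx (Y.bstep^[k] c₀)).succ ?_⟩
          have := hO _ ih2
          rwa [Y.tour_up hhalt] at this
    obtain ⟨i, hi⟩ := (key t le_rfl).2
    refine ⟨i % T, Nat.mod_lt _ hT, ?_⟩
    have hfix : ∀ m, Y.tour^[T * m] (c₀, 0) = (c₀, 0) := fun m => by
      rw [Function.iterate_mul]
      exact Function.iterate_fixed hper _
    dsimp only at hi
    rwa [← Nat.mod_add_div i T, Function.iterate_add_apply, hfix, ht] at hi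

end TourSystem


/-! ## Tours through the configurations of a probabilistic program with fixed coin tosses -/

/-- The move that the input head really makes. -/
def effMove (d : SignType) (left right : Bool) : SignType :=
  match d with
  | .neg => if left then .zero else .neg
  | .zero => .zero
  | .pos => if right then .zero else .pos

lemma moveInput_effMove {n p : ℕ} (d : SignType) :
    moveInput n (effMove d (decide (p = 0)) (decide (p = n + 1))) p = moveInput n d p := by
  cases d
  · rfl
  · by_cases h0 : p = 0 <;> simp [effMove, h0, moveInput]
  · by_cases h0 : p = n + 1 <;> simp [effMove, h0, moveInput]

/-- A requested move beyond an end-marker leaves no trace in the position, so it cannot be inverted;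
the move that was really made can. -/
lemma moveInput_neg_effMove {n p : ℕ} (d : SignType) (h : p ≤ n + 1) :
    moveInput n (-effMove d (decide (p = 0)) (decide (p = n + 1))) (moveInput n d p) = p := by
  cases d
  · rfl
  · by_cases h0 : p = 0
    · simp [effMove, h0, moveInput]
    · simp only [effMove, h0, decide_false, Bool.false_eq_true, if_false]
      change min (p - 1 + 1) (n + 1) = p
      omega
  · by_cases h0 : p = n + 1
    · simp only [effMove, h0, decide_true, if_true]
      change min (n + 1 + 1) (n + 1) = n + 1
      omega
    · simp only [effMove, h0, decide_false, Bool.false_eq_true, if_false]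
      change min (p + 1) (n + 1) - 1 = p
      omega

/-- Description of a step: old state, overwritten symbol, real moves of the heads, and whether a
coin is tossed. -/
abbrev CoinProg.Label {α : Type u} {Γ : Type} (m : CoinProg α Γ) : Type :=
  m.Q × Γ × SignType × SignType × Bool

namespace CoinProg

variable {α : Type u} {Γ : Type} (m : CoinProg α Γ) (b : Γ) (x : List α) (ω : ℕ → Bool) (S : ℕ)

abbrev Conf : Type := (m.Q ⊕ Bool) × CoinStore Γ

instance : Finite m.Q := m.fin

/-- Configurations that have halted or left the window of the cells `-S, …, S` of the work tape
and the coins `0, …, S`. -/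
def Halted (v : m.Conf) : Prop :=
  v.1.isRight ∨ ¬ (|v.2.workPos| ≤ S ∧ 0 ≤ v.2.coin ∧ v.2.coin ≤ S)

/-- The label of the next step. -/
def label (v : m.Conf) : m.Label :=
  match v.1 with
  | .inl q =>
    let r := m.next q ((coinModel Γ x ω).obs v.2)
    (q, v.2.tape v.2.workPos,
      effMove r.2.2.1 (decide (v.2.inPos = 0)) (decide (v.2.inPos = x.length + 1)), r.2.2.2)
  | .inr _ => (m.start, b, 0, 0, false)

/-- Move the heads back. -/
def moveBack (e : m.Label) (σ : CoinStore Γ) : CoinStore Γ :=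
  ⟨moveInput x.length (-e.2.2.1) σ.inPos, σ.tape, σ.workPos - (e.2.2.2.1 : ℤ),
    σ.coin - (coinMove e.2.2.2.2 : ℤ)⟩

/-- The store with another symbol under the work head. -/
def writeSymbol (g : Γ) (σ : CoinStore Γ) : CoinStore Γ :=
  ⟨σ.inPos, Function.update σ.tape σ.workPos g, σ.workPos, σ.coin⟩

/-- The configuration before a step with the given label. -/
def undoStep (e : m.Label) (v : m.Conf) : m.Conf :=
  (.inl e.1, writeSymbol e.2.1 (m.moveBack x e v.2))

/-- The configurations that occur in computations in the window. -/
def window : Set m.Conf :=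
  {v | v.2.inPos ≤ x.length + 1 ∧ |v.2.workPos| ≤ S + 1 ∧ 0 ≤ v.2.coin ∧ v.2.coin ≤ S + 1 ∧
    ∀ p : ℤ, ¬ |p| ≤ S → v.2.tape p = b}

/-- The tape is blank outside of the cells `-S, …, S`, so finitely many data with finitely many
values determine a configuration. -/
lemma window_finite [Finite Γ] : (m.window b x S).Finite := by
  let f : m.window b x S → (m.Q ⊕ Bool) × Finset.range (x.length + 2) ×
      Finset.Icc (-(S + 1 : ℤ)) (S + 1) × Finset.Icc (0 : ℤ) (S + 1) ×
      (Finset.Icc (-(S : ℤ)) S → Γ) := fun v =>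
    (v.1.1, ⟨v.1.2.inPos, Finset.mem_range.2 (by have := v.2.1; omega)⟩,
      ⟨v.1.2.workPos, Finset.mem_Icc.2 (abs_le.1 v.2.2.1)⟩,
      ⟨v.1.2.coin, Finset.mem_Icc.2 ⟨v.2.2.2.1, v.2.2.2.2.1⟩⟩, fun p => v.1.2.tape p)
  have hf : Function.Injective f := by
    rintro ⟨⟨a, ip, tp, wp, cn⟩, h⟩ ⟨⟨a', ip', tp', wp', cn'⟩, h'⟩ hff
    simp only [f, Prod.mk.injEq, Subtype.mk.injEq] at hff
    obtain ⟨rfl, rfl, rfl, rfl, h5⟩ := hff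
    have : tp = tp' := by
      funext p
      by_cases hp : |p| ≤ S
      · exact congrFun h5 ⟨p, Finset.mem_Icc.2 (abs_le.1 hp)⟩
      · exact Eq.trans (h.2.2.2.2 p hp) (Eq.symm (h'.2.2.2.2 p hp))
    subst this
    rfl
  exact Set.finite_coe_iff.1 (Finite.of_injective f hf)

variable {m b x ω S}

lemma not_halted_iff {v : m.Conf} : ¬ m.Halted S v ↔
    (∃ q, v.1 = .inl q) ∧ |v.2.workPos| ≤ S ∧ 0 ≤ v.2.coin ∧ v.2.coin ≤ S := by
  unfold Halted
  push Not
  rcases v with ⟨q | e, σ⟩ <;> simp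

/-- A configuration that has not halted is within the bounds `S`; its step leads at most to `S + 1`
and writes only inside. Hence `window` allows one cell on each side and one coin more than the
halting test. -/
lemma step_mem_window {w : m.Conf} (h : w ∈ m.window b x S) (hw : ¬ m.Halted S w) :
    (coinModel Γ x ω).step m w ∈ m.window b x S := by
  obtain ⟨⟨q, hq⟩, hw1, hw2, hw3⟩ := not_halted_iff.1 hw
  obtain ⟨a, σ⟩ := w
  obtain rfl : a = .inl q := hq
  obtain ⟨h1, -, -, -, h5⟩ := h
  rw [StoreModel.step_inl]
  refine ⟨moveInput_le _ h1, ?_, ?_, ?_, fun p hp => ?_⟩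
  · exact (abs_add_le _ _).trans (add_le_add hw1 (signType_abs_le _))
  · simp only [coinModel]
    dsimp only at hw2
    generalize (m.next q _).2.2.2.2 = c
    cases c <;> simp [coinMove] <;> omega
  · simp only [coinModel]
    dsimp only at hw3
    generalize (m.next q _).2.2.2.2 = c
    cases c <;> simp [coinMove] <;> omega
  · simp only [coinModel]
    rw [Function.update_of_ne]
    · exact h5 p hp
    · rintro rfl
      exact hp hw1

/-- Apart from moving the heads, a step destroys only the old state and the overwritten symbol; the
label records these and the moves really made. -/
lemma undoStep_step {w : m.Conf} (h : w ∈ m.window b x S) (hw : ¬ m.Halted S w) :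
    m.undoStep x (m.label b x ω w) ((coinModel Γ x ω).step m w) = w := by
  obtain ⟨⟨q, hq⟩, -, -, -⟩ := not_halted_iff.1 hw
  obtain ⟨a, ⟨ip, tp, wp, cn⟩⟩ := w
  obtain rfl : a = .inl q := hq
  rw [StoreModel.step_inl]
  simp only [undoStep, label, writeSymbol, moveBack, coinModel, add_sub_cancel_right,
    Function.update_idem, Function.update_eq_self]
  rw [moveInput_neg_effMove _ h.1]

variable (m b x ω S)

/-- The system of computations in the window. -/
noncomputable def tourSystem [Finite Γ] : TourSystem m.Conf (Nat.card m.Label) where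
  step := (coinModel Γ x ω).step m
  halted := m.Halted S
  idx v := Finite.equivFin _ (m.label b x ω v)
  undo e v := m.undoStep x ((Finite.equivFin m.Label).symm e) v
  X := m.window b x S
  finX := m.window_finite b x S
  step_mem _ := step_mem_window
  undo_step w h hw := by
    rw [Equiv.symm_apply_apply]
    exact undoStep_step h hw

/-- Test before moving the heads back: the input head can make the reverse move. -/
def canMoveBack (e : m.Label) (left right : Bool) : Prop :=
  (e.2.2.1 = .pos → left = false) ∧ (e.2.2.1 = .neg → right = false)

/-- Test after moving the heads back: a step with this label leads to the state `a` and to the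
symbol `g` under the head. -/
def matchesLabel (a : m.Q ⊕ Bool) (e : m.Label) (left right : Bool) (i : Option α) (g : Γ)
    (c : Bool) : Prop :=
  let r := m.next e.1 (i, e.2.1, c)
  r.1 = a ∧ r.2.1 = g ∧ effMove r.2.2.1 left right = e.2.2.1 ∧ r.2.2.2 = e.2.2.2

variable {m b x ω S}

/-- Validity turns into tests that a program can make in place: before moving, whether the input
head can make the reverse move; after moving, whether the heads are inside the window, and whether a
step from there with the guessed old state and symbol yields the present state and symbol and the
guessed moves. That the predecessor belongs to `window` then follows from `hv`. -/
lemma valid_iff [Finite Γ] {e : m.Label} {v : m.Conf} (hv : v ∈ m.window b x S) :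
    (m.tourSystem b x ω S).Valid (Finite.equivFin _ e) v ↔
      m.canMoveBack e (decide (v.2.inPos = 0)) (decide (v.2.inPos = x.length + 1)) ∧
      (|(m.moveBack x e v.2).workPos| ≤ S ∧ 0 ≤ (m.moveBack x e v.2).coin ∧
        (m.moveBack x e v.2).coin ≤ S) ∧
      m.matchesLabel v.1 e (decide ((m.moveBack x e v.2).inPos = 0))
        (decide ((m.moveBack x e v.2).inPos = x.length + 1))
        (inputSymbol x (m.moveBack x e v.2).inPos) (v.2.tape (m.moveBack x e v.2).workPos)
        (ω (m.moveBack x e v.2).coin.toNat) := by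
  have hidx : ∀ w, (Finite.equivFin m.Label) (m.label b x ω w) = Finite.equivFin m.Label e ↔
    m.label b x ω w = e := fun w => (Finite.equivFin m.Label).injective.eq_iff
  simp only [TourSystem.Valid, tourSystem, Equiv.symm_apply_apply, hidx]
  set σ' := m.moveBack x e v.2 with hσ'
  have hip : σ'.inPos = moveInput x.length (-e.2.2.1) v.2.inPos := rfl
  have hle : σ'.inPos ≤ x.length + 1 := moveInput_le _ hv.1
  have htape : σ'.tape = v.2.tape := rfl
  have hw : m.undoStep x e v = (.inl e.1, writeSymbol e.2.1 σ') := rfl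
  have hobs : (coinModel Γ x ω).obs (writeSymbol e.2.1 σ') =
      (inputSymbol x σ'.inPos, e.2.1, ω σ'.coin.toNat) := by
    simp [coinModel, writeSymbol]
  rw [hw, not_halted_iff, StoreModel.step_inl]
  simp only [label, hobs]
  set r := m.next e.1 (inputSymbol x σ'.inPos, e.2.1, ω σ'.coin.toNat) with hr
  constructor
  · rintro ⟨hX, ⟨-, h1⟩, h2, h3⟩
    have h3b : effMove r.2.2.1 (decide (σ'.inPos = 0)) (decide (σ'.inPos = x.length + 1)) =
        e.2.2.1 := congrArg (fun l : m.Label => l.2.2.1) h3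
    have h3c : r.2.2.2 = e.2.2.2 := congrArg (fun l : m.Label => l.2.2.2) h3
    have h2a : r.1 = v.1 := congrArg Prod.fst h2
    have h2b : moveInput x.length r.2.2.1 σ'.inPos = v.2.inPos :=
      congrArg (fun c : m.Conf => c.2.inPos) h2
    have h2c : Function.update (Function.update σ'.tape σ'.workPos e.2.1) σ'.workPos r.2.1 =
      v.2.tape := congrArg (fun c : m.Conf => c.2.tape) h2
    refine ⟨?_, h1, h2a, ?_, h3b, h3c⟩
    · constructor
      · intro he
        rw [he] at h3b hip
        rw [← h2b]
        rcases hd : r.2.2.1 with _ | _ | _ <;> rw [hd] at h3b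
        · cases h3b
        · simp only [effMove] at h3b
          split_ifs at h3b
        · simp [moveInput]
      · intro he
        rw [he] at h3b hip
        rw [← h2b]
        rcases hd : r.2.2.1 with _ | _ | _ <;> rw [hd] at h3b
        · cases h3b
        · simp only [effMove] at h3b
          split_ifs at h3b with h0
          simp only [decide_eq_true_eq] at h0
          simp only [decide_eq_false_iff_not]
          change ¬ σ'.inPos - 1 = _
          omega
        · simp only [effMove] at h3b
          split_ifs at h3b
    · rw [← h2c]
      exact (Function.update_self (f := Function.update σ'.tape σ'.workPos e.2.1) σ'.workPos
        r.2.1).symm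
  · rintro ⟨⟨hm1, hm2⟩, h1, h2, h3, h4, h5⟩
    refine ⟨⟨hle, ?_, h1.2.1, ?_, fun p hp => ?_⟩, ⟨⟨_, rfl⟩, h1⟩, ?_, ?_⟩
    · exact h1.1.trans (by omega)
    · exact h1.2.2.trans (by omega)
    · change Function.update σ'.tape σ'.workPos e.2.1 p = b
      rw [Function.update_of_ne]
      · exact hv.2.2.2.2 p hp
      · rintro rfl
        exact hp h1.1
    · refine Prod.ext h2 ?_
      change CoinStore.mk (moveInput x.length r.2.2.1 σ'.inPos)
        (Function.update (Function.update σ'.tape σ'.workPos e.2.1) σ'.workPos r.2.1)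
        (σ'.workPos + (r.2.2.2.1 : ℤ)) (σ'.coin + (coinMove r.2.2.2.2 : ℤ)) = v.2
      rw [h5, h3]
      refine CoinStore.ext ?_ ?_ ?_ ?_
      · change moveInput x.length r.2.2.1 σ'.inPos = v.2.inPos
        rw [← moveInput_effMove, h4, hip]
        have hvle := hv.1
        rcases he : e.2.2.1 with _ | _ | _
        · rfl
        · have := hm2 he
          simp only [decide_eq_false_iff_not] at this
          change min (v.2.inPos + 1) (x.length + 1) - 1 = _
          omega
        · have := hm1 he
          simp only [decide_eq_false_iff_not] at this
          change min (v.2.inPos - 1 + 1) (x.length + 1) = _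
          omega
      · simp [htape]
      · simp [hσ', moveBack]
      · simp [hσ', moveBack]
    · change (e.1, Function.update σ'.tape σ'.workPos e.2.1 σ'.workPos, _, r.2.2.2) = e
      rw [Function.update_self]
      exact Prod.ext rfl (Prod.ext rfl (Prod.ext h4 h5))

end CoinProg


/-! ## A deterministic program that makes the tour

Tape `0` holds the work tape of the simulated program, tape `1` its coin tosses. The head of
tape `2` is as far from the origin as there are nonblank cells on tape `0`; so it is easy to see
whether the tour is back at its start. Tape `3` is a counter for accepting coin sequences. -/

/-- Cells of the tapes: `none` outside of the window, otherwise a symbol, a bit and a mark of the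
origin. -/
abbrev Cell (Γ : Type) : Type := Option (Γ × Bool × Bool)

abbrev TourObs (α : Type u) (Γ : Type) : Type u := Bool × Option α × (Fin (3 + 1) → Cell Γ)

abbrev TourAct (Γ : Type) : Type :=
  (Fin (3 + 1) → Cell Γ) × SignType × (Fin (3 + 1) → SignType)

section Tapes

variable {α : Type u} {Γ : Type}

lemma tapeModel_act_four (x : List α) (c₀ c₁ c₂ c₃ : Γ) (d d₀ d₁ d₂ d₃ : SignType) (i : ℕ)
    (t₀ t₁ t₂ t₃ : ℤ → Γ) (p₀ p₁ p₂ p₃ : ℤ) :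
    (tapeModel Γ 3 x).act (![c₀, c₁, c₂, c₃], d, ![d₀, d₁, d₂, d₃])
      ⟨i, ![t₀, t₁, t₂, t₃], ![p₀, p₁, p₂, p₃]⟩ =
    ⟨moveInput x.length d i, ![Function.update t₀ p₀ c₀, Function.update t₁ p₁ c₁,
      Function.update t₂ p₂ c₂, Function.update t₃ p₃ c₃],
      ![p₀ + (d₀ : ℤ), p₁ + (d₁ : ℤ), p₂ + (d₂ : ℤ), p₃ + (d₃ : ℤ)]⟩ := by
  refine TapeStore.ext rfl ?_ ?_
  · funext j
    fin_cases j <;> rfl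
  · funext j
    fin_cases j <;> rfl

lemma tapeModel_obs_four (x : List α) (i : ℕ)
    (t₀ t₁ t₂ t₃ : ℤ → Γ) (p₀ p₁ p₂ p₃ : ℤ) :
    (tapeModel Γ 3 x).obs ⟨i, ![t₀, t₁, t₂, t₃], ![p₀, p₁, p₂, p₃]⟩ =
    (decide (i = 0), inputSymbol x i, ![t₀ p₀, t₁ p₁, t₂ p₂, t₃ p₃]) := by
  refine Prod.ext rfl (Prod.ext rfl ?_)
  funext j
  fin_cases j <;> rfl

/-- Contents of the work tape, with marks. -/
def workCells (S : ℕ) (f : ℤ → Γ) (p : ℤ) : Cell Γ :=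
  if |p| ≤ S then some (f p, false, decide (p = 0)) else none

/-- Contents of a bit tape of length `W`. -/
def bitCells (b : Γ) (W : ℕ) (β : ℕ → Bool) (p : ℤ) : Cell Γ :=
  if 0 ≤ p ∧ p < W then some (b, β p.toNat, decide (p = 0)) else none

/-- Contents of a tape on which only the origin is marked. -/
def originCells (b : Γ) (p : ℤ) : Cell Γ := if p = 0 then some (b, false, true) else none

open Classical in
/-- Number of nonblank cells in the window. -/
noncomputable def nonblank (b : Γ) (S : ℕ) (f : ℤ → Γ) : ℕ :=
  ((Finset.Icc (-(S : ℤ)) S).filter fun p => f p ≠ b).card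

open Classical in
/-- Change of the number of nonblank cells when `g` is replaced by `g'`. -/
noncomputable def blankChange (b g g' : Γ) : SignType :=
  if g = b then if g' = b then .zero else .pos else if g' = b then .neg else .zero

/-- Only one cell changes, so the count changes by at most one: a single move of the head of tape
`2` keeps it correct. -/
lemma nonblank_update (b : Γ) (S : ℕ) (f : ℤ → Γ) (p : ℤ) (hp : |p| ≤ S) (g : Γ) :
    (nonblank b S (Function.update f p g) : ℤ) = nonblank b S f + (blankChange b (f p) g : ℤ) := by
  classical
  have hmem : p ∈ Finset.Icc (-(S : ℤ)) S := Finset.mem_Icc.2 (abs_le.1 hp)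
  have key : ∀ f : ℤ → Γ, nonblank b S f =
      (((Finset.Icc (-(S : ℤ)) S).erase p).filter fun p => f p ≠ b).card +
        if f p = b then 0 else 1 := by
    intro f
    rw [nonblank, Finset.filter_erase]
    split_ifs with h
    · rw [Finset.erase_eq_of_notMem (by simp [h]), add_zero]
    · rw [Finset.card_erase_add_one (Finset.mem_filter.2 ⟨hmem, h⟩)]
  rw [key, key f]
  have hcongr : (((Finset.Icc (-(S : ℤ)) S).erase p).filter fun q => Function.update f p g q ≠ b) =
      (((Finset.Icc (-(S : ℤ)) S).erase p).filter fun q => f q ≠ b) := by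
    refine Finset.filter_congr fun q hq => ?_
    rw [Function.update_of_ne (Finset.ne_of_mem_erase hq)]
  rw [hcongr, Function.update_self]
  unfold blankChange
  split_ifs <;> simp

lemma nonblank_le (b : Γ) (S : ℕ) (f : ℤ → Γ) : nonblank b S f ≤ 2 * S + 1 := by
  classical
  refine (Finset.card_filter_le _ _).trans ?_
  rw [Int.card_Icc]
  omega

lemma nonblank_eq_zero {b : Γ} {S : ℕ} {f : ℤ → Γ} (h : nonblank b S f = 0) {p : ℤ}
    (hp : |p| ≤ S) : f p = b := by
  classical
  by_contra hne
  rw [nonblank, Finset.card_eq_zero] at h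
  have : p ∈ (Finset.Icc (-(S : ℤ)) S).filter fun p => f p ≠ b :=
    Finset.mem_filter.2 ⟨Finset.mem_Icc.2 (abs_le.1 hp), hne⟩
  rw [h] at this
  simp at this

lemma nonblank_blank (b : Γ) (S : ℕ) : nonblank b S (fun _ => b) = 0 := by
  classical
  simp [nonblank]

lemma update_workCells {S : ℕ} {f : ℤ → Γ} {p : ℤ} (hp : |p| ≤ S) (g : Γ) :
    Function.update (workCells S f) p (some (g, false, decide (p = 0))) =
      workCells S (Function.update f p g) := by
  funext q
  by_cases hq : q = p
  · subst hq
    simp [workCells, hp]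
  · simp [workCells, Function.update_of_ne hq]

/-- The store of the simulation: simulated store, contents of the bit tapes, and position of the
head on the counter. -/
noncomputable def bigStore (b : Γ) (S : ℕ) (β κ : ℕ → Bool) (σ : CoinStore Γ) (p : ℤ) :
    TapeStore (Cell Γ) 3 :=
  ⟨σ.inPos, ![workCells S σ.tape, bitCells b (S + 1) β, originCells b, bitCells b (S + 1) κ],
    ![σ.workPos, σ.coin, nonblank b S σ.tape, p]⟩

lemma obs_bigStore (x : List α) (b : Γ) (S : ℕ) (β κ : ℕ → Bool) (σ : CoinStore Γ) (p : ℤ) :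
    (tapeModel (Cell Γ) 3 x).obs (bigStore b S β κ σ p) =
    (decide (σ.inPos = 0), inputSymbol x σ.inPos, ![workCells S σ.tape σ.workPos,
      bitCells b (S + 1) β σ.coin, originCells b (nonblank b S σ.tape),
      bitCells b (S + 1) κ p]) := tapeModel_obs_four ..

/-- Moving heads without writing. -/
lemma act_bigStore_move (x : List α) (b : Γ) (S : ℕ) (β κ : ℕ → Bool) (σ : CoinStore Γ) (p : ℤ)
    (d d₀ d₁ d₃ : SignType) :
    (tapeModel (Cell Γ) 3 x).act (((tapeModel (Cell Γ) 3 x).obs (bigStore b S β κ σ p)).2.2, d,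
      ![d₀, d₁, 0, d₃]) (bigStore b S β κ σ p) =
    bigStore b S β κ ⟨moveInput x.length d σ.inPos, σ.tape, σ.workPos + (d₀ : ℤ),
      σ.coin + (d₁ : ℤ)⟩ (p + (d₃ : ℤ)) := by
  rw [obs_bigStore]
  refine (tapeModel_act_four ..).trans ?_
  simp [bigStore]

/-- Writing a symbol, and moving heads. -/
lemma act_bigStore_write (x : List α) (b : Γ) (S : ℕ) (β κ : ℕ → Bool) (σ : CoinStore Γ) (p : ℤ)
    (d d₀ d₁ : SignType) (g : Γ) (hp : |σ.workPos| ≤ S) :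
    (tapeModel (Cell Γ) 3 x).act (![some (g, false, decide (σ.workPos = 0)),
      bitCells b (S + 1) β σ.coin, originCells b (nonblank b S σ.tape),
      bitCells b (S + 1) κ p], d,
      ![d₀, d₁, blankChange b (σ.tape σ.workPos) g, 0]) (bigStore b S β κ σ p) =
    bigStore b S β κ ⟨moveInput x.length d σ.inPos, Function.update σ.tape σ.workPos g,
      σ.workPos + (d₀ : ℤ), σ.coin + (d₁ : ℤ)⟩ p := by
  refine (tapeModel_act_four ..).trans ?_
  simp [bigStore, update_workCells hp, nonblank_update b S σ.tape σ.workPos hp g]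

end Tapes

namespace CoinProg

variable {α : Type u} {Γ : Type} [Finite Γ] (m : CoinProg α Γ) (b : Γ)

/-- State of the tour: control state, number of predecessors visited, and whether accepting
configurations and configurations outside of the window have been seen. -/
abbrev TourState : Type := (m.Q ⊕ Bool) × Fin (Nat.card m.Label + 1) × Bool × Bool

/-- Do nothing, and return a value. -/
def skipWith {E : Type} (e : E) : Prog (TourObs α Γ) (TourAct Γ) E :=
  .op fun o => (e, o.2.2, 0, ![0, 0, 0, 0])

/-- Is the input head on the right end-marker? -/
def rightFlag (o : TourObs α Γ) : Bool := o.2.1.isNone && !o.1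

open Classical in
/-- Try to go to the predecessor with label `e`. -/
noncomputable def tourBack (a : m.Q ⊕ Bool) (e : m.Label) :
    Prog (TourObs α Γ) (TourAct Γ) Bool :=
  .bind (.op fun o =>
    if m.canMoveBack e o.1 (rightFlag o) then
      (true, o.2.2, -e.2.2.1, ![-e.2.2.2.1, -coinMove e.2.2.2.2, 0, 0])
    else (false, o.2.2, 0, ![0, 0, 0, 0]))
  fun ok => if ok then
    -- A cell `none` on tape `0` or `1` shows that a head has left the window. In this case, and if
    -- the label does not match, the heads move forward again.
    .op fun o => match o.2.2 0, o.2.2 1 with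
      | some (g, _, z), some (_, c, _) =>
        if m.matchesLabel a e o.1 (rightFlag o) o.2.1 g c then
          (true, ![some (e.2.1, false, z), o.2.2 1, o.2.2 2, o.2.2 3], 0,
            ![0, 0, blankChange b g e.2.1, 0])
        else (false, o.2.2, e.2.2.1, ![e.2.2.2.1, coinMove e.2.2.2.2, 0, 0])
      | _, _ => (false, o.2.2, e.2.2.1, ![e.2.2.2.1, coinMove e.2.2.2.2, 0, 0])
    else skipWith false

open Classical in
/-- Go up in the tree, if the configuration has not halted. -/
noncomputable def tourUp (a : m.Q ⊕ Bool) (acc ovf : Bool) :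
    Prog (TourObs α Γ) (TourAct Γ) m.TourState :=
  .op fun o => match a, o.2.2 0, o.2.2 1 with
    | .inl q, some (g, _, z), some (_, c, _) =>
      let r := m.next q (o.2.1, g, c)
      ((r.1, (Finite.equivFin m.Label (q, g, effMove r.2.2.1 o.1 (rightFlag o), r.2.2.2)).succ,
        acc, ovf),
        ![some (r.2.1, false, z), o.2.2 1, o.2.2 2, o.2.2 3], r.2.2.1,
          ![r.2.2.2.1, coinMove r.2.2.2.2, blankChange b g r.2.1, 0])
    -- A running state outside of the window counts as halted: the tour continues at index `0`, and
    -- the overflow is noted.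
    | .inl q, _, _ => ((.inl q, 0, acc, true), o.2.2, 0, ![0, 0, 0, 0])
    | .inr e, _, _ => ((.inr e, 0, acc || e, ovf), o.2.2, 0, ![0, 0, 0, 0])

/-- One step of the tour. -/
noncomputable def tourStep (z : m.TourState) : Prog (TourObs α Γ) (TourAct Γ) m.TourState :=
  if h : (z.2.1 : ℕ) < Nat.card m.Label then
    .bind (m.tourBack b z.1 ((Finite.equivFin m.Label).symm ⟨z.2.1, h⟩)) fun ok =>
      skipWith (if ok then (.inl ((Finite.equivFin m.Label).symm ⟨z.2.1, h⟩).1, 0, z.2.2)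
        else (z.1, ⟨z.2.1 + 1, by omega⟩, z.2.2))
  else m.tourUp b z.1 z.2.2.1 z.2.2.2

/-- Mark of the origin. -/
def isOrigin (c : Cell Γ) : Bool := c.elim false fun c => c.2.2

open Classical in
/-- Are we back at the start of the tour? -/
noncomputable def atStart (z : m.TourState) (o : TourObs α Γ) : Bool :=
  decide (z.1 = .inl m.start ∧ z.2.1 = 0) && o.1 && isOrigin (o.2.2 0) && isOrigin (o.2.2 1) &&
    isOrigin (o.2.2 2)

/-- The whole tour; the exit value tells whether accepting configurations and configurations
outside of the window have been seen. -/
noncomputable def tourProg : Prog (TourObs α Γ) (TourAct Γ) (Bool × Bool) :=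
  .iter (X := m.TourState) (fun z => .bind (m.tourStep b z) fun z' =>
    .op fun o => (if m.atStart z' o then .inr z'.2.2 else .inl z', o.2.2, 0, ![0, 0, 0, 0]))
    (.inl m.start, 0, false, false)

end CoinProg


/-! ### Correctness of the tour program. -/

namespace CoinProg

open StoreModel

variable {α : Type u} {Γ : Type} {m : CoinProg α Γ} {b : Γ} {x : List α}
  {S : ℕ} {β κ : ℕ → Bool}

/-- All work heads are within distance `B` of the origin. -/
def Within {Γ : Type} {k : ℕ} (B : ℤ) (s : TapeStore Γ k) : Prop := ∀ i, |s.workPos i| ≤ B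

/-- A tentative move back leads from `S + 1` to at most `S + 2`, and the count of nonblank cells is
at most `2 * S + 1`; the bound `2 * S + 3` covers both. -/
lemma within_bigStore {B : ℤ} (hB : 2 * S + 3 ≤ B) {σ : CoinStore Γ} {p : ℤ}
    (h0 : |σ.workPos| ≤ S + 2) (h1 : |σ.coin| ≤ S + 2) (h2 : |p| ≤ S + 2) :
    Within B (bigStore b S β κ σ p) := by
  have h3 := nonblank_le b S σ.tape
  rw [Within, Fin.forall_fin_succ, Fin.forall_fin_succ, Fin.forall_fin_succ, Fin.forall_fin_one]
  refine ⟨?_, ?_, ?_, ?_⟩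
  · change |σ.workPos| ≤ B
    omega
  · change |σ.coin| ≤ B
    omega
  · change |(nonblank b S σ.tape : ℤ)| ≤ B
    rw [abs_of_nonneg (by omega)]
    omega
  · change |p| ≤ B
    omega

lemma within_window {B : ℤ} (hB : 2 * S + 3 ≤ B) {v : m.Conf} (hv : v ∈ m.window b x S) :
    Within B (bigStore b S β κ v.2 0) :=
  within_bigStore hB (hv.2.1.trans (by omega))
    (by rw [abs_of_nonneg hv.2.2.1]; have := hv.2.2.2.1; omega) (by simp; omega)

lemma rightFlag_obs {σ : CoinStore Γ} {p : ℤ} (h : σ.inPos ≤ x.length + 1) :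
    rightFlag ((tapeModel (Cell Γ) 3 x).obs (bigStore b S β κ σ p)) =
      decide (σ.inPos = x.length + 1) := by
  rw [obs_bigStore, rightFlag]
  simp only [inputSymbol_isNone]
  rw [Bool.eq_iff_iff]
  simp
  omega

lemma runs_skipWith {E : Type} {P : TapeStore (Cell Γ) 3 → Prop} {σ : CoinStore Γ} {p : ℤ} (e : E)
    (hP : P (bigStore b S β κ σ p)) :
    (tapeModel (Cell Γ) 3 x).Runs (skipWith e) P (bigStore b S β κ σ p) e
      (bigStore b S β κ σ p) := by
  refine Runs.op' rfl ?_ hP hP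
  refine (act_bigStore_move x b S β κ σ p 0 0 0 0).trans ?_
  have : moveInput x.length 0 σ.inPos = σ.inPos := rfl
  simp [this]

lemma workCells_of {f : ℤ → Γ} {p : ℤ} (h : |p| ≤ S) :
    workCells S f p = some (f p, false, decide (p = 0)) := by simp [workCells, h]

lemma workCells_of_not {f : ℤ → Γ} {p : ℤ} (h : ¬ |p| ≤ S) : workCells S f p = none := by
  simp [workCells, h]

lemma bitCells_of {W : ℕ} {p : ℤ} (h : 0 ≤ p ∧ p < W) :
    bitCells b W β p = some (b, β p.toNat, decide (p = 0)) := by simp [bitCells, h]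

lemma bitCells_of_not {W : ℕ} {p : ℤ} (h : ¬ (0 ≤ p ∧ p < W)) : bitCells b W β p = none := by
  simp only [bitCells, h, if_false]

variable [Finite Γ]

-- The cases are those of `valid_iff`. An impossible reverse move is noticed before anything has
-- changed; every other failure is noticed after moving back, and then the forward move restores the
-- store.
open Classical in
lemma runs_tourBack {B : ℤ} (hB : 2 * S + 3 ≤ B) {v : m.Conf} (hv : v ∈ m.window b x S)
    (e : m.Label) :
    (tapeModel (Cell Γ) 3 x).Runs (m.tourBack b v.1 e) (Within B) (bigStore b S β κ v.2 0)
      (decide ((m.tourSystem b x β S).Valid (Finite.equivFin _ e) v))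
      (bigStore b S β κ (if (m.tourSystem b x β S).Valid (Finite.equivFin _ e) v then
        (m.undoStep x e v).2 else v.2) 0) := by
  have hin := within_window (β := β) (κ := κ) hB hv
  by_cases hc : m.canMoveBack e (decide (v.2.inPos = 0)) (decide (v.2.inPos = x.length + 1))
  swap
  · have hnv : ¬ (m.tourSystem b x β S).Valid (Finite.equivFin _ e) v := fun h =>
      hc ((valid_iff hv).1 h).1
    rw [decide_eq_false hnv, if_neg hnv]
    refine Runs.bind (e := false) (s' := bigStore b S β κ v.2 0) ?_ (runs_skipWith _ hin)
    refine Runs.op' (a := (((tapeModel (Cell Γ) 3 x).obs (bigStore b S β κ v.2 0)).2.2, 0,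
      ![0, 0, 0, 0])) ?_ ?_ hin hin
    · rw [rightFlag_obs hv.1, obs_bigStore, if_neg hc]
    · refine (act_bigStore_move x b S β κ v.2 0 0 0 0 0).trans ?_
      have : moveInput x.length 0 v.2.inPos = v.2.inPos := rfl
      simp [this]
  have hw0 : |(m.moveBack x e v.2).workPos| ≤ S + 2 := by
    have h1 := signType_abs_le e.2.2.2.1
    have h2 := hv.2.1
    simp only [moveBack]
    rw [abs_le] at *
    omega
  have hw1 : |(m.moveBack x e v.2).coin| ≤ S + 2 := by
    have h1 := signType_abs_le (coinMove e.2.2.2.2)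
    have h2 := hv.2.2.1
    have h3 := hv.2.2.2.1
    simp only [moveBack]
    rw [abs_le] at *
    omega
  have hin' : Within B (bigStore b S β κ (m.moveBack x e v.2) 0) :=
    within_bigStore hB hw0 hw1 (by simp; omega)
  have hle' : (m.moveBack x e v.2).inPos ≤ x.length + 1 := moveInput_le _ hv.1
  refine Runs.bind (e := true) (s' := bigStore b S β κ (m.moveBack x e v.2) 0) ?_ ?_
  · refine Runs.op' (a := (((tapeModel (Cell Γ) 3 x).obs (bigStore b S β κ v.2 0)).2.2,
      -e.2.2.1, ![-e.2.2.2.1, -coinMove e.2.2.2.2, 0, 0])) ?_ ?_ hin hin'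
    · rw [rightFlag_obs hv.1, obs_bigStore, if_pos hc]
    · refine (act_bigStore_move x b S β κ v.2 0 _ _ _ 0).trans ?_
      simp [moveBack, sub_eq_add_neg]
  -- Moving forward undoes moving back, because `canMoveBack` excludes that the reverse move was cut
  -- off at an end-marker.
  · have hforth : (tapeModel (Cell Γ) 3 x).act
        (((tapeModel (Cell Γ) 3 x).obs (bigStore b S β κ (m.moveBack x e v.2) 0)).2.2, e.2.2.1,
          ![e.2.2.2.1, coinMove e.2.2.2.2, 0, 0]) (bigStore b S β κ (m.moveBack x e v.2) 0) =
        bigStore b S β κ v.2 0 := by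
      refine (act_bigStore_move x b S β κ _ 0 _ _ _ 0).trans ?_
      have : moveInput x.length e.2.2.1 (moveInput x.length (-e.2.2.1) v.2.inPos) =
          v.2.inPos := by
        have hvle := hv.1
        obtain ⟨hm1, hm2⟩ := hc
        rcases he : e.2.2.1 with _ | _ | _
        · rfl
        · have := hm2 he
          simp only [decide_eq_false_iff_not] at this
          change min (v.2.inPos + 1) (x.length + 1) - 1 = _
          omega
        · have := hm1 he
          simp only [decide_eq_false_iff_not] at this
          change min (v.2.inPos - 1 + 1) (x.length + 1) = _
          omega
      simp [moveBack, this]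
    by_cases hwin : |(m.moveBack x e v.2).workPos| ≤ S ∧ 0 ≤ (m.moveBack x e v.2).coin ∧
        (m.moveBack x e v.2).coin ≤ S
    · have h0 := workCells_of (f := (m.moveBack x e v.2).tape) hwin.1
      have h1 := bitCells_of (b := b) (β := β) (W := S + 1) (p := (m.moveBack x e v.2).coin)
        ⟨hwin.2.1, by push_cast; omega⟩
      by_cases hm : m.matchesLabel v.1 e (decide ((m.moveBack x e v.2).inPos = 0))
          (decide ((m.moveBack x e v.2).inPos = x.length + 1))
          (inputSymbol x (m.moveBack x e v.2).inPos) (v.2.tape (m.moveBack x e v.2).workPos)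
          (β (m.moveBack x e v.2).coin.toNat)
      · have hval : (m.tourSystem b x β S).Valid (Finite.equivFin _ e) v :=
          (valid_iff hv).2 ⟨hc, hwin, hm⟩
        rw [decide_eq_true hval, if_pos hval]
        refine Runs.op' (a := (![some (e.2.1, false, decide ((m.moveBack x e v.2).workPos = 0)),
          bitCells b (S + 1) β (m.moveBack x e v.2).coin,
          originCells b (nonblank b S (m.moveBack x e v.2).tape),
          bitCells b (S + 1) κ 0], 0,
          ![0, 0, blankChange b ((m.moveBack x e v.2).tape (m.moveBack x e v.2).workPos) e.2.1,
            0])) ?_ ?_ hin' ?_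
        · rw [rightFlag_obs hle', obs_bigStore]
          simp only [Matrix.cons_val]
          rw [h0, h1]
          simp only
          exact if_pos hm
        · rw [act_bigStore_write _ _ _ _ _ _ _ _ _ _ _ hwin.1]
          have : moveInput x.length 0 (m.moveBack x e v.2).inPos = (m.moveBack x e v.2).inPos := rfl
          simp [undoStep, writeSymbol, this]
        · exact within_bigStore hB hw0 hw1 (by simp; omega)
      · have hval : ¬ (m.tourSystem b x β S).Valid (Finite.equivFin _ e) v := fun h =>
          hm ((valid_iff hv).1 h).2.2
        rw [decide_eq_false hval, if_neg hval]
        refine Runs.op' ?_ hforth hin' hin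
        rw [rightFlag_obs hle', obs_bigStore]
        simp only [Matrix.cons_val]
        rw [h0, h1]
        simp only
        exact if_neg hm
    · have hval : ¬ (m.tourSystem b x β S).Valid (Finite.equivFin _ e) v := fun h =>
        hwin ((valid_iff hv).1 h).2.1
      rw [decide_eq_false hval, if_neg hval]
      refine Runs.op' ?_ hforth hin' hin
      rw [rightFlag_obs hle', obs_bigStore]
      simp only [Matrix.cons_val]
      by_cases h : |(m.moveBack x e v.2).workPos| ≤ S
      · have h1 := bitCells_of_not (b := b) (β := β) (W := S + 1) (p := (m.moveBack x e v.2).coin)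
          (fun h2 => hwin ⟨h, h2.1, by have := h2.2; push_cast at this; omega⟩)
        rw [h1]
        cases workCells S (m.moveBack x e v.2).tape (m.moveBack x e v.2).workPos <;> rfl
      · rw [workCells_of_not h]

-- Halting is visible at the heads: either the control state is an exit value, which decides the
-- acceptance flag, or one of the cells on tapes `0` and `1` is `none`, which sets the overflow
-- flag.
open Classical in
lemma runs_tourUp {B : ℤ} (hB : 2 * S + 3 ≤ B) {v : m.Conf} (hv : v ∈ m.window b x S)
    (acc ovf : Bool) :
    (tapeModel (Cell Γ) 3 x).Runs (m.tourUp b v.1 acc ovf) (Within B) (bigStore b S β κ v.2 0)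
      (((m.tourSystem b x β S).tour (v, Fin.last _)).1.1,
        ((m.tourSystem b x β S).tour (v, Fin.last _)).2,
        acc || decide (v.1 = .inr true), ovf || (decide (m.Halted S v) && v.1.isLeft))
      (bigStore b S β κ ((m.tourSystem b x β S).tour (v, Fin.last _)).1.2 0) := by
  have hin := within_window (β := β) (κ := κ) hB hv
  have hstay : (tapeModel (Cell Γ) 3 x).act
        (((tapeModel (Cell Γ) 3 x).obs (bigStore b S β κ v.2 0)).2.2, 0, ![0, 0, 0, 0])
        (bigStore b S β κ v.2 0) = bigStore b S β κ v.2 0 := by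
    refine (act_bigStore_move x b S β κ _ 0 _ _ _ 0).trans ?_
    have : moveInput x.length 0 v.2.inPos = v.2.inPos := rfl
    simp [this]
  have hin2 := (m.tourSystem b x β S).tour_mem (v, Fin.last _) hv
  by_cases hh : m.Halted S v
  · rw [(m.tourSystem b x β S).tour_halted hh]
    obtain ⟨a, σ⟩ := v
    rcases a with q | e
    · refine Runs.op' ?_ hstay hin hin
      rw [obs_bigStore]
      simp only [Matrix.cons_val, reduceCtorEq, decide_false, Bool.or_false, hh, decide_true,
        Sum.isLeft_inl, Bool.and_true, Bool.or_true]
      by_cases h : |σ.workPos| ≤ S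
      · have h1 := bitCells_of_not (b := b) (β := β) (W := S + 1) (p := σ.coin) (fun h2 => by
          rcases hh with hh | hh
          · simp at hh
          · refine hh ⟨h, h2.1, ?_⟩
            have := h2.2
            push_cast at this
            exact Int.lt_add_one_iff.1 this)
        rw [h1]
        cases workCells S σ.tape σ.workPos <;> rfl
      · rw [workCells_of_not h]
    · refine Runs.op' ?_ hstay hin hin
      cases e <;> simp
  · rw [(m.tourSystem b x β S).tour_up hh] at hin2 ⊢
    obtain ⟨⟨q, hq⟩, hwin⟩ := not_halted_iff.1 hh
    obtain ⟨a, σ⟩ := v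
    obtain rfl : a = .inl q := hq
    have h0 := workCells_of (f := σ.tape) hwin.1
    have h1 := bitCells_of (b := b) (β := β) (W := S + 1) (p := σ.coin)
        ⟨hwin.2.1, by push_cast; exact Int.lt_add_one_iff.2 hwin.2.2⟩
    refine Runs.op' ?_ (act_bigStore_write x b S β κ σ 0 _ _ _ _ hwin.1) hin
      (within_window hB hin2)
    rw [rightFlag_obs hv.1, obs_bigStore]
    simp only [Matrix.cons_val]
    rw [h0, h1]
    simp [hh, tourSystem, label, coinModel, step_inl]

open Classical in
lemma runs_tourStep {B : ℤ} (hB : 2 * S + 3 ≤ B) {v : m.Conf} (hv : v ∈ m.window b x S)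
    (j : Fin (Nat.card m.Label + 1)) (acc ovf : Bool) :
    (tapeModel (Cell Γ) 3 x).Runs (m.tourStep b (v.1, j, acc, ovf)) (Within B)
      (bigStore b S β κ v.2 0)
      (((m.tourSystem b x β S).tour (v, j)).1.1, ((m.tourSystem b x β S).tour (v, j)).2,
        acc || decide (j = Fin.last _ ∧ v.1 = .inr true),
        ovf || decide (j = Fin.last _ ∧ m.Halted S v ∧ v.1.isLeft))
      (bigStore b S β κ ((m.tourSystem b x β S).tour (v, j)).1.2 0) := by
  have hin2 := (m.tourSystem b x β S).tour_mem (v, j) hv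
  by_cases hj : (j : ℕ) < Nat.card m.Label
  · have hne : j ≠ Fin.last _ := fun h => by rw [h] at hj; simp at hj
    have hb := runs_tourBack (β := β) (κ := κ) hB hv ((Finite.equivFin m.Label).symm ⟨j, hj⟩)
    rw [Equiv.apply_symm_apply] at hb
    rw [tourStep, dif_pos hj]
    by_cases hval : (m.tourSystem b x β S).Valid ⟨j, hj⟩ v
    · rw [(m.tourSystem b x β S).tour_valid hj hval] at hin2 ⊢
      rw [if_pos hval, decide_eq_true hval] at hb
      refine hb.bind ?_
      have := runs_skipWith (b := b) (x := x) (S := S) (β := β) (κ := κ)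
        (σ := ((m.tourSystem b x β S).undo ⟨j, hj⟩ v).2) (p := 0) (P := Within B)
        (Sum.inl (β := Bool) ((Finite.equivFin m.Label).symm ⟨j, hj⟩).1,
        (0 : Fin (Nat.card m.Label + 1)), acc, ovf) (within_window hB hin2)
      simpa [hne, tourSystem, undoStep] using this
    · rw [(m.tourSystem b x β S).tour_invalid hj hval]
      rw [if_neg hval, decide_eq_false hval] at hb
      refine hb.bind ?_
      have := runs_skipWith (b := b) (x := x) (S := S) (β := β) (κ := κ)
        (σ := v.2) (p := 0) (P := Within B) (v.1,
        (⟨j + 1, by omega⟩ : Fin (Nat.card m.Label + 1)), acc, ovf) (within_window hB hv)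
      simpa [hne] using this
  · obtain rfl : j = Fin.last _ := Fin.ext (by rw [Fin.val_last]; omega)
    rw [tourStep, dif_neg hj]
    have := runs_tourUp (β := β) (κ := κ) hB hv acc ovf
    simpa using this

-- The marks of the origin on tapes `0`, `1` and `2` say that the work head and the coins are at `0`
-- and that no cell of the window is nonblank; outside of the window the tape is blank anyway. So
-- finitely many visible data identify the initial configuration.
omit [Finite Γ] in
lemma atStart_iff {v : m.Conf} (hv : v ∈ m.window b x S) (j : Fin (Nat.card m.Label + 1))
    (f : Bool × Bool) :
    m.atStart (v.1, j, f) ((tapeModel (Cell Γ) 3 x).obs (bigStore b S β κ v.2 0)) = true ↔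
      (v, j) = ((.inl m.start, .init b), 0) := by
  rw [obs_bigStore]
  obtain ⟨a, σ⟩ := v
  simp only [atStart, Bool.and_eq_true, decide_eq_true_eq, Matrix.cons_val]
  constructor
  · rintro ⟨⟨⟨⟨⟨rfl, rfl⟩, h1⟩, h2⟩, h3⟩, h4⟩
    have h2' : σ.workPos = 0 := by
      by_contra hne
      unfold workCells isOrigin at h2
      split_ifs at h2 <;> simp [hne] at h2
    have h3' : σ.coin = 0 := by
      by_contra hne
      unfold bitCells isOrigin at h3
      split_ifs at h3 <;> simp [hne] at h3
    have h4' : nonblank b S σ.tape = 0 := by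
      by_contra hne
      unfold originCells isOrigin at h4
      split_ifs at h4 with h5
      · exact hne (by exact_mod_cast h5)
      · simp at h4
    have h5 : σ.tape = fun _ => b := by
      funext p
      by_cases hp : |p| ≤ S
      · exact nonblank_eq_zero h4' hp
      · exact hv.2.2.2.2 p hp
    have : σ = .init b := CoinStore.ext h1 h5 h2' h3'
    rw [this]
  · intro h
    simp only [Prod.mk.injEq] at h
    obtain ⟨⟨rfl, rfl⟩, rfl⟩ := h
    simp [CoinStore.init, workCells, bitCells, originCells, isOrigin, nonblank_blank]

omit [Finite Γ] in
lemma init_mem_window : ((.inl m.start, .init b) : m.Conf) ∈ m.window b x S := by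
  refine ⟨Nat.zero_le _, ?_, le_rfl, ?_, fun _ _ => rfl⟩ <;> simp [CoinStore.init] <;> omega

-- The test for the start follows every step, so by minimality of the period the loop makes exactly
-- one round of the tour. In it the halting configurations that appear at their last position are
-- those of the computation, by `tour_halted_iff`; the flags collect the accepting and the
-- overflowing ones among them.
open Classical in
theorem runs_tourProg {B : ℤ} (hB : 2 * S + 3 ≤ B) :
    (tapeModel (Cell Γ) 3 x).Runs (m.tourProg b) (Within B) (bigStore b S β κ (.init b) 0)
      (decide (∃ t, ((m.tourSystem b x β S).bstep^[t] (.inl m.start, .init b)).1 = .inr true),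
        decide (∃ t, m.Halted S ((m.tourSystem b x β S).bstep^[t] (.inl m.start, .init b)) ∧
          ((m.tourSystem b x β S).bstep^[t] (.inl m.start, .init b)).1.isLeft))
      (bigStore b S β κ (.init b) 0) := by
  set Y := m.tourSystem b x β S with hY
  set c₀ : m.Conf := (.inl m.start, .init b) with hc₀
  have hc : c₀ ∈ Y.X := init_mem_window
  obtain ⟨T, hT, hper, hmin⟩ := Y.exists_period hc
  let z : ℕ → m.Conf × Fin (Nat.card m.Label + 1) := fun i => Y.tour^[i] (c₀, 0)
  have hz : ∀ i, (z i).1 ∈ Y.X := Y.iterate_tour_mem hc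
  have hzs : ∀ i, z (i + 1) = Y.tour (z i) := fun i => Function.iterate_succ_apply' _ _ _
  let A : m.Conf × Fin (Nat.card m.Label + 1) → Prop := fun z =>
    z.2 = Fin.last _ ∧ z.1.1 = .inr true
  let V : m.Conf × Fin (Nat.card m.Label + 1) → Prop := fun z =>
    z.2 = Fin.last _ ∧ m.Halted S z.1 ∧ z.1.1.isLeft
  let w : ℕ → m.TourState := fun i =>
    ((z i).1.1, (z i).2, decide (∃ k < i, A (z k)), decide (∃ k < i, V (z k)))
  have hw0 : w 0 = (.inl m.start, 0, false, false) := by simp [w, z, c₀]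
  -- The decidability instances are arguments so that the equation applies to whichever instances
  -- occur in `w` and in the step lemma.
  have hflag : ∀ (p : m.Conf × Fin (Nat.card m.Label + 1) → Prop) (i : ℕ)
      (d₁ : Decidable (∃ k < i + 1, p (z k))) (d₂ : Decidable (∃ k < i, p (z k)))
      (d₃ : Decidable (p (z i))),
      decide (∃ k < i + 1, p (z k)) = (decide (∃ k < i, p (z k)) || decide (p (z i))) := by
    intro p i _ _ _
    simp only [Nat.lt_succ_iff_lt_or_eq]
    rw [Bool.eq_iff_iff]
    simp only [decide_eq_true_eq, Bool.or_eq_true]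
    constructor
    · rintro ⟨k, hk | rfl, h⟩
      · exact .inl ⟨k, hk, h⟩
      · exact .inr h
    · rintro (⟨k, hk, h⟩ | h)
      · exact ⟨k, .inl hk, h⟩
      · exact ⟨i, .inr rfl, h⟩
  have hstep : ∀ i, (tapeModel (Cell Γ) 3 x).Runs (m.tourStep b (w i)) (Within B)
      (bigStore b S β κ (z i).1.2 0) (w (i + 1)) (bigStore b S β κ (z (i + 1)).1.2 0) := by
    intro i
    have := runs_tourStep (β := β) (κ := κ) hB (hz i) (z i).2 (decide (∃ k < i, A (z k)))
      (decide (∃ k < i, V (z k)))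
    have hw : w (i + 1) = ((Y.tour (z i)).1.1, (Y.tour (z i)).2,
        decide (∃ k < i, A (z k)) ||
          decide ((z i).2 = Fin.last (Nat.card m.Label) ∧ (z i).1.1 = Sum.inr true),
        decide (∃ k < i, V (z k)) || decide ((z i).2 = Fin.last (Nat.card m.Label) ∧
          m.Halted S (z i).1 ∧ (z i).1.1.isLeft = true)) :=
      Prod.ext (congrArg (fun z => z.1.1) (hzs i)) (Prod.ext (congrArg (fun z => z.2) (hzs i))
        (Prod.ext (hflag A i _ _ _) (hflag V i _ _ _)))
    rw [hw, hzs]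
    exact this
  have hround : ∀ i, (tapeModel (Cell Γ) 3 x).Runs (.bind (m.tourStep b (w i)) fun z' =>
      .op fun o => ((if m.atStart z' o then .inr z'.2.2 else .inl z' : m.TourState ⊕ (Bool × Bool)),
        o.2.2, 0, ![0, 0, 0, 0])) (Within B)
      (bigStore b S β κ (z i).1.2 0)
      (if z (i + 1) = (c₀, 0) then .inr (w (i + 1)).2.2 else .inl (w (i + 1)))
      (bigStore b S β κ (z (i + 1)).1.2 0) := by
    intro i
    refine (hstep i).bind ?_
    have hin := within_window (β := β) (κ := κ) hB (hz (i + 1))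
    refine Runs.op' (a := (((tapeModel (Cell Γ) 3 x).obs
      (bigStore b S β κ (z (i + 1)).1.2 0)).2.2, 0, ![0, 0, 0, 0])) ?_ ?_ hin hin
    · have h1 := atStart_iff (β := β) (κ := κ) (hz (i + 1)) (z (i + 1)).2 (w (i + 1)).2.2
      by_cases h : z (i + 1) = (c₀, 0)
      · rw [if_pos h]
        have h2 := h1.2 h
        change (if m.atStart (w (i + 1)) _ = true then _ else _, _) = _
        change m.atStart (w (i + 1)) _ = true at h2
        rw [if_pos h2]
      · rw [if_neg h]
        have h2 : ¬ m.atStart (w (i + 1)) _ = true := fun h3 => h (h1.1 h3)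
        change (if m.atStart (w (i + 1)) _ = true then _ else _, _) = _
        rw [if_neg h2]
    · refine (act_bigStore_move x b S β κ _ 0 0 0 0 0).trans ?_
      have : moveInput x.length 0 (z (i + 1)).1.2.inPos = (z (i + 1)).1.2.inPos := rfl
      simp [this]
  have hwT : (w T).2.2 = (decide (∃ t, (Y.bstep^[t] c₀).1 = .inr true),
      decide (∃ t, m.Halted S (Y.bstep^[t] c₀) ∧ (Y.bstep^[t] c₀).1.isLeft)) := by
    have hiff := fun h hh => Y.tour_halted_iff (h := h) hc hh hT hper
    refine Prod.ext ?_ ?_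
    · refine decide_eq_decide.2 ⟨?_, ?_⟩
      · rintro ⟨k, hk, h1, h2⟩
        obtain ⟨t, ht⟩ := (hiff (z k).1 (.inl (by simp [h2]))).1 ⟨k, hk, Prod.ext rfl h1⟩
        exact ⟨t, by rw [ht, h2]⟩
      · rintro ⟨t, ht⟩
        obtain ⟨k, hk, h1⟩ := (hiff (Y.bstep^[t] c₀) (.inl (by simp [ht]))).2 ⟨t, rfl⟩
        exact ⟨k, hk, congrArg Prod.snd h1, (congrArg (fun z => z.1.1) h1).trans ht⟩
    · refine decide_eq_decide.2 ⟨?_, ?_⟩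
      · rintro ⟨k, hk, h1, h2, h3⟩
        obtain ⟨t, ht⟩ := (hiff (z k).1 h2).1 ⟨k, hk, Prod.ext rfl h1⟩
        exact ⟨t, by rw [ht]; exact ⟨h2, h3⟩⟩
      · rintro ⟨t, h2, h3⟩
        obtain ⟨k, hk, h1⟩ := (hiff (Y.bstep^[t] c₀) h2).2 ⟨t, rfl⟩
        refine ⟨k, hk, congrArg Prod.snd h1, ?_⟩
        have : (z k).1 = Y.bstep^[t] c₀ := congrArg Prod.fst h1
        rw [this]
        exact ⟨h2, h3⟩
  -- As the test comes after the step, `T - 1` rounds continue and the next one exits.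
  obtain ⟨n, rfl⟩ : ∃ n, T = n + 1 := ⟨T - 1, by omega⟩
  have := Runs.iter_of_seq (M := tapeModel (Cell Γ) 3 x) (P := Within B) n w
    (fun i => bigStore b S β κ (z i).1.2 0) (m := fun z => .bind (m.tourStep b z) fun z' =>
      .op fun o => (if m.atStart z' o then .inr z'.2.2 else .inl z', o.2.2, 0, ![0, 0, 0, 0]))
    (e := (w (n + 1)).2.2) (s' := bigStore b S β κ (z (n + 1)).1.2 0) (fun i hi => ?_) ?_
  · rw [hw0, hwT] at this
    have h1 : z (n + 1) = (c₀, 0) := hper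
    rw [h1] at this
    exact this
  · have h1 := hround i
    rwa [if_neg (hmin (i + 1) (by omega) (by omega))] at h1
  · have h1 := hround n
    rwa [if_pos hper] at h1

end CoinProg


/-! ## Enumeration of the coin sequences -/

section Idle

open StoreModel

variable {α : Type u} {Γ : Type}

/-- Bit under the head of tape `i`. -/
def readBit (i : Fin (3 + 1)) (o : TourObs α Γ) : Option Bool := (o.2.2 i).map fun c => c.2.1

/-- Replace the bit under the head of tape `i`. -/
def writeBit (i : Fin (3 + 1)) (o : TourObs α Γ) (c : Bool) (d : SignType) : TourAct Γ :=
  (Function.update o.2.2 i ((o.2.2 i).map fun g => (g.1, c, g.2.2)), 0,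
    Function.update ![0, 0, 0, 0] i d)

/-- Move the head of tape `i`. -/
def moveHead (i : Fin (3 + 1)) (o : TourObs α Γ) (d : SignType) : TourAct Γ :=
  (o.2.2, 0, Function.update ![0, 0, 0, 0] i d)

/-- Initialize the cell under the head of tape `i`. -/
def newCell (b : Γ) (i : Fin (3 + 1)) (d : SignType) (o : TourObs α Γ) : TourAct Γ :=
  (Function.update o.2.2 i (some (b, false, false)), 0, Function.update ![0, 0, 0, 0] i d)

/-- The store between two tours: window sizes of the tapes, contents of the bit tapes and positions
of their heads. -/
def idleStore (b : Γ) (S W V : ℕ) (β κ : ℕ → Bool) (p q : ℤ) : TapeStore (Cell Γ) 3 :=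
  ⟨0, ![workCells S fun _ => b, bitCells b W β, originCells b, bitCells b V κ], ![0, p, 0, q]⟩

lemma bigStore_init (b : Γ) (S : ℕ) (β κ : ℕ → Bool) :
    bigStore b S β κ (.init b) 0 = idleStore b S (S + 1) (S + 1) β κ 0 0 := by
  simp [bigStore, idleStore, CoinStore.init, nonblank_blank]

lemma update_bitCells (b : Γ) {W : ℕ} (β : ℕ → Bool) {p : ℕ} (hp : p < W) (c : Bool) :
    Function.update (bitCells b W β) p ((bitCells b W β p).map fun g => (g.1, c, g.2.2)) =
      bitCells b W (Function.update β p c) := by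
  funext q
  by_cases hq : q = p
  · subst hq
    simp [bitCells, hp]
  · rw [Function.update_of_ne hq]
    unfold bitCells
    split_ifs with h
    · rw [Function.update_of_ne]
      omega
    · rfl

/-- Since `W` is positive, the new cell is not the origin and must not carry its mark. -/
lemma append_bitCells (b : Γ) {W : ℕ} (hW : 0 < W) (β : ℕ → Bool) :
    Function.update (bitCells b W β) W (some (b, false, false)) =
      bitCells b (W + 1) (Function.update β W false) := by
  funext q
  by_cases hq : q = W
  · subst hq
    simp [bitCells, hW.ne']
  · rw [Function.update_of_ne hq]
    unfold bitCells
    by_cases h : 0 ≤ q ∧ q < W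
    · rw [if_pos h, if_pos ⟨h.1, by push_cast; omega⟩, Function.update_of_ne]
      omega
    · rw [if_neg h, if_neg]
      push_cast
      omega

lemma obs_idleStore (x : List α) (b : Γ) (S W V : ℕ) (β κ : ℕ → Bool) (p q : ℤ) :
    (tapeModel (Cell Γ) 3 x).obs (idleStore b S W V β κ p q) =
      (true, inputSymbol x 0, ![workCells S (fun _ => b) 0, bitCells b W β p, originCells b 0,
        bitCells b V κ q]) := tapeModel_obs_four ..

lemma moveInput_zero (n p : ℕ) : moveInput n 0 p = p := rfl

lemma update_four_one {β : Type*} (a b c d e : β) :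
    Function.update ![a, b, c, d] 1 e = ![a, e, c, d] := by
  funext j; fin_cases j <;> rfl

lemma update_four_three {β : Type*} (a b c d e : β) :
    Function.update ![a, b, c, d] 3 e = ![a, b, c, e] := by
  funext j; fin_cases j <;> rfl

lemma update_four_zero {β : Type*} (a b c d e : β) :
    Function.update ![a, b, c, d] 0 e = ![e, b, c, d] := by
  funext j; fin_cases j <;> rfl

lemma bitTape_coins (x : List α) (b : Γ) (S W V : ℕ) (κ : ℕ → Bool) (q : ℤ) :
    BitTape (tapeModel (Cell Γ) 3 x) W (fun β p => idleStore b S W V β κ p q)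
      (readBit 1) (writeBit 1) (moveHead 1) where
  rd_in β p hp := by
    simp [obs_idleStore, readBit, bitCells, hp]
  rd_right β := by simp [obs_idleStore, readBit, bitCells]
  rd_left β := by simp [obs_idleStore, readBit, bitCells]
  act_wr β p c d hp := by
    rw [obs_idleStore]
    simp only [writeBit, Matrix.cons_val]
    erw [update_four_one, update_four_one]
    refine (tapeModel_act_four ..).trans ?_
    simp [idleStore, update_bitCells b β hp, moveInput_zero]
  act_mv β p d := by
    rw [obs_idleStore]
    simp only [moveHead]
    erw [update_four_one]
    refine (tapeModel_act_four ..).trans ?_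
    simp [idleStore, moveInput_zero]

lemma bitTape_count (x : List α) (b : Γ) (S W V : ℕ) (β : ℕ → Bool) (p : ℤ) :
    BitTape (tapeModel (Cell Γ) 3 x) V (fun κ q => idleStore b S W V β κ p q)
      (readBit 3) (writeBit 3) (moveHead 3) where
  rd_in κ q hp := by
    simp [obs_idleStore, readBit, bitCells, hp]
  rd_right β := by simp [obs_idleStore, readBit, bitCells]
  rd_left β := by simp [obs_idleStore, readBit, bitCells]
  act_wr κ q c d hp := by
    rw [obs_idleStore]
    simp only [writeBit, Matrix.cons_val]
    erw [update_four_three, update_four_three]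
    refine (tapeModel_act_four ..).trans ?_
    simp [idleStore, update_bitCells b κ hp, moveInput_zero]
  act_mv κ q d := by
    rw [obs_idleStore]
    simp only [moveHead]
    erw [update_four_three]
    refine (tapeModel_act_four ..).trans ?_
    simp [idleStore, moveInput_zero]

open CoinProg (Within)

lemma within_idleStore {B : ℤ} {b : Γ} {S W V : ℕ} {β κ : ℕ → Bool} {p q : ℤ} (hp : |p| ≤ B)
    (hq : |q| ≤ B) : Within B (idleStore b S W V β κ p q) := by
  have hB : (0 : ℤ) ≤ B := (abs_nonneg p).trans hp
  rw [Within, Fin.forall_fin_succ, Fin.forall_fin_succ, Fin.forall_fin_succ, Fin.forall_fin_one]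
  exact ⟨by simpa [idleStore] using hB, hp, by simpa [idleStore] using hB, hq⟩

/-- Enlarge the window of the work tape by one cell on each side. -/
def growWork (b : Γ) : Prog (TourObs α Γ) (TourAct Γ) Unit :=
  .bind (.scan fun o => if (o.2.2 0).isSome then (.inl (), moveHead 0 o .pos)
    else (.inr (), newCell b 0 .neg o)) fun _ =>
  .bind (.scan fun o => if (o.2.2 0).isSome then (.inl (), moveHead 0 o .neg)
    else (.inr (), newCell b 0 .pos o)) fun _ =>
  .scan fun o => if CoinProg.isOrigin (o.2.2 0) then (.inr (), moveHead 0 o .zero)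
    else (.inl (), moveHead 0 o .pos)

/-- Enlarge all windows, set the coins to `0` and the counter to `2 ^ (W - 1) - 1` for the new
window size `W`. -/
def growAll (b : Γ) : Prog (TourObs α Γ) (TourAct Γ) Unit :=
  .bind (growWork b) fun _ =>
  .bind (.append (readBit 1) (moveHead 1) (newCell b 1 .zero)) fun _ =>
  .bind (.fill (readBit 3) (writeBit 3) (moveHead 3)) fun _ =>
  .append (readBit 3) (moveHead 3) (newCell b 3 .zero)

/-- The scans look for the first unused cell on the right, the first unused cell on the left, and
the origin. After adding a cell the head steps back into the old window; so the scans move `S + 1`,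
`2 * S + 1` and `S` times before they stop. -/
lemma runs_growWork (x : List α) (b : Γ) (S W V : ℕ) (β κ : ℕ → Bool) {B : ℤ}
    (hB : S + 1 ≤ B) :
    (tapeModel (Cell Γ) 3 x).Runs (growWork b) (Within B) (idleStore b S W V β κ 0 0) ()
      (idleStore b (S + 1) W V β κ 0 0) := by
  let st : (ℤ → Cell Γ) → ℤ → TapeStore (Cell Γ) 3 := fun f p =>
    ⟨0, ![f, bitCells b W β, originCells b, bitCells b V κ], ![p, 0, 0, 0]⟩
  have hobs : ∀ f p, (tapeModel (Cell Γ) 3 x).obs (st f p) = (true, inputSymbol x 0,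
      ![f p, bitCells b W β 0, originCells b 0, bitCells b V κ 0]) := fun f p =>
    tapeModel_obs_four ..
  have hmove : ∀ f p d, (tapeModel (Cell Γ) 3 x).act
      (moveHead 0 ((tapeModel (Cell Γ) 3 x).obs (st f p)) d) (st f p) = st f (p + (d : ℤ)) := by
    intro f p d
    rw [hobs]
    simp only [moveHead]
    erw [update_four_zero]
    refine (tapeModel_act_four ..).trans ?_
    simp [st, moveInput_zero]
  have hnew : ∀ f p d, (tapeModel (Cell Γ) 3 x).act
      (newCell b 0 d ((tapeModel (Cell Γ) 3 x).obs (st f p))) (st f p) =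
      st (Function.update f p (some (b, false, false))) (p + (d : ℤ)) := by
    intro f p d
    rw [hobs]
    simp only [newCell]
    erw [update_four_zero, update_four_zero]
    refine (tapeModel_act_four ..).trans ?_
    simp [st, moveInput_zero]
  have hP : ∀ f (p : ℤ), |p| ≤ S + 1 → Within B (st f p) := by
    intro f p hp
    have hB0 : (0 : ℤ) ≤ B := by omega
    rw [Within, Fin.forall_fin_succ, Fin.forall_fin_succ, Fin.forall_fin_succ, Fin.forall_fin_one]
    exact ⟨hp.trans hB, by simpa [st] using hB0, by simpa [st] using hB0, by simpa [st] using hB0⟩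
  set f₀ : ℤ → Cell Γ := workCells S fun _ => b with hf₀
  set f₁ := Function.update f₀ (S + 1) (some (b, false, false)) with hf₁
  set f₂ := Function.update f₁ (-(S + 1)) (some (b, false, false)) with hf₂
  have hf₂' : f₂ = workCells (S + 1) fun _ => b := by
    funext p
    by_cases h1 : p = -(S + 1)
    · rw [hf₂, h1, Function.update_self, CoinProg.workCells_of (by rw [abs_le]; push_cast; omega)]
      simp
      omega
    · rw [hf₂, Function.update_of_ne h1]
      by_cases h2 : p = S + 1
      · rw [hf₁, h2, Function.update_self, CoinProg.workCells_of (by rw [abs_le]; push_cast; omega)]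
        simp
        omega
      · rw [hf₁, Function.update_of_ne h2]
        by_cases h3 : |p| ≤ S
        · rw [hf₀, CoinProg.workCells_of h3, CoinProg.workCells_of (by push_cast; omega)]
        · rw [hf₀, CoinProg.workCells_of_not h3, CoinProg.workCells_of_not]
          rw [abs_le] at h3 ⊢
          push_cast
          omega
  have hs : (idleStore b S W V β κ 0 0) = st f₀ 0 := rfl
  have hs' : (idleStore b (S + 1) W V β κ 0 0) = st f₂ 0 := by rw [hf₂']; rfl
  rw [hs, hs']
  refine Runs.bind (e := ()) (s' := st f₁ S) ?_ (Runs.bind (e := ()) (s' := st f₂ (-S)) ?_ ?_)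
  · have := Runs.scan (M := tapeModel (Cell Γ) 3 x) (P := Within B) (e := ()) (s' := st f₁ S)
      (f := fun o => if (o.2.2 0).isSome then (.inl (), moveHead 0 o .pos)
        else (.inr (), newCell b 0 .neg o)) (S + 1) (fun i => st f₀ i)
      (fun i hi => ⟨_, ?_, (hmove _ _ .pos).trans ?_⟩) ⟨_, ?_, (hnew _ _ .neg).trans ?_⟩
      (fun i hi => hP _ _ (by rw [abs_of_nonneg] <;> omega))
      (hP _ _ (by rw [abs_of_nonneg] <;> omega))
    · simpa using this
    · have : (f₀ i).isSome := by simp [hf₀, workCells]; omega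
      rw [hobs]
      exact if_pos this
    · simp
    · have : ¬ (f₀ ((S + 1 : ℕ) : ℤ)).isSome := by
        simp only [hf₀, workCells]
        rw [if_neg (by rw [abs_of_nonneg] <;> push_cast <;> omega)]
        simp
      rw [hobs]
      exact if_neg this
    · simp [hf₁]
  · have := Runs.scan (M := tapeModel (Cell Γ) 3 x) (P := Within B) (e := ()) (s' := st f₂ (-S))
      (f := fun o => if (o.2.2 0).isSome then (.inl (), moveHead 0 o .neg)
        else (.inr (), newCell b 0 .pos o)) (2 * S + 1) (fun i => st f₁ (S - i))
      (fun i hi => ⟨_, ?_, (hmove _ _ .neg).trans ?_⟩) ⟨_, ?_, (hnew _ _ .pos).trans ?_⟩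
      (fun i hi => hP _ _ (by rw [abs_le]; omega))
      (hP _ _ (by rw [abs_le]; omega))
    · simpa using this
    · have : (f₁ (S - i)).isSome := by
        rw [hf₁, Function.update_of_ne (by omega), hf₀,
          CoinProg.workCells_of (by rw [abs_le]; omega)]
        rfl
      rw [hobs]
      exact if_pos this
    · congr 1
      push_cast
      simp
      ring
    · have : ¬ (f₁ (S - ((2 * S + 1 : ℕ) : ℤ))).isSome := by
        rw [hf₁, Function.update_of_ne (by omega), hf₀,
          CoinProg.workCells_of_not (by rw [abs_le]; omega)]
        simp
      rw [hobs]
      exact if_neg this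
    · have : (S : ℤ) - ((2 * S + 1 : ℕ) : ℤ) = -(S + 1) := by push_cast; ring
      rw [this]
      simp [hf₂]
  · have := Runs.scan (M := tapeModel (Cell Γ) 3 x) (P := Within B) (e := ()) (s' := st f₂ 0)
      (f := fun o => if CoinProg.isOrigin (o.2.2 0) then (.inr (), moveHead 0 o .zero)
        else (.inl (), moveHead 0 o .pos)) S (fun i => st f₂ (-S + i))
      (fun i hi => ⟨_, ?_, (hmove _ _ .pos).trans ?_⟩) ⟨_, ?_, (hmove _ _ .zero).trans ?_⟩
      (fun i hi => hP _ _ (by rw [abs_le]; omega))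
      (hP _ _ (by simp; omega))
    · simpa using this
    · have : ¬ CoinProg.isOrigin (f₂ (-S + i)) = true := by
        rw [hf₂', CoinProg.workCells_of (by rw [abs_le]; push_cast; omega)]
        simp [CoinProg.isOrigin]
        omega
      rw [hobs]
      exact if_neg this
    · congr 1
      push_cast
      simp
      ring
    · have : CoinProg.isOrigin (f₂ (-S + (S : ℤ))) = true := by
        rw [hf₂', CoinProg.workCells_of (by simp; omega)]
        simp [CoinProg.isOrigin]
      rw [hobs]
      exact if_pos this
    · simp

/-- A leading zero does not change a number, so a window can grow under a counter. -/
lemma update_testBit {N W : ℕ} (h : N < 2 ^ W) : Function.update N.testBit W false = N.testBit := by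
  rw [Function.update_eq_self_iff, Nat.testBit_lt_two_pow h]

/-- The counter is filled with ones before its window grows, so the added cell is a leading zero.
The result is the initial value `2 ^ S' - 1` for the new size `S' = S + 1`. The coins are already
`0`, because a complete enumeration ends with an overflow. -/
lemma runs_growAll (x : List α) (b : Γ) (S K : ℕ) (hK : K < 2 ^ (S + 1)) {B : ℤ}
    (hB : 2 * S + 3 ≤ B) :
    (tapeModel (Cell Γ) 3 x).Runs (growAll b) (Within B)
      (idleStore b S (S + 1) (S + 1) (0 : ℕ).testBit K.testBit 0 0) ()
      (idleStore b (S + 1) (S + 2) (S + 2) (0 : ℕ).testBit (2 ^ (S + 1) - 1).testBit 0 0) := by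
  have hB0 : |(0 : ℤ)| ≤ B := by simp; omega
  have hap : ∀ p : ℤ, -1 ≤ p → p ≤ ((S + 1 : ℕ) : ℤ) + 1 → |p| ≤ B := fun p h1 h2 => by
    rw [abs_le]; push_cast at h2; omega
  refine (runs_growWork x b S _ _ _ _ (by omega)).bind ?_
  have h0 := update_testBit (N := 0) (W := S + 1) (by positivity)
  have hlt : 2 ^ (S + 1) - 1 < 2 ^ (S + 1) := Nat.sub_lt (by positivity) (by norm_num)
  have h1 := (bitTape_coins x b (S + 1) (S + 1) (S + 1) K.testBit 0).append (b := false)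
    (bitTape_coins x b (S + 1) (S + 2) (S + 1) K.testBit 0) (new := newCell b 1 .zero)
    (0 : ℕ).testBit (P := Within B) ?_
    (fun β p h1 h2 => within_idleStore (hap p h1 (by omega)) hB0)
    (fun β p h1 h2 => within_idleStore (hap p h1 (by omega)) hB0)
  · rw [h0] at h1
    refine Runs.bind h1 ?_
    refine Runs.bind ((bitTape_count x b (S + 1) (S + 2) (S + 1) (0 : ℕ).testBit 0).fill
      (P := Within B) hK (fun β p h1 h2 => within_idleStore hB0 (hap p h1 (by omega)))) ?_
    have h3 := (bitTape_count x b (S + 1) (S + 2) (S + 1) (0 : ℕ).testBit 0).append (b := false)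
      (bitTape_count x b (S + 1) (S + 2) (S + 2) (0 : ℕ).testBit 0) (new := newCell b 3 .zero)
      (2 ^ (S + 1) - 1).testBit (P := Within B) ?_
      (fun β p h1 h2 => within_idleStore hB0 (hap p h1 (by omega)))
      (fun β p h1 h2 => within_idleStore hB0 (hap p h1 (by omega)))
    · rwa [update_testBit hlt] at h3
    · rw [obs_idleStore]
      simp only [newCell]
      erw [update_four_three, update_four_three]
      refine (tapeModel_act_four ..).trans ?_
      simp only [idleStore, append_bitCells b (Nat.succ_pos S), moveInput_zero]
      simp
  · rw [obs_idleStore]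
    simp only [newCell]
    erw [update_four_one, update_four_one]
    refine (tapeModel_act_four ..).trans ?_
    simp only [idleStore, append_bitCells b (Nat.succ_pos S), moveInput_zero]
    simp

end Idle


/-! ### Majority over all coin sequences, with a growing window. -/

lemma add_one_mod_eq_zero {a n : ℕ} (h : a % n + 1 = n) : (a + 1) % n = 0 := by
  rw [← Nat.div_add_mod a n, add_assoc, h, ← Nat.mul_succ, Nat.mul_mod_right]

lemma add_one_mod_eq {a n : ℕ} (h : a % n + 1 < n) : (a + 1) % n = a % n + 1 := by
  conv_lhs => rw [← Nat.div_add_mod a n, add_assoc, Nat.mul_add_mod, Nat.mod_eq_of_lt h]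

namespace CoinProg

open StoreModel

variable {α : Type u} {Γ : Type} {m : CoinProg α Γ} {b : Γ} {x : List α} {ω ω' : ℕ → Bool}
  {S : ℕ}

lemma run_succ (t : ℕ) :
    m.run b x ω (t + 1) = (coinModel Γ x ω).step m (m.run b x ω t) :=
  Function.iterate_succ_apply' _ _ _

lemma run_coin_nonneg (t : ℕ) : 0 ≤ (m.run b x ω t).2.coin := by
  induction t with
  | zero => exact le_rfl
  | succ t ih =>
    rw [run_succ]
    rcases h : m.run b x ω t with ⟨q | e, σ⟩
    · rw [h] at ih
      rw [step_inl]
      simp only [coinModel]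
      generalize (m.next q _).2.2.2.2 = c
      dsimp only at ih
      cases c <;> simp [coinMove] <;> omega
    · rw [h] at ih
      exact ih

lemma accepts_iff : m.Accepts b x ω ↔ ∃ t, (m.run b x ω t).1 = .inr true := Iff.rfl

variable [Finite Γ]

/-- Does the computation leave the window? -/
def Overflows (m : CoinProg α Γ) (b : Γ) (x : List α) (S : ℕ) (ω : ℕ → Bool) : Prop :=
  ∃ t, m.Halted S ((m.tourSystem b x ω S).bstep^[t] (.inl m.start, .init b)) ∧
    ((m.tourSystem b x ω S).bstep^[t] (.inl m.start, .init b)).1.isLeft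

/-- Does the computation accept before it leaves the window? -/
def AcceptsWithin (m : CoinProg α Γ) (b : Γ) (x : List α) (S : ℕ) (ω : ℕ → Bool) : Prop :=
  ∃ t, ((m.tourSystem b x ω S).bstep^[t] (.inl m.start, .init b)).1 = .inr true

/-- The computation in the window passes only through configurations of the unrestricted run, and
these satisfy the bounds. -/
lemma not_overflows (h : ∀ t, |(m.run b x ω t).2.workPos| ≤ S ∧ (m.run b x ω t).2.coin ≤ S) :
    ¬ m.Overflows b x S ω := by
  have key : ∀ t, ∃ t', (m.tourSystem b x ω S).bstep^[t] (.inl m.start, .init b) =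
      m.run b x ω t' := by
    intro t
    induction t with
    | zero => exact ⟨0, rfl⟩
    | succ t ih =>
      obtain ⟨t', ht'⟩ := ih
      rw [Function.iterate_succ_apply', ht']
      by_cases hh : (m.tourSystem b x ω S).halted (m.run b x ω t')
      · exact ⟨t', by simp [TourSystem.bstep, hh]⟩
      · refine ⟨t' + 1, ?_⟩
        rw [TourSystem.bstep_of_not _ hh, run_succ]
        rfl
  rintro ⟨t, h1, h2⟩
  obtain ⟨t', ht'⟩ := key t
  rw [ht'] at h1 h2
  rcases h1 with h1 | h1
  · rw [Sum.isRight_iff] at h1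
    obtain ⟨e, he⟩ := h1
    rw [he] at h2
    simp at h2
  · exact h1 ⟨(h t').1, run_coin_nonneg t', (h t').2⟩

/-- Inside the window only the coins `0, …, S` are visible, so `ω` may be replaced by `ω'`; and a
configuration at which the restricted computation stops has an exit value, hence is fixed in the
unrestricted one too. Coin `S` is visible after `S` tosses even if it is not tossed, hence the `S +
1` coins. -/
lemma run_eq_of_not_overflows (h : ¬ m.Overflows b x S ω)
    (hω : ∀ i < S + 1, ω i = ω' i) (t : ℕ) :
    (m.tourSystem b x ω S).bstep^[t] (.inl m.start, .init b) = m.run b x ω' t := by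
  induction t with
  | zero => rfl
  | succ t ih =>
    rw [Function.iterate_succ_apply', run_succ, ← ih]
    set v := (m.tourSystem b x ω S).bstep^[t] (.inl m.start, .init b) with hv
    by_cases hh : (m.tourSystem b x ω S).halted v
    · have h1 : ¬ v.1.isLeft := fun h1 => h ⟨t, hh, h1⟩
      rw [TourSystem.bstep, if_pos hh]
      rcases hv1 : v with ⟨q | e, σ⟩
      · rw [hv1] at h1
        simp at h1
      · rfl
    · rw [TourSystem.bstep_of_not _ hh]
      obtain ⟨⟨q, hq⟩, -, h2, h3⟩ := not_halted_iff.1 hh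
      change (coinModel Γ x ω).step m v = _
      rcases hv1 : v with ⟨a, σ⟩
      rw [hv1] at hq h2 h3
      obtain rfl : a = .inl q := hq
      have : (coinModel Γ x ω).obs σ = (coinModel Γ x ω').obs σ := by
        simp only [coinModel]
        dsimp only at h2 h3
        rw [hω _ (by omega)]
      rw [step_inl, step_inl, this]
      rfl

lemma acceptsWithin_iff (h : ¬ m.Overflows b x S ω) (hω : ∀ i < S + 1, ω i = ω' i) :
    m.AcceptsWithin b x S ω ↔ m.Accepts b x ω' := by
  rw [accepts_iff]
  exact exists_congr fun t => by rw [run_eq_of_not_overflows h hω]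

variable (m b)

/-- Run the tours for all coin sequences; the exit value tells whether some computation leaves the
window, and whether more than half of the computations accept. -/
noncomputable def coinLoop : Prog (TourObs α Γ) (TourAct Γ) (Bool × Bool) :=
  .iter (X := Bool × Bool) (fun z =>
    .bind (m.tourProg b) fun r =>
    .bind (if r.1 then .inc (readBit 3) (writeBit 3) (moveHead 3) else skipWith false) fun c =>
    .bind (.inc (readBit 1) (writeBit 1) (moveHead 1)) fun d =>
    skipWith (if d then .inr (z.1 || r.2, z.2 || c) else .inl (z.1 || r.2, z.2 || c)))
    (false, false)

/-- Enlarge the windows until no computation leaves them; then tell whether more than half of the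
computations accept. -/
noncomputable def majority : Prog (TourObs α Γ) (TourAct Γ) Bool :=
  .bind (.op fun _ => ((), (fun _ => some (b, false, true)), 0, ![0, 0, 0, 0])) fun _ =>
  .iter (X := Unit) (fun _ =>
    .bind (m.coinLoop b) fun r =>
    if r.1 then .bind (growAll b) fun _ => skipWith (.inl ()) else skipWith (.inr r.2)) ()

variable {m b}

-- The counter with `S + 1` bits overflows when `2 ^ (S + 1) - (2 ^ S - 1) = 2 ^ S + 1` blocks have
-- accepted. So its starting value makes the overflow bit express a strict majority, and no
-- comparison of numbers is needed.
open Classical in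
lemma runs_coinLoop {B : ℤ} (hB : 2 * S + 3 ≤ B) :
    ∃ K < 2 ^ (S + 1), (tapeModel (Cell Γ) 3 x).Runs (m.coinLoop b) (Within B)
      (idleStore b S (S + 1) (S + 1) (0 : ℕ).testBit (2 ^ S - 1).testBit 0 0)
      (decide (∃ k < 2 ^ (S + 1), m.Overflows b x S k.testBit),
        decide (2 ^ S < ((Finset.range (2 ^ (S + 1))).filter fun k =>
          m.AcceptsWithin b x S k.testBit).card))
      (idleStore b S (S + 1) (S + 1) (0 : ℕ).testBit K.testBit 0 0) := by
  let c : ℕ → ℕ := fun N => ((Finset.range N).filter fun k =>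
    m.AcceptsWithin b x S k.testBit).card
  have hc0 : c 0 = 0 := rfl
  have hcs : ∀ N, c (N + 1) = c N + if m.AcceptsWithin b x S N.testBit then 1 else 0 := by
    intro N
    simp only [c]
    rw [Finset.range_add_one, Finset.filter_insert]
    split_ifs with h
    · rw [Finset.card_insert_of_notMem (by simp)]
    · rfl
  have hcle : ∀ N, c N ≤ N := fun N => (Finset.card_filter_le _ _).trans (by simp)
  have hpos : 0 < 2 ^ S := by positivity
  have hpow : 2 ^ (S + 1) = 2 * 2 ^ S := by ring
  -- `K N` is the counter after `N` blocks, with wrap-around; the overflow itself is remembered in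
  -- the second component of `w`.
  let K : ℕ → ℕ := fun N => (2 ^ S - 1 + c N) % 2 ^ (S + 1)
  let w : ℕ → Bool × Bool := fun N => (decide (∃ k < N, m.Overflows b x S k.testBit),
    decide (2 ^ (S + 1) ≤ 2 ^ S - 1 + c N))
  have hK : ∀ N, K N < 2 ^ (S + 1) := fun N => Nat.mod_lt _ (by positivity)
  have hB0 : |(0 : ℤ)| ≤ B := by simp; omega
  have hP : ∀ p : ℤ, -1 ≤ p → p ≤ (S + 1 : ℕ) → |p| ≤ B := fun p h1 h2 => by
    rw [abs_le]; push_cast at h2; omega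
  -- The overflow `d` of the coin tape ends the loop: it is true in the last round only, in which
  -- the coins return to `0`.
  have hround : ∀ N < 2 ^ (S + 1), ∀ d N', (if N + 1 < 2 ^ (S + 1) then d = false ∧ N' = N + 1
      else d = true ∧ N' = 0) → (tapeModel (Cell Γ) 3 x).Runs (
      .bind (m.tourProg b) fun r =>
      .bind (if r.1 then .inc (readBit 3) (writeBit 3) (moveHead 3) else skipWith false) fun c =>
      .bind (.inc (readBit 1) (writeBit 1) (moveHead 1)) fun d =>
      skipWith (if d then .inr ((w N).1 || r.2, (w N).2 || c)
        else .inl ((w N).1 || r.2, (w N).2 || c) : (Bool × Bool) ⊕ (Bool × Bool))) (Within B)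
      (idleStore b S (S + 1) (S + 1) N.testBit (K N).testBit 0 0)
      (if d then .inr (w (N + 1)) else .inl (w (N + 1)))
      (idleStore b S (S + 1) (S + 1) N'.testBit (K (N + 1)).testBit 0 0) := by
    intro N hN d N' hd
    have h1 := runs_tourProg (m := m) (b := b) (x := x) (β := N.testBit) (κ := (K N).testBit) hB
    rw [bigStore_init] at h1
    obtain ⟨cc, hcc, h2⟩ : ∃ cc, (cc = decide (m.AcceptsWithin b x S N.testBit ∧
        K N + 1 = 2 ^ (S + 1))) ∧ (tapeModel (Cell Γ) 3 x).Runs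
        (if decide (m.AcceptsWithin b x S N.testBit) then .inc (readBit 3) (writeBit 3) (moveHead 3)
          else skipWith false) (Within B)
        (idleStore b S (S + 1) (S + 1) N.testBit (K N).testBit 0 0) cc
        (idleStore b S (S + 1) (S + 1) N.testBit (K (N + 1)).testBit 0 0) := by
      refine ⟨_, rfl, ?_⟩
      by_cases ha : m.AcceptsWithin b x S N.testBit
      · rw [if_pos (by simpa using ha)]
        by_cases ho : K N + 1 = 2 ^ (S + 1)
        · have hK1 : K (N + 1) = 0 := by
            simp only [K, hcs, if_pos ha] at ho ⊢
            rw [← add_assoc, add_one_mod_eq_zero ho]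
          rw [hK1, decide_eq_true ⟨ha, ho⟩]
          exact (bitTape_count x b S (S + 1) (S + 1) N.testBit 0).inc_overflow ho
            (fun β p h1 h2 => within_idleStore hB0 (hP p h1 h2))
        · have hlt : K N + 1 < 2 ^ (S + 1) := by have := hK N; omega
          have hK1 : K (N + 1) = K N + 1 := by
            simp only [K, hcs, if_pos ha] at hlt ⊢
            rw [← add_assoc, add_one_mod_eq hlt]
          rw [hK1, decide_eq_false (fun h => ho h.2)]
          exact (bitTape_count x b S (S + 1) (S + 1) N.testBit 0).inc hlt
            (fun β p h1 h2 => within_idleStore hB0 (hP p h1 h2))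
      · have hK1 : K (N + 1) = K N := by simp only [K, hcs, if_neg ha, add_zero]
        rw [if_neg (by simpa using ha), hK1, decide_eq_false (fun h => ha h.1)]
        have := runs_skipWith (b := b) (x := x) (S := S) (β := N.testBit) (κ := (K N).testBit)
          (σ := .init b) (p := 0) (P := Within B) false
          (by rw [bigStore_init]; exact within_idleStore hB0 hB0)
        rwa [bigStore_init] at this
    have h3 : (tapeModel (Cell Γ) 3 x).Runs (.inc (readBit 1) (writeBit 1) (moveHead 1)) (Within B)
        (idleStore b S (S + 1) (S + 1) N.testBit (K (N + 1)).testBit 0 0) d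
        (idleStore b S (S + 1) (S + 1) N'.testBit (K (N + 1)).testBit 0 0) := by
      split_ifs at hd with hlt
      · rw [hd.1, hd.2]
        exact (bitTape_coins x b S (S + 1) (S + 1) (K (N + 1)).testBit 0).inc hlt
            (fun β p h1 h2 => within_idleStore (hP p h1 h2) hB0)
      · rw [hd.1, hd.2]
        exact (bitTape_coins x b S (S + 1) (S + 1) (K (N + 1)).testBit 0).inc_overflow (by omega)
            (fun β p h1 h2 => within_idleStore (hP p h1 h2) hB0)
    have hw1 : (w (N + 1)).1 = ((w N).1 || decide (m.Overflows b x S N.testBit)) := by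
      rw [Bool.eq_iff_iff]
      simp only [w, decide_eq_true_eq, Bool.or_eq_true]
      constructor
      · rintro ⟨k, hk, h⟩
        rcases Nat.lt_succ_iff_lt_or_eq.1 hk with hk | rfl
        · exact .inl ⟨k, hk, h⟩
        · exact .inr h
      · rintro (⟨k, hk, h⟩ | h)
        · exact ⟨k, by omega, h⟩
        · exact ⟨N, by omega, h⟩
    have hw2 : (w (N + 1)).2 = ((w N).2 || cc) := by
      rw [Bool.eq_iff_iff, hcc]
      simp only [w, decide_eq_true_eq, Bool.or_eq_true, hcs, K]
      have := hcle N
      by_cases ha : m.AcceptsWithin b x S N.testBit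
      · simp only [ha, if_true, true_and]
        -- Once an overflow has occurred the flag stays; before it the reduction modulo `2 ^ (S +
        -- 1)` does nothing.
        by_cases hge : 2 ^ (S + 1) ≤ 2 ^ S - 1 + c N
        · simp only [hge, true_or, iff_true]
          omega
        · rw [Nat.mod_eq_of_lt (by omega)]
          omega
      · simp [ha]
    refine h1.bind (h2.bind (h3.bind ?_))
    have := runs_skipWith (b := b) (x := x) (S := S) (β := N'.testBit) (κ := (K (N + 1)).testBit)
      (σ := .init b) (p := 0) (P := Within B)
      (if d then .inr ((w N).1 || decide (m.Overflows b x S N.testBit), (w N).2 || cc)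
        else .inl ((w N).1 || decide (m.Overflows b x S N.testBit), (w N).2 || cc) :
        (Bool × Bool) ⊕ (Bool × Bool))
      (by rw [bigStore_init]; exact within_idleStore hB0 hB0)
    rw [bigStore_init] at this
    have hw : w (N + 1) = ((w N).1 || decide (m.Overflows b x S N.testBit), (w N).2 || cc) :=
      Prod.ext hw1 hw2
    rw [hw]
    exact this
  refine ⟨K (2 ^ (S + 1)), hK _, ?_⟩
  have hsub : 2 ^ (S + 1) - 1 + 1 = 2 ^ (S + 1) := by omega
  have hfin : w (2 ^ (S + 1)) = (decide (∃ k < 2 ^ (S + 1), m.Overflows b x S k.testBit),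
        decide (2 ^ S < ((Finset.range (2 ^ (S + 1))).filter fun k =>
          m.AcceptsWithin b x S k.testBit).card)) := by
    refine Prod.ext rfl (decide_eq_decide.2 ?_)
    change 2 ^ (S + 1) ≤ 2 ^ S - 1 + c (2 ^ (S + 1)) ↔ 2 ^ S < c (2 ^ (S + 1))
    omega
  have := Runs.iter_of_seq (M := tapeModel (Cell Γ) 3 x) (P := Within B) (2 ^ (S + 1) - 1) w
    (fun N => idleStore b S (S + 1) (S + 1) N.testBit (K N).testBit 0 0)
    (m := fun z => .bind (m.tourProg b) fun r =>
      .bind (if r.1 then .inc (readBit 3) (writeBit 3) (moveHead 3) else skipWith false) fun c =>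
      .bind (.inc (readBit 1) (writeBit 1) (moveHead 1)) fun d =>
      skipWith (if d then .inr (z.1 || r.2, z.2 || c) else .inl (z.1 || r.2, z.2 || c)))
    (e := w (2 ^ (S + 1)))
    (s' := idleStore b S (S + 1) (S + 1) (0 : ℕ).testBit (K (2 ^ (S + 1))).testBit 0 0)
    (fun N hN => hround N (by omega) false (N + 1) (by rw [if_pos (by omega)]; exact ⟨rfl, rfl⟩))
    (by
      have h := hround (2 ^ (S + 1) - 1) (by omega) true 0
        (by rw [if_neg (by omega)]; exact ⟨rfl, rfl⟩)
      rwa [hsub] at h)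
  rw [hfin] at this
  have hw0 : w 0 = (false, false) := by
    have h0 : ¬ ∃ k < 0, m.Overflows b x S k.testBit := fun ⟨k, hk, _⟩ => absurd hk k.not_lt_zero
    refine Prod.ext (decide_eq_false h0) (decide_eq_false ?_)
    omega
  have hK0 : K 0 = 2 ^ S - 1 := by
    simp only [K, hc0, add_zero]
    exact Nat.mod_eq_of_lt (by omega)
  rw [hw0] at this
  simp only [hK0] at this
  exact this

-- The window sizes are tried in increasing order, and the search stops at the least `S` that no
-- block leaves. Since `S₁` is such a size, the search never exceeds it, although the program does
-- not know `S₁`.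
open Classical in
lemma runs_majority {S₁ : ℕ} (hS : ∀ k < 2 ^ (S₁ + 1), ¬ m.Overflows b x S₁ k.testBit) :
    ∃ S ≤ S₁, (∀ k < 2 ^ (S + 1), ¬ m.Overflows b x S k.testBit) ∧
      ∃ σ, (tapeModel (Cell Γ) 3 x).Runs (m.majority b) (Within (2 * S₁ + 3))
        ⟨0, fun _ _ => none, fun _ => 0⟩
        (decide (2 ^ S < ((Finset.range (2 ^ (S + 1))).filter fun k =>
          m.AcceptsWithin b x S k.testBit).card)) σ := by
  let p : ℕ → Prop := fun S => ∀ k < 2 ^ (S + 1), ¬ m.Overflows b x S k.testBit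
  have hex : ∃ S, p S := ⟨S₁, hS⟩
  have hS₀ : Nat.find hex ≤ S₁ := Nat.find_min' hex hS
  set S₀ := Nat.find hex with hS₀def
  refine ⟨S₀, hS₀, Nat.find_spec hex, ?_⟩
  have hB0 : |(0 : ℤ)| ≤ 2 * S₁ + 3 := by simp; omega
  have hloop : ∀ S ≤ S₀, ∃ K < 2 ^ (S + 1), (tapeModel (Cell Γ) 3 x).Runs (m.coinLoop b)
      (Within (2 * S₁ + 3))
      (idleStore b S (S + 1) (S + 1) (0 : ℕ).testBit (2 ^ S - 1).testBit 0 0)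
      (decide (∃ k < 2 ^ (S + 1), m.Overflows b x S k.testBit),
        decide (2 ^ S < ((Finset.range (2 ^ (S + 1))).filter fun k =>
          m.AcceptsWithin b x S k.testBit).card))
      (idleStore b S (S + 1) (S + 1) (0 : ℕ).testBit K.testBit 0 0) := fun S hS' =>
    runs_coinLoop (by omega)
  obtain ⟨K₀, hK₀, hlast⟩ := hloop S₀ le_rfl
  have hfind : ¬ ∃ k < 2 ^ (S₀ + 1), m.Overflows b x S₀ k.testBit := fun ⟨k, hk, h⟩ =>
    Nat.find_spec hex k hk h
  have hskip : ∀ {E : Type} (e : E) (S : ℕ) (β κ : ℕ → Bool), (tapeModel (Cell Γ) 3 x).Runs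
      (skipWith e) (Within (2 * S₁ + 3)) (idleStore b S (S + 1) (S + 1) β κ 0 0) e
      (idleStore b S (S + 1) (S + 1) β κ 0 0) := by
    intro E e S β κ
    have := runs_skipWith (b := b) (x := x) (S := S) (β := β) (κ := κ)
      (σ := .init b) (p := 0) (P := Within (2 * S₁ + 3)) e
      (by rw [bigStore_init]; exact within_idleStore hB0 hB0)
    rwa [bigStore_init] at this
  refine ⟨idleStore b S₀ (S₀ + 1) (S₀ + 1) (0 : ℕ).testBit K₀.testBit 0 0,
    Runs.bind (e := ()) (s' := idleStore b 0 1 1 (0 : ℕ).testBit (2 ^ 0 - 1).testBit 0 0) ?_ ?_⟩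
  -- One marked cell on every tape is the idle store for `S = 0`, with coins `0` and counter `2 ^ 0
  -- - 1 = 0`.
  · refine Runs.op' rfl ?_ (fun i => by simp; omega) (within_idleStore hB0 hB0)
    refine TapeStore.ext rfl ?_ ?_
    · funext i p
      have hc : ∀ c : Cell Γ, Function.update (fun _ : ℤ => (none : Cell Γ)) 0 c p =
          if p = 0 then c else none := fun c => by simp [Function.update_apply]
      fin_cases i
      · refine (hc _).trans ?_
        change _ = workCells 0 (fun _ => b) p
        by_cases hp : p = 0 <;> simp [workCells, hp]
      · refine (hc _).trans ?_
        change _ = bitCells b 1 _ p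
        have : (0 ≤ p ∧ p < 1) ↔ p = 0 := by omega
        by_cases hp : p = 0
        · simp [bitCells, hp]
        · simp [bitCells, this, hp]
      · refine (hc _).trans ?_
        rfl
      · refine (hc _).trans ?_
        change _ = bitCells b 1 _ p
        have : (0 ≤ p ∧ p < 1) ↔ p = 0 := by omega
        by_cases hp : p = 0
        · simp [bitCells, hp]
        · simp [bitCells, this, hp]
    · funext i
      fin_cases i <;> rfl
  · refine Runs.iter_of_seq S₀ (fun _ => ())
      (fun S => idleStore b S (S + 1) (S + 1) (0 : ℕ).testBit (2 ^ S - 1).testBit 0 0)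
      (fun S hS' => ?_) ?_
    · obtain ⟨K, hK, hr⟩ := hloop S hS'.le
      have hov : ∃ k < 2 ^ (S + 1), m.Overflows b x S k.testBit := by
        have := Nat.find_min hex hS'
        simp only [p] at this
        push Not at this
        exact this
      rw [decide_eq_true hov] at hr
      refine hr.bind ?_
      simp only [if_true]
      exact (runs_growAll x b S K hK (by omega)).bind (hskip _ _ _ _)
    · rw [decide_eq_false hfind] at hlast
      refine hlast.bind ?_
      simp only [Bool.false_eq_true, if_false]
      exact hskip _ _ _ _

/-- Derandomization: a probabilistic program that uses `O(s(n))` space and `O(s(n))` coins can be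
simulated deterministically in space `O(s(n))`. -/
theorem mem_SPACE (L : Language α) (s : ℕ → ℕ) (C : ℕ)
    (hspace : ∀ x ω t, |(m.run b x ω t).2.workPos| ≤ ((C * (s x.length + 1) : ℕ) : ℤ) ∧
      (m.run b x ω t).2.coin ≤ ((C * (s x.length + 1) : ℕ) : ℤ))
    (hL : ∀ x, x ∈ L ↔ 1 / 2 < coinMeasure {ω | m.Accepts b x ω}) : L ∈ SPACE α s := by
  classical
  refine mem_SPACE_of_prog none (m.majority b) L s (2 * C + 3) fun x => ?_
  obtain ⟨S, hS, hno, σ, hr⟩ := runs_majority (m := m) (b := b) (x := x)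
    (S₁ := C * (s x.length + 1)) fun k _ => not_overflows (hspace x _)
  refine ⟨_, σ, ?_, hr.mono fun σ hσ i => (hσ i).trans ?_⟩
  -- The size `S` that was found may be below the assumed bound. As no block leaves this window,
  -- acceptance nevertheless depends on `S + 1` coins only: compare both sequences with their common
  -- initial block `a`.
  · have hkey : ∀ ω ω', (∀ i < S + 1, ω i = ω' i) → m.Accepts b x ω → m.Accepts b x ω' := by
      intro ω ω' hω h
      obtain ⟨a, ha, hab⟩ := exists_testBit_eq (S + 1) ω
      rw [← acceptsWithin_iff (hno a ha) fun i hi => (hab i hi).symm] at h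
      rwa [← acceptsWithin_iff (hno a ha) fun i hi => (hab i hi).symm.trans (hω i hi)]
    rw [decide_eq_true_eq, hL, half_lt_coinMeasure_iff S _ hkey]
    have : ((Finset.range (2 ^ (S + 1))).filter fun k => m.AcceptsWithin b x S k.testBit) =
        ((Finset.range (2 ^ (S + 1))).filter fun k => m.Accepts b x k.testBit) :=
      Finset.filter_congr fun k hk =>
        acceptsWithin_iff (hno k (Finset.mem_range.1 hk)) fun _ _ => rfl
    rw [this]
  · push_cast
    nlinarith

end CoinProg


/-! ## Counters made of heads -/

namespace StoreModel

variable {O : Type u} {A E F X S Z : Type} {M : StoreModel O A S}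

/-- A program transforms abstract states, which are related to stores by `R`. -/
def Transforms (M : StoreModel O A S) (R : S → Z → Prop) (P : S → Prop) (m : Prog O A E) (z : Z)
    (e : E) (z' : Z) : Prop :=
  ∀ s, R s z → ∃ s', M.Runs m P s e s' ∧ R s' z'

variable {R : S → Z → Prop} {P : S → Prop}

lemma Transforms.bind [Finite E] {m : Prog O A E} {f : E → Prog O A F} {z z' z'' e e'}
    (h : M.Transforms R P m z e z') (h' : M.Transforms R P (f e) z' e' z'') :
    M.Transforms R P (m.bind f) z e' z'' := by
  intro s hs
  obtain ⟨s', h1, h2⟩ := h s hs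
  obtain ⟨s'', h3, h4⟩ := h' s' h2
  exact ⟨s'', h1.bind h3, h4⟩

lemma Transforms.iter_of_seq [Finite X] {m : X → Prog O A (X ⊕ E)} (T : ℕ)
    (x : ℕ → X) (z : ℕ → Z) {e z'}
    (h : ∀ i < T, M.Transforms R P (m (x i)) (z i) (.inl (x (i + 1))) (z (i + 1)))
    (h' : M.Transforms R P (m (x T)) (z T) (.inr e) z') :
    M.Transforms R P (.iter m (x 0)) (z 0) e z' := by
  induction T generalizing x z with
  | zero =>
    intro s hs
    obtain ⟨s', h1, h2⟩ := h' s hs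
    exact ⟨s', .iter_exit h1, h2⟩
  | succ T ih =>
    intro s hs
    obtain ⟨s', h1, h2⟩ := h 0 (by omega) s hs
    obtain ⟨s'', h3, h4⟩ := ih (fun i => x (i + 1)) (fun i => z (i + 1))
      (fun i hi => h (i + 1) (by omega)) h' s' h2
    exact ⟨s'', .iter_next h1 h3, h4⟩

end StoreModel

section Heads

open StoreModel

variable {α : Type u} {H : Type} [DecidableEq H]

/-- Move one head. -/
def moveOne (h : H) (d : SignType) : H → SignType := fun h' => if h' = h then d else .zero

lemma headModel_moveOne (x : List α) (h : H) (d : SignType) (s : H → ℕ) :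
    (headModel H x).act (moveOne h d) s = Function.update s h (moveInput x.length d (s h)) := by
  funext h'
  by_cases hh : h' = h
  · subst hh; simp [headModel, moveOne]
  · simp only [headModel, moveOne, hh, if_false, Function.update_of_ne hh]
    rfl

omit [DecidableEq H] in
lemma headModel_stay (x : List α) (s : H → ℕ) :
    (headModel H x).act (fun _ => .zero) s = s := rfl

/-- Is the head on the right end-marker? -/
def atRight (o : H → Bool × Option α) (h : H) : Bool := (o h).2.isNone && !(o h).1

omit [DecidableEq H] in
lemma atRight_obs {x : List α} {s : H → ℕ} {h : H} (hs : s h ≤ x.length + 1) :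
    atRight ((headModel H x).obs s) h = decide (s h = x.length + 1) := by
  simp only [atRight, headModel, inputSymbol_isNone]
  rw [Bool.eq_iff_iff]
  simp
  omega

/-- Do nothing, and return a value. -/
def headSkip {E : Type} (e : E) : Prog (H → Bool × Option α) (H → SignType) E :=
  .op fun _ => (e, fun _ => .zero)

omit [DecidableEq H] in
lemma runs_headSkip {E : Type} (x : List α) (e : E) (s : H → ℕ) :
    (headModel H x).Runs (headSkip e) (fun _ => True) s e s :=
  Runs.op' rfl rfl trivial trivial

def toLeft (h : H) : Prog (H → Bool × Option α) (H → SignType) Unit :=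
  .scan fun o => if (o h).1 then (.inr (), fun _ => .zero) else (.inl (), moveOne h .neg)

def toRight (h : H) : Prog (H → Bool × Option α) (H → SignType) Unit :=
  .scan fun o => if atRight o h then (.inr (), fun _ => .zero) else (.inl (), moveOne h .pos)

lemma runs_toLeft (x : List α) (h : H) (s : H → ℕ) :
    (headModel H x).Runs (toLeft h) (fun _ => True) s () (Function.update s h 0) := by
  have := Runs.scan (M := headModel H x) (P := fun _ => True) (e := ())
    (s' := Function.update s h 0)
    (f := fun o => if (o h).1 then (.inr (), fun _ => .zero) else (.inl (), moveOne h .neg))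
    (s h) (fun i => Function.update s h (s h - i))
    (fun i hi => ⟨_, if_neg ?_, (headModel_moveOne _ _ _ _).trans ?_⟩)
    ⟨_, if_pos ?_, (headModel_stay _ _).trans ?_⟩ (fun _ _ => trivial) trivial
  · simpa [toLeft] using this
  · simp [headModel]; omega
  · simp only [Function.update_idem, Function.update_self]
    congr 1
  · simp [headModel]
  · simp

lemma runs_toRight (x : List α) (h : H) (s : H → ℕ) (hs : s h ≤ x.length + 1) :
    (headModel H x).Runs (toRight h) (fun _ => True) s ()
      (Function.update s h (x.length + 1)) := by
  have := Runs.scan (M := headModel H x) (P := fun _ => True) (e := ())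
    (s' := Function.update s h (x.length + 1))
    (f := fun o => if atRight o h then (.inr (), fun _ => .zero) else (.inl (), moveOne h .pos))
    (x.length + 1 - s h) (fun i => Function.update s h (s h + i))
    (fun i hi => ⟨_, if_neg ?_, (headModel_moveOne _ _ _ _).trans ?_⟩)
    ⟨_, if_pos ?_, (headModel_stay _ _).trans ?_⟩ (fun _ _ => trivial) trivial
  · simpa [toRight] using this
  · rw [atRight_obs (by simp; omega)]
    simp
    omega
  · simp only [Function.update_idem, Function.update_self]
    congr 1
    change min _ _ = _
    omega
  · rw [atRight_obs (by simp; omega)]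
    simp
    omega
  · congr 1
    omega

/-- Increment of a number whose digits are head positions. -/
def incHeads : List H → Prog (H → Bool × Option α) (H → SignType) Unit
  | [] => headSkip ()
  | h :: hs => .bind (.op fun o =>
      if atRight o h then (true, fun _ => .zero) else (false, moveOne h .pos)) fun r =>
      if r then .bind (toLeft h) fun _ => incHeads hs else headSkip ()

/-- Decrement of a positive number whose digits are head positions. -/
def decHeads : List H → Prog (H → Bool × Option α) (H → SignType) Unit
  | [] => headSkip ()
  | h :: hs => .bind (.op fun o =>
      if (o h).1 then (true, fun _ => .zero) else (false, moveOne h .neg)) fun r =>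
      if r then .bind (toRight h) fun _ => decHeads hs else headSkip ()

lemma map_update_of_notMem {h : H} {hs : List H} (hh : h ∉ hs) (s : H → ℕ) (v : ℕ) :
    hs.map (Function.update s h v) = hs.map s :=
  List.map_congr_left fun h' hh' => Function.update_of_ne (by rintro rfl; exact hh hh') _ _

/-- A position in `0, …, n + 1` is a digit in base `n + 2`. A head on the right end-marker is the
largest digit: it returns to `0` and passes the carry on. By `hlt` the carry does not get past the
last head. -/
lemma runs_incHeads (x : List α) (hs : List H) (hnd : hs.Nodup) (s : H → ℕ)
    (hle : ∀ h, s h ≤ x.length + 1)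
    (hlt : Nat.ofDigits (x.length + 2) (hs.map s) + 1 < (x.length + 2) ^ hs.length) :
    ∃ s', (headModel H x).Runs (incHeads hs) (fun _ => True) s () s' ∧ (∀ h ∉ hs, s' h = s h) ∧
      (∀ h, s' h ≤ x.length + 1) ∧
      Nat.ofDigits (x.length + 2) (hs.map s') = Nat.ofDigits (x.length + 2) (hs.map s) + 1 := by
  induction hs generalizing s with
  | nil => simp at hlt
  | cons h hs ih =>
    rw [List.nodup_cons] at hnd
    simp only [List.map_cons, Nat.ofDigits_cons, List.length_cons, pow_succ] at hlt ⊢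
    by_cases hr : s h = x.length + 1
    · obtain ⟨s', h1, h2, h3, h4⟩ := ih hnd.2 (Function.update s h 0) (fun h' => by
        by_cases hh : h' = h
        · subst hh; simp
        · rw [Function.update_of_ne hh]; exact hle h') (by
          rw [map_update_of_notMem hnd.1]
          nlinarith)
      rw [map_update_of_notMem hnd.1] at h4
      refine ⟨s', ?_, fun h' hh => ?_, h3, ?_⟩
      · refine Runs.bind (e := true) (s' := s) (Runs.op' (if_pos ?_) rfl trivial trivial) ?_
        · rw [atRight_obs (hle h)]
          simpa using hr
        · exact (runs_toLeft x h s).bind h1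
      · rw [List.mem_cons, not_or] at hh
        rw [h2 h' hh.2, Function.update_of_ne hh.1]
      · rw [h4, h2 h hnd.1, Function.update_self, hr]
        ring
    · have hle' := hle h
      refine ⟨Function.update s h (s h + 1), ?_, fun h' hh => ?_, fun h' => ?_, ?_⟩
      · refine Runs.bind (e := false) (s' := Function.update s h (s h + 1))
          (Runs.op' (if_neg ?_) ?_ trivial trivial) (runs_headSkip _ _ _)
        · rw [atRight_obs (hle h)]
          simpa using hr
        · rw [headModel_moveOne]
          congr 1
          change min _ _ = _
          omega
      · rw [List.mem_cons, not_or] at hh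
        rw [Function.update_of_ne hh.1]
      · by_cases hh : h' = h
        · subst hh; simp; omega
        · rw [Function.update_of_ne hh]; exact hle h'
      · rw [map_update_of_notMem hnd.1, Function.update_self]
        ring

/-- A digit `0` becomes `n + 1` and borrows from the next head; because the number is positive, some
digit stops the borrow. -/
lemma runs_decHeads (x : List α) (hs : List H) (hnd : hs.Nodup) (s : H → ℕ)
    (hle : ∀ h, s h ≤ x.length + 1) (v : ℕ)
    (hv : Nat.ofDigits (x.length + 2) (hs.map s) = v + 1) :
    ∃ s', (headModel H x).Runs (decHeads hs) (fun _ => True) s () s' ∧ (∀ h ∉ hs, s' h = s h) ∧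
      (∀ h, s' h ≤ x.length + 1) ∧ Nat.ofDigits (x.length + 2) (hs.map s') = v := by
  induction hs generalizing s v with
  | nil => simp at hv
  | cons h hs ih =>
    rw [List.nodup_cons] at hnd
    simp only [List.map_cons, Nat.ofDigits_cons] at hv ⊢
    by_cases hr : s h = 0
    · have hpos : Nat.ofDigits (x.length + 2) (hs.map s) ≠ 0 := by
        intro h0
        rw [hr, h0] at hv
        simp at hv
      obtain ⟨v', hv'⟩ := Nat.exists_eq_succ_of_ne_zero hpos
      obtain ⟨s', h1, h2, h3, h4⟩ := ih hnd.2 (Function.update s h (x.length + 1)) (fun h' => by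
        by_cases hh : h' = h
        · subst hh; simp
        · rw [Function.update_of_ne hh]; exact hle h') v' (by
          rw [map_update_of_notMem hnd.1, hv'])
      refine ⟨s', ?_, fun h' hh => ?_, h3, ?_⟩
      · refine Runs.bind (e := true) (s' := s) (Runs.op' (if_pos ?_) rfl trivial trivial) ?_
        · simpa [headModel] using hr
        · exact (runs_toRight x h s (hle h)).bind h1
      · rw [List.mem_cons, not_or] at hh
        rw [h2 h' hh.2, Function.update_of_ne hh.1]
      · rw [h4, h2 h hnd.1, Function.update_self]
        rw [hr, hv'] at hv
        rw [Nat.succ_eq_add_one] at hv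
        linarith
    · have hle' := hle h
      refine ⟨Function.update s h (s h - 1), ?_, fun h' hh => ?_, fun h' => ?_, ?_⟩
      · refine Runs.bind (e := false) (s' := Function.update s h (s h - 1))
          (Runs.op' (if_neg ?_) ?_ trivial trivial) (runs_headSkip _ _ _)
        · simpa [headModel] using hr
        · rw [headModel_moveOne]
          rfl
      · rw [List.mem_cons, not_or] at hh
        rw [Function.update_of_ne hh.1]
      · by_cases hh : h' = h
        · subst hh; simp; omega
        · rw [Function.update_of_ne hh]; exact hle h'
      · rw [map_update_of_notMem hnd.1, Function.update_self]
        omega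

end Heads

/-! ### Arithmetic with counters -/

section Counters

open StoreModel

variable {α : Type u} {I : Type} [DecidableEq I] {K : ℕ}

/-- The heads of an automaton that has a main head and, for each `i : I`, a counter made of `K`
heads. -/
abbrev Heads (I : Type) (K : ℕ) : Type := Unit ⊕ (I × Fin K)

abbrev HeadProg (α : Type u) (I : Type) (K : ℕ) (E : Type) : Type (max u 1) :=
  Prog (Heads I K → Bool × Option α) (Heads I K → SignType) E

/-- The heads of a counter. -/
def counterHeads (K : ℕ) (i : I) : List (Heads I K) := (List.finRange K).map fun j => .inr (i, j)

/-- The main head is at position `p`, and the counters have the values `c`. -/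
def HasCounters (x : List α) (s : Heads I K → ℕ) (z : ℕ × (I → ℕ)) : Prop :=
  s (.inl ()) = z.1 ∧ (∀ h, s h ≤ x.length + 1) ∧
    ∀ i, Nat.ofDigits (x.length + 2) ((counterHeads K i).map s) = z.2 i

abbrev Computes (x : List α) {E : Type} (m : HeadProg α I K E) (z : ℕ × (I → ℕ)) (e : E)
    (z' : ℕ × (I → ℕ)) : Prop :=
  (headModel (Heads I K) x).Transforms (HasCounters x) (fun _ => True) m z e z'

omit [DecidableEq I] in
lemma mem_counterHeads {i : I} {h : Heads I K} :
    h ∈ counterHeads K i ↔ ∃ j, h = .inr (i, j) := by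
  simp [counterHeads, eq_comm]

omit [DecidableEq I] in
lemma counterHeads_nodup (i : I) : (counterHeads K i).Nodup :=
  (List.nodup_finRange K).map fun j j' h => by simpa using h

omit [DecidableEq I] in
lemma counterHeads_length (i : I) : (counterHeads K i).length = K := by simp [counterHeads]

variable {x : List α} {p : ℕ} {c : I → ℕ}

lemma hasCounters_update {s s' : Heads I K → ℕ} {i : I} {v : ℕ} (h : HasCounters x s (p, c))
    (h1 : ∀ h ∉ counterHeads K i, s' h = s h) (h2 : ∀ h, s' h ≤ x.length + 1)
    (h3 : Nat.ofDigits (x.length + 2) ((counterHeads K i).map s') = v) :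
    HasCounters x s' (p, Function.update c i v) := by
  refine ⟨(h1 _ (by simp [mem_counterHeads])).trans h.1, h2, fun i' => ?_⟩
  by_cases hi : i' = i
  · subst hi; simpa using h3
  · refine Eq.trans ?_ ((h.2.2 i').trans (Function.update_of_ne hi v c).symm)
    congr 1
    refine List.map_congr_left fun h' hh' => h1 _ fun hh'' => ?_
    obtain ⟨j, rfl⟩ := mem_counterHeads.1 hh'
    obtain ⟨j', hj'⟩ := mem_counterHeads.1 hh''
    simp only [Sum.inr.injEq, Prod.mk.injEq] at hj'
    exact hi hj'.1

lemma computes_inc (i : I) (hlt : c i + 1 < (x.length + 2) ^ K) :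
    Computes (K := K) x (incHeads (counterHeads K i)) (p, c) ()
      (p, Function.update c i (c i + 1)) := by
  intro s hs
  obtain ⟨s', h1, h2, h3, h4⟩ := runs_incHeads x (counterHeads K i) (counterHeads_nodup i) s hs.2.1
    (by rw [counterHeads_length, show _ = c i from hs.2.2 i]; exact hlt)
  exact ⟨s', h1, hasCounters_update hs h2 h3 (h4.trans (congrArg (· + 1) (hs.2.2 i)))⟩

lemma computes_dec (i : I) (v : ℕ) (hv : c i = v + 1) :
    Computes (K := K) x (decHeads (counterHeads K i)) (p, c) ()
      (p, Function.update c i v) := by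
  intro s hs
  obtain ⟨s', h1, h2, h3, h4⟩ := runs_decHeads x (counterHeads K i) (counterHeads_nodup i) s hs.2.1
    v ((hs.2.2 i).trans hv)
  exact ⟨s', h1, hasCounters_update hs h2 h3 h4⟩

omit [DecidableEq I] in
lemma computes_skip {E : Type} (e : E) (z : ℕ × (I → ℕ)) :
    Computes (K := K) x (headSkip e) z e z :=
  fun s hs => ⟨s, runs_headSkip x e s, hs⟩

/-- Zero test. -/
def headsZero (i : I) : HeadProg α I K Bool :=
  .op fun o => ((counterHeads K i).all fun h => (o h).1, fun _ => .zero)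

lemma ofDigits_eq_zero_iff {b : ℕ} (hb : 0 < b) (l : List ℕ) :
    Nat.ofDigits b l = 0 ↔ ∀ d ∈ l, d = 0 := by
  induction l with
  | nil => simp
  | cons d l ih =>
    simp [Nat.ofDigits_cons, ih, hb.ne']

omit [DecidableEq I] in
lemma computes_zero (i : I) (z : ℕ × (I → ℕ)) :
    Computes (K := K) x (headsZero i) z (decide (z.2 i = 0)) z := by
  intro s hs
  refine ⟨s, Runs.op' (Prod.ext ?_ rfl) rfl trivial trivial, hs⟩
  rw [← hs.2.2 i, Bool.eq_iff_iff, List.all_eq_true, decide_eq_true_iff,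
    ofDigits_eq_zero_iff (by omega)]
  simp only [List.forall_mem_map]
  simp [headModel]

/-- Repeated increment. -/
def incTimes (i : I) : ℕ → HeadProg α I K Unit
  | 0 => headSkip ()
  | n + 1 => .bind (incHeads (counterHeads K i)) fun _ => incTimes i n

lemma computes_incTimes (i : I) (n : ℕ) (hlt : c i + n < (x.length + 2) ^ K) :
    Computes (K := K) x (incTimes i n) (p, c) () (p, Function.update c i (c i + n)) := by
  induction n generalizing c with
  | zero => simpa [incTimes] using computes_skip () (p, c)
  | succ n ih =>
    refine (computes_inc i (by omega)).bind ?_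
    have := ih (c := Function.update c i (c i + 1)) (by simp; omega)
    simp only [Function.update_self, Function.update_idem] at this
    rwa [show c i + 1 + n = c i + (n + 1) by ring] at this

/-- Empty one counter, adding `g` times its value to another one. -/
def transfer (g : ℕ) (i j : I) : HeadProg α I K Unit :=
  .iter (X := Unit) (fun _ => .bind (headsZero i) fun z => if z then headSkip (.inr ()) else
    .bind (decHeads (counterHeads K i)) fun _ =>
    .bind (incTimes j g) fun _ => headSkip (.inl ())) ()

/-- After `t` rounds the counters hold `c i - t` and `c j + g * t`; the bound on the final value of
`j` bounds all intermediate ones. -/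
lemma computes_transfer (g : ℕ) {i j : I} (hij : i ≠ j)
    (hlt : c j + g * c i < (x.length + 2) ^ K) :
    Computes (K := K) x (transfer g i j) (p, c) ()
      (p, Function.update (Function.update c i 0) j (c j + g * c i)) := by
  have key := Transforms.iter_of_seq (M := headModel (Heads I K) x) (R := HasCounters x)
    (P := fun _ => True) (E := Unit) (X := Unit) (m := fun _ => .bind (headsZero i) fun z =>
      if z then headSkip (.inr ()) else
      .bind (decHeads (counterHeads K i)) fun _ =>
      .bind (incTimes j g) fun _ => headSkip (.inl ()))
    (c i) (fun _ => ())
    (fun t => (p, Function.update (Function.update c i (c i - t)) j (c j + g * t))) (e := ())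
    (z' := (p, Function.update (Function.update c i 0) j (c j + g * c i))) (fun t ht => ?_) ?_
  · have h0 : (p, c) = (p, Function.update (Function.update c i (c i - 0)) j (c j + g * 0)) := by
      rw [Nat.mul_zero, Nat.sub_zero, Function.update_eq_self, Nat.add_zero,
        Function.update_eq_self]
    rw [← h0] at key
    exact key
  · refine (computes_zero i _).bind ?_
    simp only [Function.update_of_ne hij, Function.update_self]
    rw [decide_eq_false (by omega)]
    simp only [Bool.false_eq_true, if_false]
    refine (computes_dec i (c i - (t + 1))
      (by simp only [Function.update_of_ne hij, Function.update_self]; omega)).bind ?_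
    have hmono : g * (t + 1) ≤ g * c i := Nat.mul_le_mul_left _ ht
    have := computes_incTimes (x := x) (K := K) (p := p)
      (c := Function.update (Function.update (Function.update c i (c i - t)) j (c j + g * t)) i
        (c i - (t + 1))) j g (by
          simp only [Function.update_of_ne hij.symm, Function.update_self]
          rw [Nat.mul_add] at hmono
          omega)
    refine this.bind ?_
    convert computes_skip _ _ using 2
    funext l
    by_cases hl : l = j
    · subst hl
      simp [Function.update_of_ne hij.symm]
      ring
    · by_cases hl' : l = i
      · subst hl'; simp [Function.update_of_ne hl]
      · simp [Function.update_of_ne hl, Function.update_of_ne hl']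
  · refine (computes_zero i _).bind ?_
    simp only [Function.update_of_ne hij, Function.update_self]
    rw [decide_eq_true (by omega)]
    simp only [if_true, Nat.sub_self]
    exact computes_skip _ _

/-- Replace the value `v` of the counter `i` by `g * v + a`, using the empty counter `j`. -/
def pushCounter (g : ℕ) (i j : I) (a : ℕ) : HeadProg α I K Unit :=
  .bind (transfer g i j) fun _ => .bind (incTimes j a) fun _ => transfer 1 j i

lemma computes_push (g : ℕ) {i j : I} (hij : i ≠ j) (a : ℕ) (hj : c j = 0)
    (hlt : g * c i + a < (x.length + 2) ^ K) :
    Computes (K := K) x (pushCounter g i j a) (p, c) ()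
      (p, Function.update c i (g * c i + a)) := by
  refine (computes_transfer g hij (by omega)).bind ?_
  refine (computes_incTimes j a (by simp; omega)).bind ?_
  have := computes_transfer (x := x) (K := K) (p := p) (c := Function.update (Function.update
    (Function.update c i 0) j (c j + g * c i)) j (Function.update
    (Function.update c i 0) j (c j + g * c i) j + a)) 1 hij.symm (by
      simp [Function.update_of_ne hij]; omega)
  convert this using 2
  funext l
  by_cases hl : l = i
  · subst hl
    simp [Function.update_of_ne hij, hj]
  · by_cases hl' : l = j
    · subst hl'; simp [Function.update_of_ne hl, hj]
    · simp [Function.update_of_ne hl, Function.update_of_ne hl']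

/-- Divide the counter `i` by `g`, using the empty counter `j`; return the remainder. -/
def popCounter (g : ℕ) [NeZero g] (i j : I) : HeadProg α I K (Fin g) :=
  .bind (.iter (X := Fin g) (fun r => .bind (headsZero i) fun z =>
    if z then headSkip (.inr r) else
    .bind (decHeads (counterHeads K i)) fun _ =>
    if (r : ℕ) + 1 = g then .bind (incTimes j 1) fun _ => headSkip (.inl 0)
    else headSkip (.inl (Fin.ofNat g (r + 1)))) 0) fun r =>
  .bind (transfer 1 j i) fun _ => headSkip r

/-- After `t` rounds the loop variable is `t` modulo `g` and the counter `j` holds `t / g`, since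
`j` is increased only when the remainder wraps around. -/
lemma computes_pop (g : ℕ) [NeZero g] {i j : I} (hij : i ≠ j) (hj : c j = 0)
    (hlt : c i < (x.length + 2) ^ K) :
    Computes (K := K) x (popCounter g i j) (p, c) (Fin.ofNat g (c i))
      (p, Function.update c i (c i / g)) := by
  have hg : 0 < g := Nat.pos_of_ne_zero (NeZero.ne g)
  have key := Transforms.iter_of_seq (M := headModel (Heads I K) x) (R := HasCounters x)
    (P := fun _ => True) (E := Fin g) (X := Fin g) (m := fun r => .bind (headsZero i) fun z =>
      if z then headSkip (.inr r) else
      .bind (decHeads (counterHeads K i)) fun _ =>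
      if (r : ℕ) + 1 = g then .bind (incTimes j 1) fun _ => headSkip (.inl 0)
      else headSkip (.inl (Fin.ofNat g (r + 1))))
    (c i) (fun t => Fin.ofNat g t)
    (fun t => (p, Function.update (Function.update c i (c i - t)) j (t / g)))
    (e := Fin.ofNat g (c i))
    (z' := (p, Function.update (Function.update c i 0) j (c i / g))) (fun t ht => ?_) ?_
  · have h0 : (p, c) = (p, Function.update (Function.update c i (c i - 0)) j (0 / g)) := by
      rw [Nat.zero_div, Nat.sub_zero, Function.update_eq_self, ← hj, Function.update_eq_self]
    rw [← h0] at key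
    refine key.bind ?_
    have hdiv : c i / g ≤ c i := Nat.div_le_self _ _
    refine (computes_transfer 1 hij.symm (by
      simp [Function.update_of_ne hij]; omega)).bind ?_
    convert computes_skip _ _ using 2
    funext l
    by_cases hl : l = i
    · subst hl
      simp [Function.update_of_ne hij]
    · by_cases hl' : l = j
      · subst hl'; simp [Function.update_of_ne hl, hj]
      · simp [Function.update_of_ne hl, Function.update_of_ne hl']
  · refine (computes_zero i _).bind ?_
    simp only [Function.update_of_ne hij, Function.update_self]
    rw [decide_eq_false (by omega)]
    simp only [Bool.false_eq_true, if_false]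
    refine (computes_dec i (c i - (t + 1))
      (by simp only [Function.update_of_ne hij, Function.update_self]; omega)).bind ?_
    simp only [Fin.val_ofNat]
    by_cases hr : t % g + 1 = g
    · rw [if_pos hr]
      have h1 : (t + 1) / g = t / g + 1 := by
        rw [Nat.succ_div, if_pos (Nat.dvd_of_mod_eq_zero (add_one_mod_eq_zero hr))]
      have h2 : Fin.ofNat g (t + 1) = 0 := by
        ext
        simp [add_one_mod_eq_zero hr]
      have hdiv : t / g ≤ t := Nat.div_le_self _ _
      refine (computes_incTimes j 1 (by
        simp only [Function.update_of_ne hij.symm, Function.update_self]; omega)).bind ?_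
      rw [h1, h2]
      convert computes_skip _ _ using 2
      funext l
      by_cases hl : l = j
      · subst hl
        simp [Function.update_of_ne hij.symm]
      · by_cases hl' : l = i
        · subst hl'; simp [Function.update_of_ne hl]
        · simp [Function.update_of_ne hl, Function.update_of_ne hl']
    · rw [if_neg hr]
      have hlt' : t % g + 1 < g := by have := Nat.mod_lt t hg; omega
      have hmod := add_one_mod_eq hlt'
      have h1 : (t + 1) / g = t / g := by
        rw [Nat.succ_div, if_neg (fun h => by rw [Nat.mod_eq_zero_of_dvd h] at hmod; omega)]
        simp
      have h2 : Fin.ofNat g (t % g + 1) = Fin.ofNat g (t + 1) := by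
        ext
        simp
      rw [h1, h2]
      convert computes_skip _ _ using 2
      funext l
      by_cases hl : l = j
      · subst hl
        simp [Function.update_of_ne hij.symm]
      · by_cases hl' : l = i
        · subst hl'; simp [Function.update_of_ne hl]
        · simp [Function.update_of_ne hl, Function.update_of_ne hl']
  · refine (computes_zero i _).bind ?_
    simp only [Function.update_of_ne hij, Function.update_self]
    rw [decide_eq_true (by omega)]
    simp only [if_true, Nat.sub_self]
    exact computes_skip _ _

end Counters


/-! ## Turing machines simulated by multihead automata -/

/-- The digits of `N` in base `g` encode the sequence `f` of symbols. -/
def IsStack {Γ : Type} {g : ℕ} (code : Γ → Fin g) (f : ℕ → Γ) (N : ℕ) : Prop :=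
  ∀ j, N / g ^ j % g = code (f j)

namespace IsStack

variable {Γ : Type} {g : ℕ} {code : Γ → Fin g} {f f' : ℕ → Γ} {N : ℕ}

lemma zero [NeZero g] {b : Γ} (hb : code b = 0) : IsStack code (fun _ => b) 0 := by
  intro j
  simp [hb]

lemma push (h : IsStack code f N) {a : Γ} (h0 : f' 0 = a) (h1 : ∀ j, f' (j + 1) = f j) :
    IsStack code f' (g * N + code a) := by
  have hg : 0 < g := (Nat.zero_le _).trans_lt (code a).2
  intro j
  cases j with
  | zero => simp [h0, Nat.mod_eq_of_lt (code a).2]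
  | succ j =>
    rw [h1, ← h j, pow_succ', ← Nat.div_div_eq_div_mul, Nat.mul_add_div hg,
      Nat.div_eq_of_lt (code a).2, Nat.add_zero]

lemma pop (h : IsStack code f N) (h1 : ∀ j, f' j = f (j + 1)) : IsStack code f' (N / g) := by
  intro j
  rw [h1, ← h (j + 1), pow_succ', Nat.div_div_eq_div_mul]

lemma top [NeZero g] (h : IsStack code f N) : Fin.ofNat g N = code (f 0) := by
  ext
  have := h 0
  rwa [pow_zero, Nat.div_one] at this

lemma eq_zero_of_digits (hg : 1 < g) (h : ∀ j, N / g ^ j % g = 0) : N = 0 := by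
  induction N using Nat.strong_induction_on with
  | _ N ih =>
    by_contra hN
    have h0 : N % g = 0 := by simpa using h 0
    have h1 := ih (N / g) (Nat.div_lt_self (by omega) hg) fun j => by
      rw [Nat.div_div_eq_div_mul, ← pow_succ']
      exact h (j + 1)
    have := Nat.div_add_mod N g
    rw [h1, h0] at this
    omega

/-- The blank has code `0`, so an infinite blank tail contributes no digits and a number represents
a whole half-tape. -/
lemma lt_pow [NeZero g] (hg : 1 < g) {b : Γ} (hb : code b = 0) (h : IsStack code f N) {S : ℕ}
    (hf : ∀ j, S ≤ j → f j = b) : N < g ^ S := by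
  have : N / g ^ S = 0 := eq_zero_of_digits hg fun j => by
    rw [Nat.div_div_eq_div_mul, ← pow_add, h, hf _ (by omega), hb]
    rfl
  exact (Nat.div_eq_zero_iff_lt (by positivity)).1 this

end IsStack

section Simulation

open StoreModel

variable {α : Type u} {Γ : Type} {g k K : ℕ} [NeZero g] {code : Γ → Fin g} {decode : Fin g → Γ}

/-- The counters that hold a number of tapes: for each tape the parts to the left and to the right
of its head, and one auxiliary counter. -/
abbrev TapeIndex (k : ℕ) : Type := Option (Fin (k + 1) × Bool)

/-- The tape with content `T` and head position `w` is held by the counters `l` and `r`. -/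
def IsTape (code : Γ → Fin g) (T : ℤ → Γ) (w : ℤ) (l r : ℕ) : Prop :=
  IsStack code (fun j => T (w - 1 - j)) l ∧ IsStack code (fun j => T (w + 1 + j)) r

/-- Write the symbol `a` on tape `i`, move its head, and return the symbol it reads then. -/
def shiftTape (code : Γ → Fin g) (decode : Fin g → Γ) (i : Fin (k + 1)) (a : Γ) :
    SignType → HeadProg α (TapeIndex k) K Γ
  | .neg => .bind (pushCounter g (some (i, true)) none (code a)) fun _ =>
      .bind (popCounter g (some (i, false)) none) fun v => headSkip (decode v)
  | .zero => headSkip a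
  | .pos => .bind (pushCounter g (some (i, false)) none (code a)) fun _ =>
      .bind (popCounter g (some (i, true)) none) fun v => headSkip (decode v)

variable {x : List α} {p : ℕ} {c : TapeIndex k → ℕ}

/-- The symbol under the head belongs to neither half. A move pushes the written symbol on the half
that the head leaves behind and pops the symbol it then reads from the other half. -/
lemma computes_shiftTape [Finite Γ] (hg : 1 < g) {b : Γ} (hb : code b = 0)
    (hdec : ∀ a, decode (code a) = a) {B : ℕ} (hB : g ^ (2 * B + 1) ≤ (x.length + 2) ^ K)
    (i : Fin (k + 1)) (a : Γ) (d : SignType) (T : ℤ → Γ) (w : ℤ) (hw : |w| ≤ B)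
    (hw' : |w + (d : ℤ)| ≤ B) (hT : ∀ p : ℤ, (B : ℤ) < |p| → T p = b) (h0 : c none = 0)
    (hc : IsTape code T w (c (some (i, false))) (c (some (i, true)))) :
    ∃ c', Computes (K := K) x (shiftTape code decode i a d) (p, c)
        (Function.update T w a (w + (d : ℤ))) (p, c') ∧
      c' none = 0 ∧ (∀ i' ≠ i, ∀ r, c' (some (i', r)) = c (some (i', r))) ∧
      IsTape code (Function.update T w a) (w + (d : ℤ)) (c' (some (i, false)))
        (c' (some (i, true))) := by
  rw [abs_le] at hw hw'
  have hT' : ∀ p : ℤ, (B : ℤ) < |p| → Function.update T w a p = b := fun p hp => by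
    rw [Function.update_of_ne, hT p hp]
    rintro rfl
    rw [lt_abs] at hp
    omega
  have hu : ∀ p : ℤ, p ≠ w → Function.update T w a p = T p := fun p hp =>
    Function.update_of_ne hp _ _
  -- The head is within `B` of the origin, so cells more than `2 * B + 1` away from it lie beyond
  -- `B` and are blank: `2 * B + 1` digits suffice for each half.
  have hlt : ∀ {f N}, IsStack code f N → (∀ j, 2 * B + 1 ≤ j → f j = b) →
      N < (x.length + 2) ^ K := fun h h' => (h.lt_pow hg hb h').trans_le hB
  have hft : (some (i, false) : TapeIndex k) ≠ some (i, true) := by simp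
  cases d with
  | zero =>
    refine ⟨c, ?_, h0, fun _ _ _ => rfl, ?_, ?_⟩
    · simpa [shiftTape] using computes_skip a (p, c)
    · intro j
      simp only [SignType.zero_eq_zero, SignType.coe_zero, add_zero]
      rw [hu _ (by omega)]
      exact hc.1 j
    · intro j
      simp only [SignType.zero_eq_zero, SignType.coe_zero, add_zero]
      rw [hu _ (by omega)]
      exact hc.2 j
  | neg =>
    have hd : w + ((SignType.neg : SignType) : ℤ) = w - 1 := rfl
    rw [hd] at hw' ⊢
    have hp : IsStack code (fun j : ℕ => Function.update T w a (w - 1 + 1 + j))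
        (g * c (some (i, true)) + code a) := hc.2.push (by simp) fun j => by
      rw [hu _ (by push_cast; omega)]
      congr 1
      push_cast
      ring
    have hq : IsStack code (fun j : ℕ => Function.update T w a (w - 1 - 1 - j))
        (c (some (i, false)) / g) := hc.1.pop fun j => by
      rw [hu _ (by omega)]
      congr 1
      push_cast
      ring
    have hl1 := hlt hp fun j hj => hT' _ (by rw [lt_abs]; omega)
    have hl2 := hlt hc.1 fun j hj => hT _ (by rw [lt_abs]; omega)
    refine ⟨Function.update (Function.update c (some (i, true)) (g * c (some (i, true)) + code a))
      (some (i, false)) (c (some (i, false)) / g), ?_, ?_, ?_, ?_, ?_⟩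
    · refine (computes_push g (by simp) _ h0 hl1).bind ?_
      have h1 := computes_pop (x := x) (K := K) (p := p) g (i := some (i, false)) (j := none)
        (c := Function.update c (some (i, true)) (g * c (some (i, true)) + code a)) (by simp)
        (by simp [h0]) (by rwa [Function.update_of_ne hft])
      rw [Function.update_of_ne hft] at h1
      refine h1.bind ?_
      rw [hc.1.top, hdec, hu _ (by omega)]
      simpa using computes_skip _ _
    · simp [h0]
    · intro i' hi' r
      simp [hi']
    · simpa using hq
    · simpa [Function.update_of_ne hft.symm] using hp
  | pos =>
    have hd : w + ((SignType.pos : SignType) : ℤ) = w + 1 := rfl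
    rw [hd] at hw' ⊢
    have hp : IsStack code (fun j : ℕ => Function.update T w a (w + 1 - 1 - j))
        (g * c (some (i, false)) + code a) := hc.1.push (by simp) fun j => by
      rw [hu _ (by push_cast; omega)]
      congr 1
      push_cast
      ring
    have hq : IsStack code (fun j : ℕ => Function.update T w a (w + 1 + 1 + j))
        (c (some (i, true)) / g) := hc.2.pop fun j => by
      rw [hu _ (by omega)]
      congr 1
      push_cast
      ring
    have hl1 := hlt hp fun j hj => hT' _ (by rw [lt_abs]; omega)
    have hl2 := hlt hc.2 fun j hj => hT _ (by rw [lt_abs]; omega)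
    refine ⟨Function.update (Function.update c (some (i, false))
      (g * c (some (i, false)) + code a)) (some (i, true)) (c (some (i, true)) / g),
      ?_, ?_, ?_, ?_, ?_⟩
    · refine (computes_push g (by simp) _ h0 hl1).bind ?_
      have h1 := computes_pop (x := x) (K := K) (p := p) g (i := some (i, true)) (j := none)
        (c := Function.update c (some (i, false)) (g * c (some (i, false)) + code a)) (by simp)
        (by simp [h0]) (by rwa [Function.update_of_ne hft.symm])
      rw [Function.update_of_ne hft.symm] at h1
      refine h1.bind ?_
      rw [hc.2.top, hdec, hu _ (by omega)]
      simpa using computes_skip _ _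
    · simp [h0]
    · intro i' hi' r
      simp [hi']
    · simpa [Function.update_of_ne hft] using hp
    · simpa using hq

/-- Write and move on several tapes; return the symbols read then. -/
def shiftTapes [Finite Γ] (code : Γ → Fin g) (decode : Fin g → Γ) (a : Fin (k + 1) → Γ)
    (d : Fin (k + 1) → SignType) :
    List (Fin (k + 1)) → (Fin (k + 1) → Γ) → HeadProg α (TapeIndex k) K (Fin (k + 1) → Γ)
  | [], cur => headSkip cur
  | i :: is, cur => .bind (shiftTape code decode i (a i) (d i)) fun v =>
      shiftTapes code decode a d is (Function.update cur i v)

/-- The tapes are treated one after another and share the auxiliary counter, which is empty in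
between. Tapes in the list are still in the old state, the others already in the new one. -/
lemma computes_shiftTapes [Finite Γ] (hg : 1 < g) {b : Γ} (hb : code b = 0)
    (hdec : ∀ a, decode (code a) = a) {B : ℕ} (hB : g ^ (2 * B + 1) ≤ (x.length + 2) ^ K)
    (a : Fin (k + 1) → Γ) (d : Fin (k + 1) → SignType) (T : Fin (k + 1) → ℤ → Γ)
    (w : Fin (k + 1) → ℤ) (hw : ∀ i, |w i| ≤ B) (hw' : ∀ i, |w i + (d i : ℤ)| ≤ B)
    (hT : ∀ i, ∀ p : ℤ, (B : ℤ) < |p| → T i p = b) (is : List (Fin (k + 1))) (hnd : is.Nodup)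
    (cur : Fin (k + 1) → Γ) (h0 : c none = 0)
    (hc : ∀ i ∈ is, IsTape code (T i) (w i) (c (some (i, false))) (c (some (i, true))))
    (hc' : ∀ i ∉ is, IsTape code (Function.update (T i) (w i) (a i)) (w i + (d i : ℤ))
      (c (some (i, false))) (c (some (i, true))) ∧
      cur i = Function.update (T i) (w i) (a i) (w i + (d i : ℤ))) :
    ∃ c', Computes (K := K) x (shiftTapes code decode a d is cur) (p, c)
        (fun i => Function.update (T i) (w i) (a i) (w i + (d i : ℤ))) (p, c') ∧
      c' none = 0 ∧ ∀ i, IsTape code (Function.update (T i) (w i) (a i)) (w i + (d i : ℤ))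
        (c' (some (i, false))) (c' (some (i, true))) := by
  induction is generalizing c cur with
  | nil =>
    refine ⟨c, ?_, h0, fun i => (hc' i (by simp)).1⟩
    rw [show (fun i => Function.update (T i) (w i) (a i) (w i + (d i : ℤ))) = cur from
      funext fun i => (hc' i (by simp)).2.symm]
    exact computes_skip _ _
  | cons i is ih =>
    rw [List.nodup_cons] at hnd
    obtain ⟨c₁, h1, h2, h3, h4⟩ := computes_shiftTape (p := p) hg hb hdec hB i (a i) (d i) (T i)
      (w i) (hw i) (hw' i) (hT i) h0 (hc i (by simp))
    obtain ⟨c₂, h5, h6⟩ := ih hnd.2 (c := c₁) (Function.update cur i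
        (Function.update (T i) (w i) (a i) (w i + (d i : ℤ)))) h2 (fun i' hi' => by
      have hne : i' ≠ i := by rintro rfl; exact hnd.1 hi'
      rw [h3 i' hne, h3 i' hne]
      exact hc i' (by simp [hi'])) (fun i' hi' => by
      by_cases hne : i' = i
      · subst hne
        exact ⟨h4, by simp⟩
      · rw [h3 i' hne, h3 i' hne, Function.update_of_ne hne]
        exact hc' i' (by simp [hne, hi']))
    exact ⟨c₂, h1.bind h5, h6⟩

variable {M : DTM α}

/-- One step of a Turing machine whose heads read the symbols `cur`. -/
def simulateStep [Finite M.Q] [Finite M.Γ] (code : M.Γ → Fin g) (decode : Fin g → M.Γ) (K : ℕ)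
    (q : M.Q × (Fin (M.k + 1) → M.Γ)) :
    HeadProg α (TapeIndex M.k) K ((M.Q × (Fin (M.k + 1) → M.Γ)) ⊕ Bool) :=
  .bind (.op fun o =>
    let r := M.δ q.1 (o (.inl ())).2 q.2
    ((r.1.toSum, r.2.1, r.2.2.2), moveOne (.inl ()) r.2.2.1)) fun r =>
  .bind (shiftTapes code decode r.2.1 r.2.2 (List.finRange _) q.2) fun cur =>
  headSkip (r.1.map (fun q' => (q', cur)) id)

/-- The configuration `C` of a Turing machine is held by the counters `c`. -/
def HoldsConfig {M : DTM α} (code : M.Γ → Fin g) (C : M.Config) (c : TapeIndex M.k → ℕ) : Prop :=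
  c none = 0 ∧ ∀ i, IsTape code (C.tape i) (C.workPos i) (c (some (i, false)))
    (c (some (i, true)))

/-- The symbols under the work heads are part of the program state, so a look at the input symbol
already determines the transition. -/
lemma computes_simulateStep [Finite M.Q] [Finite M.Γ] {code : M.Γ → Fin g} {decode : Fin g → M.Γ}
    (hg : 1 < g) (hb : code M.blank = 0) (hdec : ∀ a, decode (code a) = a) {B : ℕ}
    (hB : g ^ (2 * B + 1) ≤ (x.length + 2) ^ K) {C : M.Config} {q : M.Q} (hq : C.state = .run q)
    (hw : ∀ i, |C.workPos i| ≤ B) (hw' : ∀ i, |(C.step x).workPos i| ≤ B)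
    (hT : ∀ i, ∀ p : ℤ, (B : ℤ) < |p| → C.tape i p = M.blank) {c : TapeIndex M.k → ℕ}
    (hc : HoldsConfig code C c) :
    ∃ c', HoldsConfig code (C.step x) c' ∧
      Computes x (simulateStep code decode K (q, fun i => C.tape i (C.workPos i))) (C.inPos, c)
        ((C.step x).state.toSum.map
          (fun q' => (q', fun i => (C.step x).tape i ((C.step x).workPos i))) id)
        ((C.step x).inPos, c') := by
  have hstep : C.step x =
      C.apply x (M.δ q (inputSymbol x C.inPos) fun i => C.tape i (C.workPos i)) := by
    simp [DTM.Config.step, hq]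
  rw [hstep] at hw' ⊢
  generalize hr : M.δ q (inputSymbol x C.inPos) (fun i => C.tape i (C.workPos i)) = r at *
  obtain ⟨c', h1, h2⟩ := computes_shiftTapes (x := x) (K := K)
    (p := moveInput x.length r.2.2.1 C.inPos) hg hb hdec hB r.2.1 r.2.2.2 C.tape
    C.workPos hw hw' hT (List.finRange _) (List.nodup_finRange _)
    (fun i => C.tape i (C.workPos i)) hc.1 (fun i _ => hc.2 i)
    (fun i hi => absurd (List.mem_finRange i) hi)
  refine ⟨c', h2, Transforms.bind (e := (r.1.toSum, r.2.1, r.2.2.2))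
    (z' := (moveInput x.length r.2.2.1 C.inPos, c)) ?_ (h1.bind (computes_skip _ _))⟩
  intro s hs
  refine ⟨Function.update s (.inl ()) (moveInput x.length r.2.2.1 (s (.inl ()))),
    Runs.op' (a := moveOne (.inl ()) r.2.2.1) ?_ (headModel_moveOne _ _ _ _) trivial trivial,
    ?_, fun h => ?_, fun i => ?_⟩
  · have : ((headModel (Heads (TapeIndex M.k) K) x).obs s (.inl ())).2 =
        inputSymbol x C.inPos := congrArg (inputSymbol x) hs.1
    simp only [this, hr]
  · rw [Function.update_self, hs.1]
  · by_cases hh : h = .inl ()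
    · rw [hh, Function.update_self]
      exact moveInput_le _ (hs.2.1 _)
    · rw [Function.update_of_ne hh]
      exact hs.2.1 h
  · rw [map_update_of_notMem (by simp [mem_counterHeads])]
    exact hs.2.2 i

lemma DTM.run_succ (M : DTM α) (x : List α) (t : ℕ) :
    M.run x (t + 1) = (M.run x t).step x := by
  simp only [DTM.run, Function.iterate_succ_apply']

lemma DTM.tape_eq_blank (M : DTM α) {x : List α} {B : ℕ}
    (hw : ∀ i t, |(M.run x t).workPos i| ≤ B) (t : ℕ) (i : Fin (M.k + 1)) {p : ℤ}
    (hp : (B : ℤ) < |p|) : (M.run x t).tape i p = M.blank := by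
  induction t with
  | zero => rfl
  | succ t ih =>
    rw [M.run_succ]
    have hw := hw i t
    generalize M.run x t = C at ih hw
    obtain ⟨q, ip, T, w⟩ := C
    rcases q with q | _ | _
    · simp only [DTM.Config.step, DTM.Config.apply]
      rw [Function.update_of_ne]
      · exact ih
      · rintro rfl
        dsimp only at hw
        omega
    · exact ih
    · exact ih

lemma DTM.run_add_of_halted (M : DTM α) {x : List α} {t : ℕ}
    (h : ∀ q, (M.run x t).state ≠ .run q) (n : ℕ) : M.run x (t + n) = M.run x t := by
  induction n with
  | zero => rfl
  | succ n ih =>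
    rw [← Nat.add_assoc, M.run_succ, ih]
    rcases hs : (M.run x t).state with q | _ | _
    · exact absurd hs (h q)
    · simp [DTM.Config.step, hs]
    · simp [DTM.Config.step, hs]

lemma runs_simulation [Finite M.Q] [Finite M.Γ] {code : M.Γ → Fin g} {decode : Fin g → M.Γ}
    (hg : 1 < g) (hb : code M.blank = 0) (hdec : ∀ a, decode (code a) = a) {B : ℕ}
    (hB : g ^ (2 * B + 1) ≤ (x.length + 2) ^ K) (hw : ∀ i t, |(M.run x t).workPos i| ≤ B)
    (n t : ℕ) (q : M.Q) (hq : (M.run x t).state = .run q)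
    (hn : ∀ q, (M.run x (t + n)).state ≠ .run q) (c : TapeIndex M.k → ℕ)
    (hc : HoldsConfig code (M.run x t) c) :
    ∃ e z, Computes x (.iter (simulateStep code decode K)
        (q, fun i => (M.run x t).tape i ((M.run x t).workPos i))) ((M.run x t).inPos, c) e z ∧
      ∃ t, (M.run x t).state.toSum = .inr e := by
  induction n generalizing t q c with
  | zero => exact absurd hq (hn q)
  | succ n ih =>
    obtain ⟨c', h1, h2⟩ := computes_simulateStep hg hb hdec hB hq (fun i => hw i t)
      (fun i => M.run_succ x t ▸ hw i (t + 1)) (fun i p hp => M.tape_eq_blank hw t i hp) hc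
    rw [← M.run_succ] at h1 h2
    rcases hs : (M.run x (t + 1)).state.toSum with q' | e
    · rw [hs] at h2
      have hq' : (M.run x (t + 1)).state = .run q' := by
        rcases h : (M.run x (t + 1)).state with _ | _ | _ <;> rw [h] at hs <;>
          simp [Control.toSum] at hs
        rw [hs]
      obtain ⟨e, z, h3, h4⟩ := ih (t + 1) q' hq' (by rwa [Nat.add_right_comm]) c' h1
      refine ⟨e, z, fun s hs => ?_, h4⟩
      obtain ⟨s', h5, h6⟩ := h2 s hs
      obtain ⟨s'', h7, h8⟩ := h3 s' h6
      exact ⟨s'', h5.iter_next h7, h8⟩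
    · rw [hs] at h2
      refine ⟨e, ((M.run x (t + 1)).inPos, c'), fun s hs => ?_, t + 1, hs⟩
      obtain ⟨s', h5, h6⟩ := h2 s hs
      exact ⟨s', h5.iter_exit, h6⟩

end Simulation

/-- A transposition gives the blank the code `0`; one unused code ensures `1 < g` even for a single
symbol. -/
lemma exists_symbol_code {Γ : Type} [Finite Γ] (b : Γ) :
    ∃ (g : ℕ) (_ : NeZero g) (code : Γ → Fin g) (decode : Fin g → Γ), 1 < g ∧ code b = 0 ∧
      ∀ a, decode (code a) = a := by
  classical
  have := Fintype.ofFinite Γ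
  let e := Fintype.equivFin Γ
  have hb : 0 < Fintype.card Γ := Fintype.card_pos_iff.2 ⟨b⟩
  let e' : Γ → Fin (Fintype.card Γ + 1) := fun a =>
    (Equiv.swap (e b).castSucc 0 (e a).castSucc)
  have he : Function.Injective e' := fun a a' h => by simpa [e'] using h
  exact ⟨_, ⟨by omega⟩, e', fun v => haveI : Nonempty Γ := ⟨b⟩; Function.invFun e' v, by omega,
    by simp [e'], fun a => haveI : Nonempty Γ := ⟨b⟩; Function.leftInverse_invFun he a⟩

/-- Numbers with logarithmically many digits are polynomially bounded: `g ≤ 2 ^ g` and `2 ^ (Nat.log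
2 n + 1) ≤ (n + 2) ^ 2`. The exponent on the right is the number of heads per counter. -/
lemma pow_le_pow_of_log (g C n : ℕ) :
    g ^ (2 * (C * (Nat.log 2 n + 1)) + 1) ≤ (n + 2) ^ (2 * (g * (2 * C + 1))) := by
  have h1 : 2 ^ (Nat.log 2 n + 1) ≤ (n + 2) ^ 2 := by
    rcases Nat.eq_zero_or_pos n with rfl | hn
    · simp
    · have := Nat.pow_log_le_self 2 hn.ne'
      rw [pow_succ]
      nlinarith
  calc g ^ (2 * (C * (Nat.log 2 n + 1)) + 1)
      ≤ (2 ^ g) ^ (2 * (C * (Nat.log 2 n + 1)) + 1) := Nat.pow_le_pow_left Nat.lt_two_pow_self.le _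
    _ ≤ (2 ^ g) ^ ((2 * C + 1) * (Nat.log 2 n + 1)) :=
        Nat.pow_le_pow_right (by positivity) (by ring_nf; omega)
    _ = (2 ^ (Nat.log 2 n + 1)) ^ (g * (2 * C + 1)) := by
        rw [← pow_mul, ← pow_mul]
        congr 1
        ring
    _ ≤ ((n + 2) ^ 2) ^ (g * (2 * C + 1)) := Nat.pow_le_pow_left h1 _
    _ = _ := (pow_mul _ _ _).symm

/-- Logarithmic space is contained in the languages of deterministic multihead automata. -/
theorem LogSpace_subset_multiheadDFA (α : Type u) : LogSpace α ⊆ multiheadDFA α := by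
  rintro L ⟨M, ⟨C, hC⟩, hL⟩
  have := M.finQ
  have := M.finΓ
  obtain ⟨g, _, code, decode, hg, hb, hdec⟩ := exists_symbol_code M.blank
  refine mem_multiheadDFA_of_prog (H := Heads (TapeIndex M.k) (2 * (g * (2 * C + 1))))
    (.iter (simulateStep code decode _) (M.start, fun _ => M.blank)) L fun x => ?_
  have hhalt : ∃ t, ∀ q, (M.run x t).state ≠ .run q := by
    by_cases hx : x ∈ L
    · obtain ⟨t, ht⟩ := (hL x).1 hx
      exact ⟨t, fun q => by simp [ht]⟩
    · obtain ⟨t, ht⟩ := (hL x).2 hx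
      exact ⟨t, fun q => by simp [ht]⟩
  obtain ⟨n, hn⟩ := hhalt
  obtain ⟨e, z, h1, t, ht⟩ := runs_simulation (x := x) (K := 2 * (g * (2 * C + 1))) hg hb hdec
    (pow_le_pow_of_log g C x.length) (fun i t => M.abs_workPos_le (hC x) i t) n 0 M.start rfl
    (by rwa [Nat.zero_add]) (fun _ => 0)
    ⟨rfl, fun i => ⟨IsStack.zero hb, IsStack.zero hb⟩⟩
  obtain ⟨σ, h2, -⟩ := h1 (fun _ => 0) ⟨rfl, fun _ => Nat.zero_le _, fun i => by
    rw [ofDigits_eq_zero_iff (by omega)]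
    simp⟩
  refine ⟨e, σ, ?_, h2⟩
  -- Halted configurations do not change, so all halting times show the same exit value.
  have hstay : ∀ t', (∀ q, (M.run x t').state ≠ .run q) → (M.run x t').state.toSum = .inr e := by
    intro t' ht'
    have h3 : ∀ q, (M.run x t).state ≠ .run q := fun q hq => by
      rw [hq] at ht
      simp [Control.toSum] at ht
    rw [← M.run_add_of_halted ht' t, Nat.add_comm, M.run_add_of_halted h3, ht]
  by_cases hx : x ∈ L
  · obtain ⟨t', ht'⟩ := (hL x).1 hx
    have := hstay t' (fun q => by simp [ht'])
    rw [ht'] at this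
    simpa [hx, Control.toSum, eq_comm] using this
  · obtain ⟨t', ht'⟩ := (hL x).2 hx
    have := hstay t' (fun q => by simp [ht'])
    rw [ht'] at this
    simpa [hx, Control.toSum, eq_comm] using this


/-! ## Heads held by binary counters -/

namespace StoreModel

variable {O : Type u} {A E X S Z : Type} {M : StoreModel O A S}

lemma Transforms.iter_forever [Finite X] {R : S → Z → Prop} {P : S → Prop}
    {m : X → Prog O A (X ⊕ E)} (x : ℕ → X) (z : ℕ → Z)
    (h : ∀ i, M.Transforms R P (m (x i)) (z i) (.inl (x (i + 1))) (z (i + 1))) {s : S}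
    (hs : R s (z 0)) (n : ℕ) :
    (∃ q, ((M.step (.iter m (x 0)))^[n] (.inl (Prog.iter m (x 0)).start, s)).1 = .inl q) ∧
      P ((M.step (.iter m (x 0)))^[n] (.inl (Prog.iter m (x 0)).start, s)).2 := by
  -- A round is only known to work on related stores, so the sequence of stores is built recursively
  -- together with the proofs of the relation.
  choose f hf using h
  let σ : ∀ i, {s // R s (z i)} := fun i =>
    Nat.rec ⟨s, hs⟩ (fun i s => ⟨f i s.1 s.2, (hf i s.1 s.2).2⟩) i
  exact StoreModel.iter_forever x (fun i => (σ i).1) (fun i => (hf i (σ i).1 (σ i).2).1) n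

lemma Runs.exit_iff {m : Prog O A E} {P : S → Prop} {s s' : S} {e : E} (h : M.Runs m P s e s')
    (e' : E) : (∃ t, ((M.step m)^[t] (.inl m.start, s)).1 = .inr e') ↔ e' = e := by
  obtain ⟨t, ht⟩ := h.iterate.1
  constructor
  · rintro ⟨t', ht'⟩
    rcases hc : ((M.step m)^[t'] (.inl m.start, s)) with ⟨q, σ⟩
    rw [hc] at ht'
    dsimp only at ht'
    subst ht'
    have h1 := congrArg (M.step m)^[t'] ht
    rw [← Function.iterate_add_apply, add_comm, Function.iterate_add_apply, hc, iterate_inr,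
      iterate_inr] at h1
    simpa using congrArg Prod.fst h1
  · rintro rfl
    exact ⟨t, by rw [ht]⟩

end StoreModel

section Tracks

open StoreModel

variable {α : Type u} {I : Type}

/-- A work tape with cells `0, …, W - 1` in use, each of which holds one bit for each track. -/
def trackStore (ip W : ℕ) (β : I → ℕ → Bool) (p n : ℤ) : CoinStore (Option (I → Bool)) :=
  ⟨ip, fun z => if 0 ≤ z ∧ z < W then some fun i => β i z.toNat else none, p, n⟩

abbrev TrackProg (α : Type u) (I E : Type) : Type (max u 1) :=
  Prog (Option α × Option (I → Bool) × Bool) (Option (I → Bool) × SignType × SignType × Bool) E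

def trackRead (i : I) (o : Option α × Option (I → Bool) × Bool) : Option Bool :=
  o.2.1.map (· i)

def trackWrite [DecidableEq I] (i : I) (o : Option α × Option (I → Bool) × Bool) (b : Bool)
    (d : SignType) : Option (I → Bool) × SignType × SignType × Bool :=
  (o.2.1.map (Function.update · i b), .zero, d, false)

def trackMove (o : Option α × Option (I → Bool) × Bool) (d : SignType) :
    Option (I → Bool) × SignType × SignType × Bool :=
  (o.2.1, .zero, d, false)

/-- Keep the work tape and move the input head. -/
def inputOp {E : Type} (e : Option α → E) (d : SignType) : TrackProg α I E :=
  .op fun o => (e o.1, o.2.1, d, .zero, false)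

/-- A counter has a value, the input head is at a position, and a number of coins have been
tossed. -/
def TrackState (Wm : ℕ) (D : ℤ) (s : CoinStore (Option (I → Bool))) (z : ℕ × (I → ℕ) × ℤ) : Prop :=
  z.2.2 ≤ D ∧ ∃ W ≤ Wm, (∀ i, z.2.1 i < 2 ^ W) ∧
    s = trackStore z.1 W (fun i => (z.2.1 i).testBit) 0 z.2.2

def TrackBound (Wm : ℕ) (D : ℤ) (s : CoinStore (Option (I → Bool))) : Prop :=
  |s.workPos| ≤ Wm ∧ s.coin ≤ D

abbrev TrackComputes (x : List α) (ω : ℕ → Bool) (Wm : ℕ) (D : ℤ) {E : Type}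
    (m : TrackProg α I E) (z : ℕ × (I → ℕ) × ℤ) (e : E) (z' : ℕ × (I → ℕ) × ℤ) : Prop :=
  (coinModel (Option (I → Bool)) x ω).Transforms (TrackState Wm D) (TrackBound Wm D) m z e z'

variable {x : List α} {ω : ℕ → Bool} {Wm : ℕ} {D : ℤ} {ip : ℕ} {c : I → ℕ} {n : ℤ}

lemma trackBound_trackStore {W : ℕ} (hWm : 1 ≤ Wm) (hW : W ≤ Wm) (hn : n ≤ D) (β : I → ℕ → Bool)
    (p : ℤ) (h : -1 ≤ p) (h' : p ≤ W) : TrackBound Wm D (trackStore ip W β p n) := by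
  refine ⟨?_, hn⟩
  change |p| ≤ _
  rw [abs_le]
  omega

lemma bitTape_track [DecidableEq I] (x : List α) (ω : ℕ → Bool) (ip W : ℕ) (β : I → ℕ → Bool)
    (n : ℤ) (i : I) :
    BitTape (coinModel (Option (I → Bool)) x ω) W
      (fun β' p => trackStore ip W (Function.update β i β') p n)
      (trackRead i) (trackWrite i) trackMove where
  rd_in β' p hp := by simp [trackRead, coinModel, trackStore, hp]
  rd_right β' := by simp [trackRead, coinModel, trackStore]
  rd_left β' := by simp [trackRead, coinModel, trackStore]
  act_wr β' p b d hp := by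
    simp only [coinModel, trackWrite, trackStore, coinMove]
    ext1
    · rfl
    · funext z
      by_cases hz : z = p
      · subst hz
        simp only [Function.update_self, Nat.cast_nonneg, Nat.cast_lt, hp, and_self, if_true,
          Option.map_some, Int.toNat_natCast, Option.some.injEq]
        funext i'
        by_cases hi : i' = i
        · subst hi; simp
        · simp [Function.update_of_ne hi]
      · simp only [Function.update_of_ne hz]
        split_ifs with h
        · simp only [Option.some.injEq]
          funext i'
          by_cases hi : i' = i
          · subst hi
            rw [Function.update_self, Function.update_self, Function.update_of_ne]
            omega
          · simp [Function.update_of_ne hi]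
        · rfl
    · rfl
    · simp
  act_mv β' p d := by
    simp only [coinModel, trackMove, trackStore, coinMove, Function.update_eq_self]
    ext1
    · rfl
    · rfl
    · rfl
    · simp

lemma trackBits_update [DecidableEq I] (c : I → ℕ) (i : I) (N : ℕ) :
    Function.update (fun i => (c i).testBit) i N.testBit =
      fun i' => (Function.update c i N i').testBit := by
  funext i'
  by_cases hi : i' = i
  · subst hi; simp
  · simp [Function.update_of_ne hi]

lemma trackBits_self [DecidableEq I] (c : I → ℕ) (i : I) :
    Function.update (fun i => (c i).testBit) i (c i).testBit = fun i' => (c i').testBit :=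
  Function.update_eq_self _ _

lemma update_lt [DecidableEq I] {B : ℕ} (hc : ∀ i, c i < B) (i : I) {v : ℕ} (hv : v < B) (i' : I) :
    Function.update c i v i' < B := by
  by_cases hi : i' = i
  · subst hi; simpa using hv
  · rw [Function.update_of_ne hi]; exact hc i'

lemma computes_inputOp {E : Type} (hWm : 1 ≤ Wm) (e : Option α → E) (d : SignType)
    (z : ℕ × (I → ℕ) × ℤ) :
    TrackComputes x ω Wm D (inputOp e d) z (e (inputSymbol x z.1))
      (moveInput x.length d z.1, z.2) := by
  rintro s ⟨hD, W, hW, hc, rfl⟩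
  refine ⟨_, Runs.op' rfl rfl (trackBound_trackStore hWm hW hD _ _ (by omega) (by omega)) ?_,
    hD, W, hW, hc, ?_⟩
  all_goals
    have : (coinModel (Option (I → Bool)) x ω).act
        (((coinModel (Option (I → Bool)) x ω).obs
          (trackStore z.1 W (fun i => (z.2.1 i).testBit) 0 z.2.2)).2.1, d, .zero, false)
        (trackStore z.1 W (fun i => (z.2.1 i).testBit) 0 z.2.2) =
        trackStore (moveInput x.length d z.1) W (fun i => (z.2.1 i).testBit) 0 z.2.2 := by
      simp only [coinModel, trackStore, coinMove, Function.update_eq_self]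
      ext1
      · rfl
      · rfl
      · rfl
      · simp
    rw [this]
  exact trackBound_trackStore hWm hW hD _ _ (by omega) (by omega)

variable [DecidableEq I]

def trackZero (i : I) : TrackProg α I Bool := .isZero (trackRead i) (trackWrite i) trackMove

def trackDec (i : I) : TrackProg α I Unit := .dec (trackRead i) (trackWrite i) trackMove

/-- Increment; when there is an overflow, a new cell is taken into use. -/
def trackInc (i : I) : TrackProg α I Unit :=
  .bind (.inc (trackRead i) (trackWrite i) trackMove) fun v =>
    if v then .append (trackRead i) trackMove
      fun _ => (some fun i' => decide (i' = i), .zero, .zero, false)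
    else inputOp (fun _ => ()) .zero

lemma computes_trackZero (hWm : 1 ≤ Wm) (i : I) :
    TrackComputes x ω Wm D (trackZero i) (ip, c, n) (decide (c i = 0)) (ip, c, n) := by
  rintro s ⟨hD, W, hW, hc, rfl⟩
  refine ⟨_, ?_, hD, W, hW, hc, rfl⟩
  have := (bitTape_track x ω ip W (fun i => (c i).testBit) n i).isZero
    (P := TrackBound Wm D) (hc i)
    fun β p h h' => trackBound_trackStore hWm hW hD _ _ h h'
  rw [trackBits_self] at this
  exact this

lemma computes_trackDec (hWm : 1 ≤ Wm) (i : I) (v : ℕ) (hv : c i = v + 1) :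
    TrackComputes x ω Wm D (trackDec i) (ip, c, n) () (ip, Function.update c i v, n) := by
  rintro s ⟨hD, W, hW, hc, rfl⟩
  replace hc : ∀ i, c i < 2 ^ W := hc
  have hv' : v + 1 < 2 ^ W := hv ▸ hc i
  refine ⟨_, ?_, hD, W, hW, update_lt hc i (by omega), rfl⟩
  have := (bitTape_track x ω ip W (fun i => (c i).testBit) n i).dec
    (P := TrackBound Wm D) hv' fun β p h h' => trackBound_trackStore hWm hW hD _ _ h h'
  rw [← hv, trackBits_self, trackBits_update] at this
  exact this

/-- After an overflow track `i` is zero and its new value is `2 ^ W`, a single one in the new cell;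
for the other tracks this cell is a leading zero. The new width is allowed since `2 ^ W < 2 ^ Wm`.
-/
lemma computes_trackInc (hWm : 1 ≤ Wm) (i : I) (hlt : c i + 1 < 2 ^ Wm) :
    TrackComputes x ω Wm D (trackInc i) (ip, c, n) () (ip, Function.update c i (c i + 1), n) := by
  rintro s ⟨hD, W, hW, hc, rfl⟩
  replace hc : ∀ i, c i < 2 ^ W := hc
  have hbt := bitTape_track x ω ip W (fun i => (c i).testBit) n i
  have hP : ∀ β (p : ℤ), -1 ≤ p → p ≤ W → TrackBound Wm D
      (trackStore ip W (Function.update (fun i => (c i).testBit) i β) p n) :=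
    fun β p h h' => trackBound_trackStore hWm hW hD _ _ h h'
  by_cases ho : c i + 1 < 2 ^ W
  · have h1 := hbt.inc ho hP
    rw [trackBits_self, trackBits_update] at h1
    obtain ⟨s', h2, h3⟩ := computes_inputOp (x := x) (ω := ω) (D := D) hWm (fun _ => ()) .zero
      (ip, Function.update c i (c i + 1), n) _ ⟨hD, W, hW, update_lt hc i ho, rfl⟩
    exact ⟨s', h1.bind h2, h3⟩
  · have ho' : c i + 1 = 2 ^ W := by
      have := hc i
      omega
    have hW' : W + 1 ≤ Wm := by
      rw [ho'] at hlt
      exact (Nat.pow_lt_pow_iff_right (by norm_num)).1 hlt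
    have h1 := hbt.inc_overflow ho' hP
    have h2 := hbt.append (bitTape_track x ω ip (W + 1) (fun i => (c i).testBit) n i)
      (b := true) (new := fun _ => (some fun i' => decide (i' = i), .zero, .zero, false))
      (0 : ℕ).testBit ?_ hP fun β p h h' =>
        trackBound_trackStore hWm hW' hD _ _ h (by push_cast; exact h')
    · have h3 : Function.update (0 : ℕ).testBit W true = (c i + 1).testBit := by
        funext j
        rw [ho', Nat.testBit_two_pow]
        by_cases hj : j = W
        · subst hj; simp
        · rw [Function.update_of_ne hj]
          simp [Ne.symm hj]
      rw [h3] at h2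
      rw [trackBits_update, trackBits_update] at h2
      rw [trackBits_self, trackBits_update] at h1
      have h4 : 2 ^ W < 2 ^ (W + 1) := Nat.pow_lt_pow_right (by norm_num) (by omega)
      exact ⟨_, h1.bind h2, hD, W + 1, hW',
        update_lt (fun i' => (hc i').trans h4) i (ho' ▸ h4), rfl⟩
    · simp only [coinModel, trackStore, coinMove]
      ext1
      · rfl
      · funext z
        by_cases hz : z = W
        · subst hz
          simp only [Function.update_self, Nat.cast_nonneg, true_and, Int.toNat_natCast]
          rw [if_pos (by omega)]
          simp only [Option.some.injEq]
          funext i'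
          by_cases hi : i' = i
          · subst hi; simp
          · have : (c i').testBit W = false := Nat.testBit_lt_two_pow (hc i')
            simp [hi, this]
        · simp only [Function.update_of_ne hz]
          have h5 : (0 ≤ z ∧ z < W) ↔ (0 ≤ z ∧ z < ((W + 1 : ℕ) : ℤ)) := by omega
          simp only [h5]
          split_ifs with h6
          · simp only [Option.some.injEq]
            funext i'
            by_cases hi : i' = i
            · subst hi
              rw [Function.update_self, Function.update_self, Function.update_of_ne]
              omega
            · simp [Function.update_of_ne hi]
          · rfl
      · simp
      · simp

/-- Move the content of a counter to another counter, moving the input head along. -/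
def shiftTrack (i j : I) (d : SignType) : TrackProg α I Unit :=
  .iter (X := Unit) (fun _ => .bind (trackZero i) fun v =>
    if v then inputOp (fun _ => .inr ()) .zero else
    .bind (trackDec i) fun _ => .bind (trackInc j) fun _ => inputOp (fun _ => .inl ()) d) ()

/-- The value is moved in unit steps, each with one move of the input head; `f t` is the head
position after `t` of them. -/
lemma computes_shiftTrack (hWm : 1 ≤ Wm) {i j : I} (hij : i ≠ j) (hlt : c j + c i < 2 ^ Wm)
    (d : SignType) (f : ℕ → ℕ) (hf : ∀ t < c i, f (t + 1) = moveInput x.length d (f t)) :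
    TrackComputes x ω Wm D (shiftTrack i j d) (f 0, c, n) ()
      (f (c i), Function.update (Function.update c i 0) j (c j + c i), n) := by
  have key := Transforms.iter_of_seq (M := coinModel (Option (I → Bool)) x ω)
    (R := TrackState Wm D) (P := TrackBound Wm D) (E := Unit) (X := Unit)
    (m := fun _ => .bind (trackZero i) fun v =>
      if v then inputOp (fun _ => .inr ()) .zero else
      .bind (trackDec i) fun _ => .bind (trackInc j) fun _ => inputOp (fun _ => .inl ()) d)
    (c i) (fun _ => ())
    (fun t => (f t, Function.update (Function.update c i (c i - t)) j (c j + t), n)) (e := ())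
    (z' := (f (c i), Function.update (Function.update c i 0) j (c j + c i), n))
    (fun t ht => ?_) ?_
  · have h0 : (f 0, c, n) =
        (f 0, Function.update (Function.update c i (c i - 0)) j (c j + 0), n) := by
      rw [Nat.sub_zero, Function.update_eq_self, Nat.add_zero, Function.update_eq_self]
    rw [← h0] at key
    exact key
  · refine (computes_trackZero hWm i).bind ?_
    simp only [Function.update_of_ne hij, Function.update_self]
    rw [decide_eq_false (by omega)]
    simp only [Bool.false_eq_true, if_false]
    refine (computes_trackDec hWm i (c i - (t + 1))
      (by simp only [Function.update_of_ne hij, Function.update_self]; omega)).bind ?_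
    refine (computes_trackInc hWm j
      (by simp only [Function.update_of_ne hij.symm, Function.update_self]; omega)).bind ?_
    rw [hf t ht]
    convert computes_inputOp hWm _ d _ using 3
    funext l
    by_cases hl : l = j
    · subst hl
      simp [Function.update_of_ne hij.symm]
      ring
    · by_cases hl' : l = i
      · subst hl'; simp [Function.update_of_ne hl]
      · simp [Function.update_of_ne hl, Function.update_of_ne hl']
  · refine (computes_trackZero hWm i).bind ?_
    simp only [Function.update_of_ne hij, Function.update_self]
    rw [decide_eq_true (by omega)]
    simp only [if_true, Nat.sub_self]
    exact computes_inputOp hWm _ .zero _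

end Tracks

/-! ### Reading and moving heads whose positions are held by counters. -/

section Heads

open StoreModel

variable {α : Type u} {k N : ℕ} {x : List α} {ω : ℕ → Bool} {Wm : ℕ} {D : ℤ}
  {c : Option (Fin k) → ℕ} {n : ℤ}

/-- Read the symbol at the position that a counter holds. -/
def readTrack (code : α → Fin N) (i : Fin k) : TrackProg α (Option (Fin k)) (Option (Fin N)) :=
  .bind (shiftTrack (some i) none .pos) fun _ =>
  .bind (inputOp (fun a => a.map code) .zero) fun v =>
  .bind (shiftTrack none (some i) .neg) fun _ => inputOp (fun _ => v) .zero

/-- Emptying the counter into the auxiliary one carries the input head from cell `0` to the position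
in question, and refilling it brings the head back. Letters are coded in `Fin N` because exit values
must form a finite type in `Type`. -/
lemma computes_readTrack (hWm : 1 ≤ Wm) (hx : x.length + 1 < 2 ^ Wm) (code : α → Fin N)
    (i : Fin k) (h0 : c none = 0) (hi : c (some i) ≤ x.length + 1) :
    TrackComputes x ω Wm D (readTrack code i) (0, c, n)
      ((inputSymbol x (c (some i))).map code) (0, c, n) := by
  refine (computes_shiftTrack hWm (by simp) (by omega) .pos id fun t ht => ?_).bind ?_
  · change t + 1 = min (t + 1) (x.length + 1)
    omega
  refine (computes_inputOp hWm _ .zero _).bind ?_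
  have h1 := computes_shiftTrack (x := x) (ω := ω) (D := D) (n := n)
    (c := Function.update (Function.update c (some i) 0) none (c none + c (some i)))
    hWm (i := none) (j := some i) (by simp)
    (by simp; omega) .neg (fun t => c (some i) - t) fun t ht => by
      change _ = c (some i) - t - 1
      omega
  refine h1.bind ?_
  have h2 : ((c (some i) - Function.update (Function.update c (some i) 0) none
        (c none + c (some i)) none, Function.update (Function.update (Function.update
        (Function.update c (some i) 0) none (c none + c (some i))) none 0) (some i)
        (Function.update (Function.update c (some i) 0) none (c none + c (some i)) (some i) +
          Function.update (Function.update c (some i) 0) none (c none + c (some i)) none), n) :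
      ℕ × (Option (Fin k) → ℕ) × ℤ) = (0, c, n) := by
    refine Prod.ext ?_ (Prod.ext ?_ rfl)
    · simp [h0]
    · funext l
      rcases l with _ | l
      · simp [h0]
      · by_cases hl : l = i
        · subst hl; simp [h0]
        · simp [hl]
  rw [h2]
  exact computes_inputOp hWm _ .zero _

/-- Read the symbols at the positions that several counters hold. -/
def readTracks (code : α → Fin N) : List (Fin k) → (Fin k → Option (Fin N)) →
    TrackProg α (Option (Fin k)) (Fin k → Option (Fin N))
  | [], cur => inputOp (fun _ => cur) .zero
  | i :: is, cur => .bind (readTrack code i) fun v => readTracks code is (Function.update cur i v)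

lemma computes_readTracks (hWm : 1 ≤ Wm) (hx : x.length + 1 < 2 ^ Wm) (code : α → Fin N)
    (h0 : c none = 0) (hi : ∀ i, c (some i) ≤ x.length + 1) (is : List (Fin k))
    (cur : Fin k → Option (Fin N))
    (hcur : ∀ i ∉ is, cur i = (inputSymbol x (c (some i))).map code) :
    TrackComputes x ω Wm D (readTracks code is cur) (0, c, n)
      (fun i => (inputSymbol x (c (some i))).map code) (0, c, n) := by
  induction is generalizing cur with
  | nil =>
    rw [show (fun i => (inputSymbol x (c (some i))).map code) = cur from
      funext fun i => (hcur i (by simp)).symm]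
    exact computes_inputOp hWm _ .zero _
  | cons i is ih =>
    refine (computes_readTrack hWm hx code i h0 (hi i)).bind (ih _ fun i' hi' => ?_)
    by_cases hii : i' = i
    · subst hii; simp
    · rw [Function.update_of_ne hii]
      exact hcur i' (by simp [hii, hi'])

/-- Move the head whose position a counter holds, and which reads `a`. -/
def moveTrack (i : Fin k) (a : Option (Fin N)) : SignType → TrackProg α (Option (Fin k)) Unit
  | .neg => .bind (trackZero (some i)) fun v =>
      if v then inputOp (fun _ => ()) .zero else trackDec (some i)
  | .zero => inputOp (fun _ => ()) .zero
  | .pos => .bind (trackZero (some i)) fun v =>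
      if a.isNone && !v then inputOp (fun _ => ()) .zero else trackInc (some i)

lemma computes_moveTrack (hWm : 1 ≤ Wm) (hx : x.length + 1 < 2 ^ Wm) (code : α → Fin N)
    (i : Fin k) (d : SignType) (hi : c (some i) ≤ x.length + 1) :
    TrackComputes x ω Wm D (moveTrack i ((inputSymbol x (c (some i))).map code) d) (0, c, n) ()
      (0, Function.update c (some i) (moveInput x.length d (c (some i))), n) := by
  cases d with
  | zero =>
    rw [show moveInput x.length SignType.zero (c (some i)) = c (some i) from rfl,
      Function.update_eq_self]
    exact computes_inputOp hWm (fun _ => ()) .zero (0, c, n)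
  | neg =>
    refine (computes_trackZero hWm (some i)).bind ?_
    by_cases h : c (some i) = 0
    · rw [decide_eq_true h, if_pos rfl,
        show moveInput x.length SignType.neg (c (some i)) = c (some i) by
          change c (some i) - 1 = c (some i); omega, Function.update_eq_self]
      exact computes_inputOp hWm _ .zero _
    · rw [decide_eq_false h, if_neg (by simp)]
      exact computes_trackDec hWm (some i) _ (by change _ = c (some i) - 1 + 1; omega)
  | pos =>
    refine (computes_trackZero hWm (some i)).bind ?_
    -- An end-marker at a nonzero position is the right one; only there is the move cut off.
    rw [Option.isNone_map, inputSymbol_isNone]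
    by_cases h : c (some i) = x.length + 1
    · rw [if_pos (by simp [h]),
        show moveInput x.length SignType.pos (c (some i)) = c (some i) by
          change min (c (some i) + 1) (x.length + 1) = c (some i); omega, Function.update_eq_self]
      exact computes_inputOp hWm _ .zero _
    · rw [if_neg (by simp; omega),
        show moveInput x.length SignType.pos (c (some i)) = c (some i) + 1 by
          change min (c (some i) + 1) (x.length + 1) = c (some i) + 1; omega]
      exact computes_trackInc hWm (some i) (by omega)

/-- Move several heads. -/
def moveTracks (d : Fin k → SignType) (cur : Fin k → Option (Fin N)) :
    List (Fin k) → TrackProg α (Option (Fin k)) Unit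
  | [] => inputOp (fun _ => ()) .zero
  | i :: is => .bind (moveTrack i (cur i) (d i)) fun _ => moveTracks d cur is

lemma computes_moveTracks (hWm : 1 ≤ Wm) (hx : x.length + 1 < 2 ^ Wm) (code : α → Fin N)
    (d : Fin k → SignType) (cur : Fin k → Option (Fin N)) (is : List (Fin k)) (hnd : is.Nodup)
    (hcur : ∀ i ∈ is, cur i = (inputSymbol x (c (some i))).map code)
    (hi : ∀ i, c (some i) ≤ x.length + 1) :
    TrackComputes x ω Wm D (moveTracks d cur is) (0, c, n) ()
      (0, fun i => i.elim (c none) fun i =>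
        if i ∈ is then moveInput x.length (d i) (c (some i)) else c (some i), n) := by
  induction is generalizing c with
  | nil =>
    have h : (fun i : Option (Fin k) => i.elim (c none) fun i => if i ∈ ([] : List (Fin k)) then
        moveInput x.length (d i) (c (some i)) else c (some i)) = c := by
      funext i
      rcases i with _ | i <;> simp
    rw [h]
    exact computes_inputOp hWm (fun _ => ()) .zero (0, c, n)
  | cons i is ih =>
    rw [List.nodup_cons] at hnd
    have h1 := computes_moveTrack (x := x) (ω := ω) (D := D) (n := n) hWm hx code i (d i) (hi i)
    rw [← hcur i (by simp)] at h1
    refine h1.bind ?_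
    have h2 := ih (c := Function.update c (some i) (moveInput x.length (d i) (c (some i))))
      hnd.2 (fun i' hi' => by
        rw [Function.update_of_ne (by simp; rintro rfl; exact hnd.1 hi')]
        exact hcur i' (by simp [hi'])) (fun i' => by
        by_cases h : i' = i
        · subst h
          rw [Function.update_self]
          exact moveInput_le _ (hi i')
        · rw [Function.update_of_ne (by simpa using h)]
          exact hi i')
    convert h2 using 3
    funext i'
    rcases i' with _ | i'
    · simp
    · by_cases h : i' = i
      · subst h; simp [hnd.1]
      · simp [h]

end Heads


/-! ## Multihead automata simulated by probabilistic programs -/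

section Simulation

open StoreModel

variable {α : Type u} {k N : ℕ}

/-- One step of a multihead automaton whose heads read the symbols `cur`. -/
def MultiheadPFA.transition (P : MultiheadPFA α k) (decode : Fin N → α)
    (cur : Fin k → Option (Fin N)) : P.R ⊕ P.D →
      TrackProg α (Option (Fin k)) (((P.R ⊕ P.D) ⊕ Bool) × (Fin k → SignType))
  | .inl q => .op fun o =>
      let r := P.δR q (fun i => (cur i).map decode) o.2.2
      ((r.1.toSum, r.2), o.2.1, .zero, .zero, true)
  | .inr q => .op fun o =>
      let r := P.δD q (fun i => (cur i).map decode)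
      ((r.1.toSum, r.2), o.2.1, .zero, .zero, false)

/-- One step of a multihead automaton. -/
def MultiheadPFA.simulateStep (P : MultiheadPFA α k) [Finite P.R] [Finite P.D] (code : α → Fin N)
    (decode : Fin N → α) (q : P.R ⊕ P.D) :
    TrackProg α (Option (Fin k)) ((P.R ⊕ P.D) ⊕ Bool) :=
  .bind (readTracks code (List.finRange k) fun _ => none) fun cur =>
  .bind (P.transition decode cur q) fun r =>
  .bind (moveTracks r.2 cur (List.finRange k)) fun _ => inputOp (fun _ => r.1) .zero

/-- The simulation of a multihead automaton. -/
def MultiheadPFA.simulate (P : MultiheadPFA α k) [Finite P.R] [Finite P.D] (code : α → Fin N)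
    (decode : Fin N → α) : CoinProg α (Option (Option (Fin k) → Bool)) :=
  .iter (P.simulateStep code decode) P.start

/-- The abstract state of the simulation that belongs to a configuration. -/
def MultiheadPFA.trackConfig {P : MultiheadPFA α k} (C : P.Config × ℕ) :
    ℕ × (Option (Fin k) → ℕ) × ℤ := (0, fun i => i.elim 0 C.1.pos, C.2)

/-- One step of a multihead automaton together with the number of tossed coins. -/
def MultiheadPFA.coinStep {P : MultiheadPFA α k} (x : List α) (ω : ℕ → Bool) (C : P.Config × ℕ) :
    P.Config × ℕ :=
  (C.1.step x (ω C.2), if C.1.tosses then C.2 + 1 else C.2)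

variable {P : MultiheadPFA α k} {x : List α} {ω : ℕ → Bool} {Wm : ℕ} {D : ℤ}

lemma computes_transition [Finite P.R] [Finite P.D] (hWm : 1 ≤ Wm) {code : α → Fin N}
    {decode : Fin N → α} (hdec : ∀ a, decode (code a) = a) {C : P.Config × ℕ} {q : P.R ⊕ P.D}
    (hq : C.1.state = .run q) (hD : ((MultiheadPFA.coinStep x ω C).2 : ℤ) ≤ D) :
    ∃ d, TrackComputes x ω Wm D
      (P.transition decode (fun i => (inputSymbol x (C.1.pos i)).map code) q)
      (MultiheadPFA.trackConfig C) ((MultiheadPFA.coinStep x ω C).1.state.toSum, d)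
      (0, fun i => i.elim 0 C.1.pos, (MultiheadPFA.coinStep x ω C).2) ∧
      ∀ i, (MultiheadPFA.coinStep x ω C).1.pos i = moveInput x.length (d i) (C.1.pos i) := by
  obtain ⟨⟨st, pos⟩, n⟩ := C
  dsimp only at hq
  subst hq
  have hmap : (fun i => ((inputSymbol x (pos i)).map code).map decode) =
      fun i => inputSymbol x (pos i) := by
    funext i
    rw [Option.map_map, show decode ∘ code = id from funext hdec, Option.map_id, id]
  rcases q with q | q
  · refine ⟨(P.δR q (fun i => inputSymbol x (pos i)) (ω n)).2, ?_, fun i => rfl⟩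
    rintro s ⟨hn, W, hW, hc, rfl⟩
    refine ⟨trackStore 0 W (fun i : Option (Fin k) => (i.elim 0 pos).testBit) 0 (n + 1),
      Runs.op' (a := ((trackStore 0 W (fun i : Option (Fin k) => (i.elim 0 pos).testBit) 0 n).tape 0,
        .zero, .zero, true)) ?_ ?_
        (trackBound_trackStore hWm hW hn _ _ (by omega) (by omega))
        (trackBound_trackStore hWm hW ?_ _ _ (by omega) (by omega)), hD, W, hW, hc, ?_⟩
    · dsimp only
      rw [hmap]
      rfl
    · simp only [coinModel, trackStore, coinMove]
      ext1
      · rfl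
      · exact Function.update_eq_self _ _
      · rfl
      · rfl
    · simpa [MultiheadPFA.coinStep, MultiheadPFA.Config.tosses] using hD
    · simp [MultiheadPFA.coinStep, MultiheadPFA.Config.tosses]
  · refine ⟨(P.δD q (fun i => inputSymbol x (pos i))).2, ?_, fun i => rfl⟩
    rintro s ⟨hn, W, hW, hc, rfl⟩
    refine ⟨trackStore 0 W (fun i : Option (Fin k) => (i.elim 0 pos).testBit) 0 n,
      Runs.op' (a := ((trackStore 0 W (fun i : Option (Fin k) => (i.elim 0 pos).testBit) 0 n).tape 0,
        .zero, .zero, false)) ?_ ?_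
        (trackBound_trackStore hWm hW hn _ _ (by omega) (by omega))
        (trackBound_trackStore hWm hW hn _ _ (by omega) (by omega)), hD, W, hW, hc, ?_⟩
    · dsimp only
      rw [hmap]
      rfl
    · simp only [coinModel, trackStore, coinMove]
      ext1
      · rfl
      · exact Function.update_eq_self _ _
      · rfl
      · simp [MultiheadPFA.trackConfig]
    · simp [MultiheadPFA.coinStep, MultiheadPFA.Config.tosses]

lemma computes_simulateMultihead [Finite P.R] [Finite P.D] (hWm : 1 ≤ Wm)
    (hx : x.length + 1 < 2 ^ Wm) {code : α → Fin N} {decode : Fin N → α}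
    (hdec : ∀ a, decode (code a) = a) {C : P.Config × ℕ} {q : P.R ⊕ P.D}
    (hq : C.1.state = .run q) (hpos : ∀ i, C.1.pos i ≤ x.length + 1)
    (hD : ((MultiheadPFA.coinStep x ω C).2 : ℤ) ≤ D) :
    TrackComputes x ω Wm D (P.simulateStep code decode q) (MultiheadPFA.trackConfig C)
      (MultiheadPFA.coinStep x ω C).1.state.toSum
      (MultiheadPFA.trackConfig (MultiheadPFA.coinStep x ω C)) := by
  have := P.finR
  obtain ⟨d, h1, h2⟩ := computes_transition (ω := ω) hWm hdec hq hD
  refine (computes_readTracks hWm hx code rfl hpos _ _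
    fun i hi => absurd (List.mem_finRange i) hi).bind (h1.bind ?_)
  have h3 := computes_moveTracks (x := x) (ω := ω) (D := D)
    (n := (MultiheadPFA.coinStep x ω C).2) (c := fun i => i.elim 0 C.1.pos) hWm hx code d
    (fun i => (inputSymbol x (C.1.pos i)).map code) (List.finRange k) (List.nodup_finRange k)
    (fun i _ => rfl) hpos
  refine h3.bind ?_
  have h4 : MultiheadPFA.trackConfig (MultiheadPFA.coinStep x ω C) = (0, fun i =>
      i.elim 0 fun i => if i ∈ List.finRange k then moveInput x.length (d i) (C.1.pos i)
        else C.1.pos i, ((MultiheadPFA.coinStep x ω C).2 : ℤ)) := by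
    refine Prod.ext rfl (Prod.ext (funext fun i => ?_) rfl)
    rcases i with _ | i
    · rfl
    · refine (h2 i).trans ?_
      simp
  rw [h4]
  exact computes_inputOp hWm _ .zero _

lemma MultiheadPFA.run_succ (P : MultiheadPFA α k) (x : List α) (ω : ℕ → Bool) (t : ℕ) :
    P.run x ω (t + 1) = MultiheadPFA.coinStep x ω (P.run x ω t) := rfl

lemma MultiheadPFA.pos_le (P : MultiheadPFA α k) (x : List α) (ω : ℕ → Bool) (t : ℕ) (i : Fin k) :
    (P.run x ω t).1.pos i ≤ x.length + 1 := by
  induction t with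
  | zero => exact Nat.zero_le _
  | succ t ih =>
    rw [P.run_succ, MultiheadPFA.coinStep]
    generalize P.run x ω t = C at ih
    obtain ⟨⟨st, pos⟩, n⟩ := C
    rcases st with (q | q) | _ | _
    · exact moveInput_le _ ih
    · exact moveInput_le _ ih
    · exact ih
    · exact ih

lemma MultiheadPFA.state_add_of_halted (P : MultiheadPFA α k) {x : List α} {ω : ℕ → Bool} {t : ℕ}
    (h : ∀ q, (P.run x ω t).1.state ≠ .run q) (n : ℕ) :
    (P.run x ω (t + n)).1.state = (P.run x ω t).1.state := by
  induction n with
  | zero => rfl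
  | succ n ih =>
    rw [← Nat.add_assoc, P.run_succ, MultiheadPFA.coinStep]
    rw [← ih] at h ⊢
    rcases hs : (P.run x ω (t + n)).1.state with q | _ | _
    · exact absurd hs (h q)
    · simp [MultiheadPFA.Config.step, hs]
    · simp [MultiheadPFA.Config.step, hs]

lemma Control.toSum_eq_inl {Q : Type} {C : Control Q} {q : Q} (h : C.toSum = .inl q) :
    C = .run q := by
  cases C <;> simp_all [Control.toSum]

lemma Control.toSum_eq_accept {Q : Type} {C : Control Q} (h : C.toSum = .inr true) :
    C = .accept := by
  cases C <;> simp_all [Control.toSum]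

lemma Control.toSum_eq_inr {Q : Type} {C : Control Q} {e : Bool} (h : C.toSum = .inr e) (q : Q) :
    C ≠ .run q := by
  rintro rfl
  simp [Control.toSum] at h

lemma trackState_init {I : Type} (hD : 0 ≤ D) :
    TrackState (I := I) Wm D (CoinStore.init none) (0, fun _ => 0, 0) := by
  refine ⟨hD, 0, Nat.zero_le _, fun _ => by simp, ?_⟩
  simp only [CoinStore.init, trackStore]
  ext1
  · rfl
  · funext z
    dsimp only
    rw [if_neg (by push_cast; omega)]
  · rfl
  · rfl

lemma computes_simulation [Finite P.R] [Finite P.D] (hWm : 1 ≤ Wm)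
    (hx : x.length + 1 < 2 ^ Wm) {code : α → Fin N} {decode : Fin N → α}
    (hdec : ∀ a, decode (code a) = a) (hD : ∀ t, ((P.run x ω t).2 : ℤ) ≤ D) (n t : ℕ)
    (q : P.R ⊕ P.D) (hq : (P.run x ω t).1.state = .run q)
    (hn : ∀ q, (P.run x ω (t + n)).1.state ≠ .run q) :
    ∃ e z, TrackComputes x ω Wm D (.iter (P.simulateStep code decode) q)
        (MultiheadPFA.trackConfig (P.run x ω t)) e z ∧
      ∃ t, (P.run x ω t).1.state.toSum = .inr e := by
  induction n generalizing t q with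
  | zero => exact absurd hq (hn q)
  | succ n ih =>
    have h1 := computes_simulateMultihead (ω := ω) hWm hx hdec hq (P.pos_le x ω t)
      (P.run_succ x ω t ▸ hD (t + 1))
    rw [← P.run_succ] at h1
    rcases hs : (P.run x ω (t + 1)).1.state.toSum with q' | e
    · rw [hs] at h1
      obtain ⟨e, z, h3, h4⟩ := ih (t + 1) q' (Control.toSum_eq_inl hs)
        (by rwa [Nat.add_right_comm])
      refine ⟨e, z, fun s hs => ?_, h4⟩
      obtain ⟨s', h5, h6⟩ := h1 s hs
      obtain ⟨s'', h7, h8⟩ := h3 s' h6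
      exact ⟨s'', h5.iter_next h7, h8⟩
    · rw [hs] at h1
      refine ⟨e, MultiheadPFA.trackConfig (P.run x ω (t + 1)), fun s hs => ?_, t + 1, hs⟩
      obtain ⟨s', h5, h6⟩ := h1 s hs
      exact ⟨s', h5.iter_exit, h6⟩

/-- If the automaton halts, the loop of the simulation exits with the same verdict. If it runs
forever on `ω`, all rounds continue, so the simulation does not accept; the bounds hold then too,
since every round keeps them. -/
lemma MultiheadPFA.simulate_spec (P : MultiheadPFA α k) [Finite P.R] [Finite P.D] (hWm : 1 ≤ Wm)
    (hx : x.length + 1 < 2 ^ Wm) {code : α → Fin N} {decode : Fin N → α}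
    (hdec : ∀ a, decode (code a) = a) (hD : ∀ t, ((P.run x ω t).2 : ℤ) ≤ D) :
    ((P.simulate code decode).Accepts none x ω ↔ P.Accepts x ω) ∧
      ∀ t, TrackBound Wm D ((P.simulate code decode).run none x ω t).2 := by
  have hinit : TrackState Wm D (CoinStore.init none)
      (MultiheadPFA.trackConfig (P.run x ω 0)) := by
    convert trackState_init (I := Option (Fin k)) (Wm := Wm) ((hD 0).trans' (by simp)) using 1
    refine Prod.ext rfl (Prod.ext (funext fun i => ?_) rfl)
    rcases i with _ | i <;> rfl
  by_cases hhalt : ∃ t, ∀ q, (P.run x ω t).1.state ≠ .run q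
  · obtain ⟨n, hn⟩ := hhalt
    obtain ⟨e, z, h1, t, ht⟩ := computes_simulation hWm hx hdec hD n 0 P.start rfl
      (by rwa [Nat.zero_add])
    obtain ⟨s', h2, -⟩ := h1 _ hinit
    refine ⟨(h2.exit_iff true).trans ?_, h2.iterate.2⟩
    constructor
    · rintro rfl
      exact ⟨t, Control.toSum_eq_accept ht⟩
    · rintro ⟨t', ht'⟩
      have h3 : ∀ q, (P.run x ω t').1.state ≠ .run q := fun q => by simp [ht']
      have h4 := P.state_add_of_halted h3 t
      rw [Nat.add_comm, P.state_add_of_halted (Control.toSum_eq_inr ht), ht'] at h4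
      rw [h4] at ht
      exact Sum.inr_injective ht
  · push Not at hhalt
    choose q hq using hhalt
    have h0 : q 0 = P.start := by
      have := (hq 0).symm
      simpa [MultiheadPFA.run, coinRun, MultiheadPFA.init] using this
    have key := Transforms.iter_forever (M := coinModel (Option (Option (Fin k) → Bool)) x ω)
      (R := TrackState Wm D) (P := TrackBound Wm D) (m := P.simulateStep code decode) q
      (fun t => MultiheadPFA.trackConfig (P.run x ω t)) (fun t => ?_) hinit
    · rw [h0] at key
      refine ⟨⟨?_, ?_⟩, fun t => (key t).2⟩
      · rintro ⟨t, ht⟩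
        obtain ⟨⟨q', hq'⟩, -⟩ := key t
        exact absurd (hq'.symm.trans ht) (by simp)
      · rintro ⟨t, ht⟩
        rw [hq] at ht
        cases ht
    · have h1 := computes_simulateMultihead (ω := ω) hWm hx hdec (hq t) (P.pos_le x ω t)
        (P.run_succ x ω t ▸ hD (t + 1))
      rw [← P.run_succ, hq (t + 1)] at h1
      exact h1

end Simulation

/-! ### The inclusions between the classes. -/

/-- Probabilistic multihead automata with logarithmically many random bits can be simulated in
deterministic logarithmic space. -/
theorem logRandomMultiheadPFA_subset_LogSpace (α : Type u) [Finite α] :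
    logRandomMultiheadPFA α ⊆ LogSpace α := by
  rintro L ⟨k, -, P, ⟨C, hC⟩, hL⟩
  have := P.finR
  have := P.finD
  obtain ⟨N, ⟨e⟩⟩ := Finite.exists_equiv_fin α
  have hspec : ∀ (x : List α) (ω : ℕ → Bool), _ := fun x ω =>
    P.simulate_spec (Wm := Nat.log 2 (x.length + 1) + 1)
      (D := ((C * (Nat.log 2 x.length + 1) : ℕ) : ℤ)) (by omega)
      (Nat.lt_pow_succ_log_self (by norm_num) _) (code := e) (decode := e.symm)
      e.symm_apply_apply (fun t => by exact_mod_cast hC x ω t)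
  -- Counters for positions up to `n + 1` have width `Nat.log 2 (n + 1) + 1 ≤ Nat.log 2 n + 2`; the
  -- constant `C + 2` covers this and the coins.
  refine CoinProg.mem_SPACE (m := P.simulate e e.symm) (b := none) L (Nat.log 2) (C + 2)
    (fun x ω t => ?_) fun x => ?_
  · obtain ⟨h1, h2⟩ := (hspec x ω).2 t
    have hlog : Nat.log 2 (x.length + 1) ≤ Nat.log 2 x.length + 1 := by
      rcases Nat.eq_zero_or_pos x.length with h0 | h0
      · simp [h0]
      · rw [← Nat.log_mul_base (by norm_num) h0.ne']
        exact Nat.log_mono_right (by omega)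
    refine ⟨h1.trans ?_, h2.trans ?_⟩
    · have : Nat.log 2 (x.length + 1) + 1 ≤ (C + 2) * (Nat.log 2 x.length + 1) := by nlinarith
      exact_mod_cast this
    · have : C * (Nat.log 2 x.length + 1) ≤ (C + 2) * (Nat.log 2 x.length + 1) :=
        Nat.mul_le_mul_right _ (by omega)
      exact_mod_cast this
  · rw [hL x, MultiheadPFA.acceptProb]
    simp only [(hspec x _).1]

/-- Deterministic multihead automata are probabilistic multihead automata that toss no coins. -/
theorem multiheadDFA_subset_logRandomMultiheadPFA (α : Type u) :
    multiheadDFA α ⊆ logRandomMultiheadPFA α := by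
  rintro L ⟨k, hk, P, hR, hL⟩
  refine ⟨k, hk, P, ⟨0, fun x ω t => ?_⟩, fun x => ?_⟩
  · rw [Nat.zero_mul, Nat.le_zero]
    induction t with
    | zero => rfl
    | succ t ih =>
      rw [P.run_succ, MultiheadPFA.coinStep]
      generalize P.run x ω t = C at ih
      obtain ⟨⟨st, pos⟩, n⟩ := C
      rcases st with (q | q) | _ | _
      · exact hR.elim q
      · exact ih
      · exact ih
      · exact ih
  -- Acceptance does not depend on the coins, so its probability is `0` or `1`.
  · rw [MultiheadPFA.acceptProb]
    simp only [← hL x]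
    by_cases hx : x ∈ L
    · simp [hx]
    · simp [hx]

/-- Derandomization of probabilistic Turing machines with few random bits. -/
theorem ptmClass_subset_SPACE (α : Type u) {r s : ℕ → ℕ}
    (hr : (fun n => (r n : ℝ)) =O[Filter.atTop] (fun n => (s n : ℝ))) :
    ptmClass α r s ⊆ SPACE α s := by
  rintro L ⟨M, hbits, ⟨C, hC⟩, hL⟩
  have := M.finΓ
  obtain ⟨C', hC'⟩ : ∃ C' : ℕ, ∀ n, r n ≤ C' * (s n + 1) := by
    obtain ⟨c, hc⟩ := hr.bound
    obtain ⟨n₀, hn₀⟩ := Filter.eventually_atTop.1 hc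
    -- The sum takes care of the finitely many lengths below `n₀`, where the asymptotic bound says
    -- nothing.
    refine ⟨⌈c⌉₊ + ∑ i ∈ Finset.range n₀, r i, fun n => ?_⟩
    by_cases hn : n < n₀
    · have h1 := Finset.single_le_sum (f := r) (fun i _ => Nat.zero_le _) (Finset.mem_range.2 hn)
      nlinarith
    · have h1 := hn₀ n (by omega)
      rw [Real.norm_natCast, Real.norm_natCast] at h1
      have h2 : (r n : ℝ) ≤ (⌈c⌉₊ * s n : ℕ) := by
        push_cast
        exact h1.trans (by gcongr; exact Nat.le_ceil c)
      have h3 : r n ≤ ⌈c⌉₊ * s n := by exact_mod_cast h2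
      exact h3.trans (Nat.mul_le_mul (Nat.le_add_right _ _) (Nat.le_succ _))
  refine CoinProg.mem_SPACE (m := M.toProg) (b := M.blank) L s (C + C') (fun x ω t => ?_)
    fun x => ?_
  · rw [M.toProg_run]
    refine ⟨(M.abs_workPos_le hC x ω t).trans ?_, ?_⟩
    · have : C * (s x.length + 1) ≤ (C + C') * (s x.length + 1) :=
        Nat.mul_le_mul_right _ (by omega)
      exact_mod_cast this
    · have : (M.run x ω t).2 ≤ (C + C') * (s x.length + 1) :=
        (hbits x ω t).trans ((hC' _).trans (Nat.mul_le_mul_right _ (by omega)))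
      exact Int.ofNat_le.2 this
  · rw [hL x, PTM.acceptProb]
    simp only [M.toProg_accepts]

theorem theorem5p1 {α : Type*} [Finite α] :
    (∀ r s : ℕ → ℕ, SpaceConstructible s → ComputableInSpace r s →
      (fun n => (r n : ℝ)) =O[Filter.atTop] (fun n => (s n : ℝ)) →
      ptmClass α r s ⊆ SPACE α s) ∧
    logRandomMultiheadPFA α = LogSpace α ∧
    logRandomMultiheadPFA α = multiheadDFA α := by
  have h1 := logRandomMultiheadPFA_subset_LogSpace α
  have h2 := LogSpace_subset_multiheadDFA α
  have h3 := multiheadDFA_subset_logRandomMultiheadPFA α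
  exact ⟨fun r s _ _ hr => ptmClass_subset_SPACE α hr, h1.antisymm (h2.trans h3),
    (h1.trans h2).antisymm h3⟩
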